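/- **Setting.** Let $d,G\in\mathbb{N}_0$. Write points of $\mathbb{R}^{2d}$ as $\mathbf z=(\mathbf z_1,\mathbf z_2)$ with $\mathbf z_1,\mathbf z_2\in\mathbb{R}^d$, and set $\langle \mathbf z\rangle=(1+|\mathbf z|^2)^{1/2}$. For a symbol $q:\mathbb{R}^{2d}\to\mathbb{C}$ the Weyl quantisation $\operatorname{op}[q]$ is the bounded operator on $L^2(\mathbb{R}^d)$ given for Schwartz functions $u$ by $$(\operatorname{op}[q]u)(\mathbf x)=\frac1{(2\pi)^d}\int_{\mathbb{R}^d}\int_{\mathbb{R}^d}e^{i(\mathbf x-\mathbf y)\cdot\boldsymbol\xi}\,q\bigl(\tfrac12(\mathbf x+\mathbf y),\boldsymbol\xi\bigr)\,u(\mathbf y)\,d\mathbf y\,d\boldsymbol\xi$$ and extended to $L^2(\mathbb{R}^d)$ by density. Let $\|\cdot\|$ denote the operator norm and $\|\cdot\|_1$ the trace norm. **Lemma.** There are constants $C_{d,G},C'_{d,G}\ge 0$, depending only on $d$ and $G$, such that the following holds. Let $p,q:\mathbb{R}^{2d}\to\mathbb{C}$ be infinitely differentiable functions such that $\partial^{\mathbf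 k}p,\partial^{\mathbf k}q\in L^1(\mathbb{R}^{2d})$ for every $\mathbf k\in\mathbb{N}_0^{2d}$, and let $n\in\mathbb{N}_0$. For $j\in\mathbb{N}_0$ and $\mathbf x,\mathbf y,\mathbf z\in\mathbb{R}^{2d}$ set $$F_j(\mathbf x,\mathbf y)=\frac{i^j}{j!\,2^j}\bigl(\nabla_{\mathbf x_1}\cdot\nabla_{\mathbf y_2}-\nabla_{\mathbf x_2}\cdot\nabla_{\mathbf y_1}\bigr)^j\bigl(p(\mathbf x)q(\mathbf y)\bigr),\qquad c_n(\mathbf z)=\sum_{j=0}^nF_j(\mathbf z,\mathbf z).$$ Then $\operatorname{op}[p]$, $\operatorname{op}[q]$ and $\operatorname{op}[c_n]$ are well defined as bounded operators on $L^2(\mathbb{R}^d)$, and, as inequalities in $[0,\infty]$, $$\bigl\|\operatorname{op}[p]\operatorname{op}[q]-\operatorname{op}[c_n]\bigr\|_1\le C_{d,G}\sum_{\substack{\mathbf m\in\mathbb{N}_0^{4d}\\|\mathbf m|\le G+4d+2}}\int_{\mathbb{R}^{2d}}\int_{\mathbb{R}^{2d}}\frac{|\partial^{\mathbf m}F_{n+1}(\mathbf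 x,\mathbf y)|}{\langle\mathbf x-\mathbf y\rangle^G}\,d\mathbf x\,d\mathbf y,$$ $$\bigl\|\operatorname{op}[p]\operatorname{op}[q]-\operatorname{op}[c_n]\bigr\|\le C'_{d,G}\sum_{\substack{\mathbf m\in\mathbb{N}_0^{4d}\\|\mathbf m|\le G+3d+3}}\int_{\mathbb{R}^{2d}}\Bigl(\sup_{\substack{\mathbf x,\mathbf y\in\mathbb{R}^{2d}\\\mathbf x-\mathbf y=\mathbf v}}\frac{|\partial^{\mathbf m}F_{n+1}(\mathbf x,\mathbf y)|}{\langle\mathbf x-\mathbf y\rangle^G}\Bigr)\,d\mathbf v.$$ -/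

import Mathlib

open MeasureTheory
open scoped ContDiff ENNReal NNReal SchwartzMap

noncomputable section

namespace Weyl

/-- Configuration space `ℝ^d` with the Euclidean norm and Lebesgue measure. -/
abbrev Conf (d : ℕ) : Type := EuclideanSpace ℝ (Fin d)

/-- Phase space `ℝ^{2d}`, a point being written `z = (z₁, z₂)` with `z₁, z₂ ∈ ℝ^d`; its measure is
Lebesgue measure. (The norm that Lean puts on a product is the maximum norm; it is used only for
differentiability, where the choice of norm is irrelevant. The Euclidean length on `ℝ^{2d}` enters
through `japBracket` only.) -/
abbrev Phase (d : ℕ) : Type := Conf d × Conf d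

/-- The Hilbert space `L²(ℝ^d)`. -/
abbrev L2 (d : ℕ) : Type := Lp ℂ 2 (volume : Measure (Conf d))

/-- `⟨z⟩ = (1 + |z|²)^{1/2}`, where `|z|² = |z₁|² + |z₂|²` is the Euclidean length on `ℝ^{2d}`. -/
def japBracket {d : ℕ} (z : Phase d) : ℝ := √(1 + (‖z.1‖ ^ 2 + ‖z.2‖ ^ 2))

/-- The `2d` unit coordinate vectors of phase space: those of `z₁`, then those of `z₂`. -/
def phaseDir {d : ℕ} : Fin d ⊕ Fin d → Phase d :=
  Sum.elim (fun i => (EuclideanSpace.single i 1, 0)) (fun i => (0, EuclideanSpace.single i 1))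

/-- The `4d` unit coordinate vectors of `ℝ^{2d} × ℝ^{2d}`: those of `x`, then those of `y`. -/
def pairDir {d : ℕ} : (Fin d ⊕ Fin d) ⊕ (Fin d ⊕ Fin d) → Phase d × Phase d :=
  Sum.elim (fun a => (phaseDir a, 0)) (fun a => (0, phaseDir a))

section MultiIndex

variable {ι E : Type*} [Fintype ι] [NormedAddCommGroup E] [NormedSpace ℝ E]

/-- The partial derivative `∂^m f`, for a multi-index `m`, with respect to the coordinate vectors
`b i`: the iterated derivative of order `|m| = ∑ i, m i`, evaluated at the tuple that contains each
`b i` exactly `m i` times (the order is irrelevant for smooth `f`). -/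
def multiDeriv (b : ι → E) (m : ι → ℕ) (f : E → ℂ) (x : E) : ℂ :=
  iteratedFDeriv ℝ (Fintype.card (Σ i, Fin (m i))) f x
    (fun k => b ((Fintype.equivFin (Σ i, Fin (m i))).symm k).1)

variable (ι) in
/-- The finite set of multi-indices `m` with `|m| ≤ N`. -/
def multiIndices [DecidableEq ι] (N : ℕ) : Finset (ι → ℕ) :=
  (Fintype.piFinset fun _ : ι => Finset.range (N + 1)).filter fun m => ∑ i, m i ≤ N

theorem mem_multiIndices [DecidableEq ι] {N : ℕ} {m : ι → ℕ} :
    m ∈ multiIndices ι N ↔ ∑ i, m i ≤ N := by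
  simp only [multiIndices, Finset.mem_filter, Fintype.mem_piFinset, Finset.mem_range,
    and_iff_right_iff_imp]
  intro h i
  exact Nat.lt_succ_of_le ((Finset.single_le_sum (fun _ _ => Nat.zero_le _)
    (Finset.mem_univ i)).trans h)

end MultiIndex

/-- The class of symbols: smooth functions on `ℝ^{2d}` all of whose partial derivatives
(including the function itself) are in `L¹(ℝ^{2d})`. -/
def IsSmoothL1 {d : ℕ} (p : Phase d → ℂ) : Prop :=
  ContDiff ℝ ∞ p ∧
    ∀ k : Fin d ⊕ Fin d → ℕ, Integrable (multiDeriv phaseDir k p) (volume : Measure (Phase d))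

/-- The function
`(op[q]u)(x) = (2π)^{-d} ∫ ∫ e^{i (x-y)·ξ} q((x+y)/2, ξ) u(y) dy dξ`. -/
def weylAction {d : ℕ} (q : Phase d → ℂ) (u : Conf d → ℂ) (x : Conf d) : ℂ :=
  (1 / (2 * (Real.pi : ℂ)) ^ d) *
    ∫ ξ : Conf d, ∫ y : Conf d,
      Complex.exp (Complex.I * (inner ℝ (x - y) ξ : ℝ)) * q ((1 / 2 : ℝ) • (x + y), ξ) * u y

/-- The bounded operator `A` on `L²(ℝ^d)` is the Weyl quantisation of `q`: on Schwartz functions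
it is given by the integral formula. -/
def IsWeylOp {d : ℕ} (q : Phase d → ℂ) (A : L2 d →L[ℂ] L2 d) : Prop :=
  ∀ u : 𝓢(Conf d, ℂ), (A (u.toLp 2 volume) : Conf d → ℂ) =ᵐ[volume] weylAction q u

/-- There is at most one such operator, as Schwartz functions are dense. -/
theorem IsWeylOp.unique {d : ℕ} {q : Phase d → ℂ} {A B : L2 d →L[ℂ] L2 d}
    (hA : IsWeylOp q A) (hB : IsWeylOp q B) : A = B := by
  have hd : DenseRange (SchwartzMap.toLpCLM ℝ ℂ 2 (volume : Measure (Conf d))) :=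
    SchwartzMap.denseRange_toLpCLM (by norm_num)
  refine DFunLike.coe_injective (hd.equalizer A.continuous B.continuous ?_)
  funext u
  exact Lp.ext ((hA u).trans (hB u).symm)

open Classical in
/-- The Weyl quantisation `op[q]` as a bounded operator on `L²(ℝ^d)` (the zero operator if `q` has
no bounded quantisation). -/
def op {d : ℕ} (q : Phase d → ℂ) : L2 d →L[ℂ] L2 d :=
  if h : ∃ A, IsWeylOp q A then h.choose else 0

/-- The trace norm `‖A‖₁ ∈ [0, ∞]` of a bounded operator on a Hilbert space: the supremum of
`∑ |⟨f_i, A e_i⟩|` over all pairs of finite orthonormal systems `(e_i)`, `(f_i)` of equal length.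
It is finite exactly for trace class `A`, and then equal to the sum of the singular values. -/
def traceNorm {H : Type*} [NormedAddCommGroup H] [InnerProductSpace ℂ H] (A : H →L[ℂ] H) : ℝ≥0∞ :=
  ⨆ (N : ℕ) (e : Fin N → H) (f : Fin N → H) (_ : Orthonormal ℂ e) (_ : Orthonormal ℂ f),
    ∑ i, ‖inner ℂ (f i) (A (e i))‖ₑ

/-- The partial derivative of a function of `(x, y) ∈ ℝ^{2d} × ℝ^{2d}` in the coordinate `a`. -/
def pairPartial {d : ℕ} (a : (Fin d ⊕ Fin d) ⊕ (Fin d ⊕ Fin d)) (H : Phase d × Phase d → ℂ) :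
    Phase d × Phase d → ℂ :=
  fun w => fderiv ℝ H w (pairDir a)

/-- The operator `∇_{x₁}·∇_{y₂} - ∇_{x₂}·∇_{y₁}` on functions of `(x, y)`. -/
def symplecticDeriv {d : ℕ} (H : Phase d × Phase d → ℂ) : Phase d × Phase d → ℂ :=
  fun w => ∑ i : Fin d,
    (pairPartial (.inl (.inl i)) (pairPartial (.inr (.inr i)) H) w -
      pairPartial (.inl (.inr i)) (pairPartial (.inr (.inl i)) H) w)

/-- `F_j(x, y) = (i^j / (j! 2^j)) (∇_{x₁}·∇_{y₂} - ∇_{x₂}·∇_{y₁})^j (p(x) q(y))`. -/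
def moyalTerm {d : ℕ} (p q : Phase d → ℂ) (j : ℕ) : Phase d × Phase d → ℂ :=
  fun w => (Complex.I ^ j / ((j.factorial : ℂ) * 2 ^ j)) *
    (symplecticDeriv^[j] (fun v => p v.1 * q v.2)) w

/-- `c_n(z) = ∑_{j=0}^n F_j(z, z)`. -/
def moyalSum {d : ℕ} (p q : Phase d → ℂ) (n : ℕ) : Phase d → ℂ :=
  fun z => ∑ j ∈ Finset.range (n + 1), moyalTerm p q j (z, z)

/-- `∑_{|m| ≤ D} ∫ ∫ |∂^m F(x, y)| / ⟨x - y⟩^G dx dy`, in `[0, ∞]`. -/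
def weightedL1 {d : ℕ} (G D : ℕ) (F : Phase d × Phase d → ℂ) : ℝ≥0∞ :=
  ∑ m ∈ multiIndices ((Fin d ⊕ Fin d) ⊕ (Fin d ⊕ Fin d)) D,
    ∫⁻ y : Phase d, ∫⁻ x : Phase d,
      ENNReal.ofReal (‖multiDeriv pairDir m F (x, y)‖ / japBracket (x - y) ^ G)

/-- `∑_{|m| ≤ D} ∫ sup_{x - y = v} (|∂^m F(x, y)| / ⟨x - y⟩^G) dv`, in `[0, ∞]`. -/
def weightedSup {d : ℕ} (G D : ℕ) (F : Phase d × Phase d → ℂ) : ℝ≥0∞ :=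
  ∑ m ∈ multiIndices ((Fin d ⊕ Fin d) ⊕ (Fin d ⊕ Fin d)) D,
    ∫⁻ v : Phase d, ⨆ (x : Phase d) (y : Phase d) (_ : x - y = v),
      ENNReal.ofReal (‖multiDeriv pairDir m F (x, y)‖ / japBracket (x - y) ^ G)

end Weyl

end

noncomputable section

namespace Weyl

set_option linter.unusedSectionVars false

section

/-! ### Characters, symbols and the Fourier integral -/

/-- The character `r ↦ e^{2πir}`. -/
def expChar (r : ℝ) : ℂ := Complex.exp (2 * Real.pi * Complex.I * r)

theorem expChar_eq (r : ℝ) : expChar r = Real.fourierChar r := by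
  rw [Real.fourierChar_apply, expChar]; push_cast; ring_nf

@[simp] theorem norm_expChar (r : ℝ) : ‖expChar r‖ = 1 := by
  rw [expChar, Complex.norm_exp]; simp

@[simp] theorem expChar_zero : expChar 0 = 1 := by simp [expChar]

theorem expChar_add (r s : ℝ) : expChar (r + s) = expChar r * expChar s := by
  simp only [expChar, ← Complex.exp_add]; push_cast; ring_nf

theorem expChar_sub (r s : ℝ) : expChar (r - s) = expChar r * expChar (-s) := by
  rw [sub_eq_add_neg, expChar_add]

@[fun_prop] theorem continuous_expChar : Continuous expChar := by
  unfold expChar; fun_prop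

theorem hasDerivAt_expChar (r : ℝ) :
    HasDerivAt expChar (2 * Real.pi * Complex.I * expChar r) r := by
  have h := Real.hasDerivAt_fourierChar r
  have h2 : (fun x : ℝ => ((Real.fourierChar x : Circle) : ℂ)) = expChar := by
    funext x; rw [expChar_eq]
  rwa [h2, ← expChar_eq] at h

section SL1

variable {X : Type*} [NormedAddCommGroup X] [NormedSpace ℝ X]

/-- The derivative of a function in the direction `e`. -/
def dirDeriv (e : X) (f : X → ℂ) : X → ℂ := fun x => fderiv ℝ f x e

theorem contDiff_dirDeriv {f : X → ℂ} (hf : ContDiff ℝ ∞ f) (e : X) :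
    ContDiff ℝ ∞ (dirDeriv e f) :=
  (hf.fderiv_right (m := ∞) (by simp)).clm_apply contDiff_const

theorem norm_iteratedFDeriv_dirDeriv_le {f : X → ℂ} (hf : ContDiff ℝ ∞ f) (e : X) (k : ℕ) (x : X) :
    ‖iteratedFDeriv ℝ k (dirDeriv e f) x‖ ≤ ‖e‖ * ‖iteratedFDeriv ℝ (k + 1) f x‖ := by
  have h : ContDiff ℝ ∞ (fderiv ℝ f) := hf.fderiv_right (m := ∞) (by simp)
  refine (norm_iteratedFDeriv_clm_apply_const (h.contDiffAt) (n := k)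
    (by exact_mod_cast le_top)).trans ?_
  rw [norm_iteratedFDeriv_fderiv]

theorem contDiff_iterate_dirDeriv {f : X → ℂ} (hf : ContDiff ℝ ∞ f) (e : X) (k : ℕ) :
    ContDiff ℝ ∞ ((dirDeriv e)^[k] f) := by
  induction k with
  | zero => exact hf
  | succ k ih => rw [Function.iterate_succ_apply']; exact contDiff_dirDeriv ih e

theorem norm_iteratedFDeriv_iterate_dirDeriv_le {f : X → ℂ} (hf : ContDiff ℝ ∞ f) (e : X)
    (m k : ℕ) (x : X) :
    ‖iteratedFDeriv ℝ m ((dirDeriv e)^[k] f) x‖ ≤ ‖e‖ ^ k * ‖iteratedFDeriv ℝ (m + k) f x‖ := by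
  induction k generalizing m with
  | zero => simp
  | succ k ih =>
    rw [Function.iterate_succ_apply']
    refine (norm_iteratedFDeriv_dirDeriv_le (contDiff_iterate_dirDeriv hf e k) e m x).trans ?_
    refine (mul_le_mul_of_nonneg_left (ih (m + 1)) (norm_nonneg e)).trans (le_of_eq ?_)
    rw [show m + 1 + k = m + (k + 1) by ring, pow_succ]; ring

theorem continuous_iteratedFDeriv_of_smooth {f : X → ℂ} (hf : ContDiff ℝ ∞ f) (k : ℕ) :
    Continuous (iteratedFDeriv ℝ k f) :=
  hf.continuous_iteratedFDeriv (by exact_mod_cast le_top)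

theorem norm_iteratedFDeriv_mul_le_of_smooth {f g : X → ℂ} (hf : ContDiff ℝ ∞ f)
    (hg : ContDiff ℝ ∞ g) (k : ℕ) (x : X) :
    ‖iteratedFDeriv ℝ k (fun y => f y * g y) x‖ ≤ ∑ i ∈ Finset.range (k + 1),
      (k.choose i : ℝ) * ‖iteratedFDeriv ℝ i f x‖ * ‖iteratedFDeriv ℝ (k - i) g x‖ :=
  norm_iteratedFDeriv_mul_le hf hg x (by exact_mod_cast le_top)

theorem norm_iteratedFDeriv_comp_clm_le {Y : Type*} [NormedAddCommGroup Y] [NormedSpace ℝ Y]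
    {f : X → ℂ} (hf : ContDiff ℝ ∞ f) (L : Y →L[ℝ] X) (k : ℕ) (y : Y) :
    ‖iteratedFDeriv ℝ k (fun z => f (L z)) y‖ ≤ ‖L‖ ^ k * ‖iteratedFDeriv ℝ k f (L y)‖ := by
  have h := L.iteratedFDeriv_comp_right (f := f) hf y (i := k) (by exact_mod_cast le_top)
  change ‖iteratedFDeriv ℝ k (f ∘ L) y‖ ≤ _
  rw [h]
  refine (ContinuousMultilinearMap.norm_compContinuousLinearMap_le _ _).trans ?_
  simp [mul_comm]

variable [MeasureSpace X]

/-- Smooth functions all of whose derivatives are integrable. -/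
def SL1 (f : X → ℂ) : Prop :=
  ContDiff ℝ ∞ f ∧ ∀ k, Integrable (iteratedFDeriv ℝ k f)

variable [BorelSpace X] [FiniteDimensional ℝ X]

theorem SL1.continuous {f : X → ℂ} (hf : SL1 f) : Continuous f := hf.1.continuous

theorem SL1.of_bound {f : X → ℂ} (hf : ContDiff ℝ ∞ f)
    (h : ∀ k, ∃ g : X → ℝ, Integrable g ∧ ∀ x, ‖iteratedFDeriv ℝ k f x‖ ≤ g x) : SL1 f := by
  refine ⟨hf, fun k => ?_⟩
  obtain ⟨g, hg, hb⟩ := h k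
  exact hg.mono' (continuous_iteratedFDeriv_of_smooth hf k).aestronglyMeasurable
    (Filter.Eventually.of_forall hb)

theorem SL1.integrable {f : X → ℂ} (hf : SL1 f) : Integrable f := by
  refine (hf.2 0).norm.mono' hf.continuous.aestronglyMeasurable
    (Filter.Eventually.of_forall fun x => ?_)
  simp

theorem SL1.dirDeriv {f : X → ℂ} (hf : SL1 f) (e : X) : SL1 (dirDeriv e f) :=
  SL1.of_bound (contDiff_dirDeriv hf.1 e) fun k => ⟨_, (hf.2 (k + 1)).norm.const_mul ‖e‖,
    norm_iteratedFDeriv_dirDeriv_le hf.1 e k⟩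

theorem SL1.iterate_dirDeriv {f : X → ℂ} (hf : SL1 f) (e : X) (k : ℕ) :
    SL1 ((Weyl.dirDeriv e)^[k] f) := by
  induction k with
  | zero => exact hf
  | succ k ih => rw [Function.iterate_succ_apply']; exact ih.dirDeriv e

theorem SL1.add {f g : X → ℂ} (hf : SL1 f) (hg : SL1 g) : SL1 (fun x => f x + g x) := by
  refine SL1.of_bound (hf.1.add hg.1) fun k => ⟨_, (hf.2 k).norm.add (hg.2 k).norm, fun x => ?_⟩
  have := iteratedFDeriv_add_apply (𝕜 := ℝ) (i := k) (x := x)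
    (hf.1.contDiffAt.of_le (by exact_mod_cast le_top)) (hg.1.contDiffAt.of_le (by exact_mod_cast le_top))
  change ‖iteratedFDeriv ℝ k (f + g) x‖ ≤ _
  rw [this]
  exact norm_add_le _ _

theorem SL1.const_mul {f : X → ℂ} (hf : SL1 f) (c : ℂ) : SL1 (fun x => c * f x) := by
  refine SL1.of_bound (contDiff_const.mul hf.1) fun k => ⟨_, (hf.2 k).norm.const_mul ‖c‖, fun x => ?_⟩
  have := iteratedFDeriv_const_smul_apply (𝕜 := ℝ) (i := k) (x := x) (a := c)
    (hf.1.contDiffAt.of_le (by exact_mod_cast le_top))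
  change ‖iteratedFDeriv ℝ k (c • f) x‖ ≤ _
  rw [this, norm_smul]

theorem SL1.comp_clm {Y : Type*} [NormedAddCommGroup Y] [NormedSpace ℝ Y] [MeasureSpace Y]
    [BorelSpace Y] [FiniteDimensional ℝ Y] {f : X → ℂ} (hf : SL1 f) (L : Y →L[ℝ] X)
    (hL : MeasurePreserving L) : SL1 (fun y => f (L y)) := by
  refine SL1.of_bound (hf.1.comp L.contDiff) fun k => ⟨_, ?_, norm_iteratedFDeriv_comp_clm_le hf.1 L k⟩
  exact ((hL.integrable_comp (hf.2 k).norm.aestronglyMeasurable).2 (hf.2 k).norm).const_mul _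

theorem SL1.tensor {Y : Type*} [NormedAddCommGroup Y] [NormedSpace ℝ Y] [MeasureSpace Y]
    [BorelSpace Y] [FiniteDimensional ℝ Y] [SFinite (volume : Measure X)]
    [SFinite (volume : Measure Y)] {p : X → ℂ} {q : Y → ℂ}
    (hp : SL1 p) (hq : SL1 q) : SL1 (fun w : X × Y => p w.1 * q w.2) := by
  have h1 : ContDiff ℝ ∞ fun w : X × Y => p w.1 := hp.1.comp contDiff_fst
  have h2 : ContDiff ℝ ∞ fun w : X × Y => q w.2 := hq.1.comp contDiff_snd
  refine SL1.of_bound (h1.mul h2) fun k => ⟨fun w => ∑ i ∈ Finset.range (k + 1),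
      (k.choose i : ℝ) * (‖iteratedFDeriv ℝ i p w.1‖ * ‖iteratedFDeriv ℝ (k - i) q w.2‖), ?_, fun w => ?_⟩
  · exact integrable_finsetSum _ fun i _ => ((hp.2 i).norm.mul_prod (hq.2 (k - i)).norm).const_mul _
  · refine (norm_iteratedFDeriv_mul_le_of_smooth h1 h2 k w).trans ?_
    refine Finset.sum_le_sum fun i _ => ?_
    rw [mul_assoc]
    gcongr
    · refine (norm_iteratedFDeriv_comp_clm_le hp.1 (ContinuousLinearMap.fst ℝ X Y) i w).trans ?_
      exact mul_le_of_le_one_left (norm_nonneg _)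
        (pow_le_one₀ (norm_nonneg _) (ContinuousLinearMap.norm_fst_le ..))
    · refine (norm_iteratedFDeriv_comp_clm_le hq.1 (ContinuousLinearMap.snd ℝ X Y) (k - i) w).trans ?_
      exact mul_le_of_le_one_left (norm_nonneg _)
        (pow_le_one₀ (norm_nonneg _) (ContinuousLinearMap.norm_snd_le ..))

end SL1

section FT

variable {X Y : Type*} [NormedAddCommGroup X] [NormedSpace ℝ X] [MeasureSpace X]
  [NormedAddCommGroup Y] [NormedSpace ℝ Y]

/-- The Fourier transform with respect to the bilinear form `B`. -/
def ft (B : X →L[ℝ] Y →L[ℝ] ℝ) (f : X → ℂ) (w : Y) : ℂ := ∫ v, expChar (-B v w) * f v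

theorem ft_eq (B : X →L[ℝ] Y →L[ℝ] ℝ) (f : X → ℂ) :
    ft B f = VectorFourier.fourierIntegral Real.fourierChar volume B.toLinearMap₁₂ f := by
  funext w
  simp only [ft, VectorFourier.fourierIntegral, Circle.smul_def, expChar_eq, smul_eq_mul]
  rfl

theorem norm_ft_le (B : X →L[ℝ] Y →L[ℝ] ℝ) (f : X → ℂ) (w : Y) :
    ‖ft B f w‖ ≤ ∫ v, ‖f v‖ := by
  refine (norm_integral_le_integral_norm _).trans (le_of_eq ?_)
  simp

variable [BorelSpace X] [FiniteDimensional ℝ X]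

theorem integrable_expChar_mul (L : X →L[ℝ] ℝ) {f : X → ℂ} (hf : Integrable f) :
    Integrable fun v => expChar (-L v) * f v := by
  refine hf.bdd_mul (c := 1) (Continuous.aestronglyMeasurable (by fun_prop)) ?_
  simp

theorem continuous_ft (B : X →L[ℝ] Y →L[ℝ] ℝ) {f : X → ℂ} (hf : Integrable f) :
    Continuous (ft B f) := by
  refine continuous_of_dominated (bound := fun v => ‖f v‖) ?_ ?_ hf.norm ?_
  · exact fun w => (integrable_expChar_mul (B.flip w) hf).aestronglyMeasurable
  · intro w; simp
  · refine Filter.Eventually.of_forall fun v => ?_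
    fun_prop

variable [(volume : Measure X).IsAddHaarMeasure]

theorem ft_dirDeriv (B : X →L[ℝ] Y →L[ℝ] ℝ) {f : X → ℂ} (hf : SL1 f) (e : X) (w : Y) :
    ft B (dirDeriv e f) w = 2 * Real.pi * Complex.I * B e w * ft B f w := by
  have hd : Integrable (fderiv ℝ f) := by
    refine (hf.2 1).norm.mono' ((hf.1.fderiv_right (m := ∞) (by simp)).continuous.aestronglyMeasurable)
      (Filter.Eventually.of_forall fun x => ?_)
    rw [← zero_add 1, ← norm_iteratedFDeriv_fderiv]; simp
  have h := congrFun (VectorFourier.fourierIntegral_fderiv B hf.integrable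
    (hf.1.differentiable (by simp)) hd) w
  have h2 := congrArg (fun T : X →L[ℝ] ℂ => T e) h
  simp only [VectorFourier.fourierSMulRight_apply, ← ft_eq] at h2
  rw [VectorFourier.fourierIntegral, ContinuousLinearMap.integral_apply] at h2
  · simp only [ft, dirDeriv]
    simp only [_root_.smul_apply, Circle.smul_def, smul_eq_mul, ← expChar_eq] at h2
    refine h2.trans ?_
    simp [ft, mul_assoc]
  · refine hd.norm.mono' ?_ (Filter.Eventually.of_forall fun v => by
      rw [Circle.smul_def, norm_smul, ← expChar_eq]; simp)
    have : (fun v => Real.fourierChar (-(B.toLinearMap₁₂ v) w) • fderiv ℝ f v) =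
        fun v => expChar (-B v w) • fderiv ℝ f v := by
      funext v; rw [expChar_eq]; rfl
    rw [this]
    exact (Continuous.aestronglyMeasurable (f := fun v => expChar (-B v w)) (by fun_prop)).smul
      hd.aestronglyMeasurable

theorem ft_iterate_dirDeriv (B : X →L[ℝ] Y →L[ℝ] ℝ) {f : X → ℂ} (hf : SL1 f) (e : X) (k : ℕ) (w : Y) :
    ft B ((dirDeriv e)^[k] f) w = (2 * Real.pi * Complex.I * B e w) ^ k * ft B f w := by
  induction k with
  | zero => simp
  | succ k ih =>
    rw [Function.iterate_succ_apply', ft_dirDeriv B (hf.iterate_dirDeriv e k), ih, pow_succ]; ring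

/-- Every vector of `Y` is detected by a vector of the unit ball of `X`. -/
def Nondeg (B : X →L[ℝ] Y →L[ℝ] ℝ) : Prop :=
  ∃ c : ℝ, 0 < c ∧ ∀ w, ∃ e, ‖e‖ ≤ 1 ∧ c * ‖w‖ ≤ |B e w|

theorem norm_pow_mul_ft_le {B : X →L[ℝ] Y →L[ℝ] ℝ} (hB : Nondeg B) {f : X → ℂ} (hf : SL1 f) (k : ℕ) :
    ∃ C, ∀ w, ‖w‖ ^ k * ‖ft B f w‖ ≤ C := by
  obtain ⟨c, hc, h⟩ := hB
  refine ⟨((2 * Real.pi * c) ^ k)⁻¹ * ∫ v, ‖iteratedFDeriv ℝ k f v‖, fun w => ?_⟩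
  obtain ⟨e, he, hw⟩ := h w
  rw [inv_mul_eq_div, le_div_iff₀ (by positivity)]
  have h1 : ‖ft B ((dirDeriv e)^[k] f) w‖ ≤ ∫ v, ‖iteratedFDeriv ℝ k f v‖ := by
    refine (norm_ft_le _ _ _).trans (integral_mono (hf.iterate_dirDeriv e k).integrable.norm
      (hf.2 k).norm fun v => ?_)
    have := norm_iteratedFDeriv_iterate_dirDeriv_le hf.1 e 0 k v
    rw [zero_add, norm_iteratedFDeriv_zero] at this
    exact this.trans (mul_le_of_le_one_left (norm_nonneg _) (pow_le_one₀ (norm_nonneg _) he))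
  refine le_trans (le_of_le_of_eq (b := (2 * Real.pi * |B e w|) ^ k * ‖ft B f w‖) ?_ ?_) h1
  · calc ‖w‖ ^ k * ‖ft B f w‖ * (2 * Real.pi * c) ^ k
        = (2 * Real.pi * (c * ‖w‖)) ^ k * ‖ft B f w‖ := by rw [mul_pow, mul_pow, mul_pow, mul_pow]; ring
      _ ≤ _ := by gcongr
  · rw [ft_iterate_dirDeriv B hf]
    simp [abs_of_pos Real.pi_pos]

theorem one_add_norm_pow_mul_ft_le {B : X →L[ℝ] Y →L[ℝ] ℝ} (hB : Nondeg B) {f : X → ℂ}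
    (hf : SL1 f) (k : ℕ) : ∃ C, ∀ w, (1 + ‖w‖) ^ k * ‖ft B f w‖ ≤ C := by
  choose C hC using norm_pow_mul_ft_le hB hf
  refine ⟨∑ i ∈ Finset.range (k + 1), C i * (k.choose i), fun w => ?_⟩
  rw [add_comm, add_pow, Finset.sum_mul]
  refine Finset.sum_le_sum fun i _ => ?_
  calc _ = ‖w‖ ^ i * ‖ft B f w‖ * (k.choose i) := by simp; ring
    _ ≤ _ := by gcongr; exact hC i w

variable [MeasureSpace Y] [BorelSpace Y] [FiniteDimensional ℝ Y]
  [(volume : Measure Y).IsAddHaarMeasure]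

theorem integrable_pow_mul_ft {B : X →L[ℝ] Y →L[ℝ] ℝ} (hB : Nondeg B) {f : X → ℂ}
    (hf : SL1 f) (k : ℕ) : Integrable fun w => (1 + ‖w‖) ^ k * ‖ft B f w‖ := by
  obtain ⟨C, hC⟩ := one_add_norm_pow_mul_ft_le hB hf (k + (Module.finrank ℝ Y + 1))
  have h := (integrable_one_add_norm (μ := (volume : Measure Y)) (r := (Module.finrank ℝ Y + 1 : ℕ))
    (by push_cast; linarith)).const_mul C
  have hc := continuous_ft B hf.integrable
  refine h.mono' (Continuous.aestronglyMeasurable (by fun_prop))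
    (Filter.Eventually.of_forall fun w => ?_)
  have hp : 0 < 1 + ‖w‖ := by positivity
  rw [Real.rpow_neg hp.le, Real.rpow_natCast, Real.norm_of_nonneg (by positivity),
    ← div_eq_mul_inv, le_div_iff₀ (by positivity)]
  refine le_trans (le_of_eq ?_) (hC w)
  rw [pow_add]; ring

theorem integrable_ft {B : X →L[ℝ] Y →L[ℝ] ℝ} (hB : Nondeg B) {f : X → ℂ}
    (hf : SL1 f) : Integrable (ft B f) := by
  have := integrable_pow_mul_ft hB hf 0
  simp only [pow_zero, one_mul] at this
  exact (integrable_norm_iff (continuous_ft B hf.integrable).aestronglyMeasurable).1 this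

end FT

end

section

/-! ### Fourier inversion and the Plancherel identity -/

section InnerProduct

open FourierTransform

variable {V : Type*} [NormedAddCommGroup V] [InnerProductSpace ℝ V] [FiniteDimensional ℝ V]
  [MeasurableSpace V] [BorelSpace V]

theorem toLp_fourier_ae_eq {g : V → ℂ} (h1 : Integrable g) (h2 : MemLp g 2) :
    (𝓕 h2.toLp : Lp ℂ 2 (volume : Measure V)) =ᵐ[volume] 𝓕 g := by
  refine ae_eq_of_integral_contDiff_smul_eq ((Lp.memLp _).locallyIntegrable (by norm_num)) ?_ ?_
  · exact (VectorFourier.fourierIntegral_continuous Real.continuous_fourierChar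
      (by exact continuous_inner) h1).locallyIntegrable
  intro ψ hψ hc
  have hψ' : ContDiff ℝ ∞ (fun x => (ψ x : ℂ)) := Complex.ofRealCLM.contDiff.comp hψ
  have hc' : HasCompactSupport (fun x => (ψ x : ℂ)) := hc.comp_left (g := fun r : ℝ => (r : ℂ)) (by simp)
  set Ψ : 𝓢(V, ℂ) := hc'.toSchwartzMap hψ'
  have e1 := congrArg (fun T : 𝓢'(V, ℂ) => T Ψ) (Lp.fourier_toTemperedDistribution_eq h2.toLp)
  simp only [TemperedDistribution.fourier_apply, Lp.toTemperedDistribution_apply] at e1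
  have e2 : ∫ x, (𝓕 Ψ) x • (h2.toLp : V → ℂ) x = ∫ x, 𝓕 (Ψ : V → ℂ) x • g x := by
    refine integral_congr_ae ?_
    filter_upwards [h2.coeFn_toLp] with x hx
    rw [hx, SchwartzMap.fourier_coe]
  have e3 : ∫ x, 𝓕 (Ψ : V → ℂ) x • g x = ∫ x, Ψ x • 𝓕 g x := by
    have := VectorFourier.integral_fourierIntegral_smul_eq_flip (μ := (volume : Measure V))
      (ν := (volume : Measure V)) (L := innerₗ V) (f := (Ψ : V → ℂ)) (g := g)
      Real.continuous_fourierChar continuous_inner Ψ.integrable h1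
    simp only [flip_innerₗ] at this
    exact this
  rw [e2, e3] at e1
  have e4 : ∀ x, Ψ x = (ψ x : ℂ) := fun x => rfl
  simp only [e4] at e1
  simpa using e1.symm

/-- Plancherel's theorem on `L¹ ∩ L²`. -/
theorem lintegral_enorm_fourier_sq {g : V → ℂ} (h1 : Integrable g) (h2 : MemLp g 2) :
    ∫⁻ w, ‖𝓕 g w‖ₑ ^ 2 = ∫⁻ v, ‖g v‖ₑ ^ 2 := by
  have h := toLp_fourier_ae_eq h1 h2
  have e := Lp.norm_fourier_eq h2.toLp
  have e' : ‖(𝓕 h2.toLp : Lp ℂ 2 (volume : Measure V))‖ₑ = ‖h2.toLp‖ₑ := by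
    rw [← ofReal_norm, ← ofReal_norm, e]
  rw [Lp.enorm_def, Lp.enorm_def, eLpNorm_congr_ae h, eLpNorm_congr_ae h2.coeFn_toLp] at e'
  have k (u : V → ℂ) : ∫⁻ w, ‖u w‖ₑ ^ 2 = eLpNorm u 2 volume ^ 2 := by
    rw [eLpNorm_eq_lintegral_rpow_enorm_toReal (by norm_num) (by norm_num), ← ENNReal.rpow_natCast,
      ← ENNReal.rpow_mul]
    simp
  rw [k, k, e']

variable {X : Type*} [NormedAddCommGroup X] [NormedSpace ℝ X] [FiniteDimensional ℝ X]
  [MeasureSpace X] [BorelSpace X]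

theorem ft_comp_equiv {B : X →L[ℝ] X →L[ℝ] ℝ} (T : V ≃L[ℝ] X) (hT : MeasurePreserving T)
    (hB : ∀ v w, B (T v) (T w) = inner ℝ v w) (f : X → ℂ) (w : V) :
    ft B f (T w) = 𝓕 (fun v => f (T v)) w := by
  rw [Real.fourier_eq, ft, ← hT.integral_comp T.toHomeomorph.measurableEmbedding]
  simp only [hB, Circle.smul_def, ← expChar_eq, smul_eq_mul]

theorem inversion_of_equiv {B : X →L[ℝ] X →L[ℝ] ℝ} (T : V ≃L[ℝ] X) (hT : MeasurePreserving T)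
    (hB : ∀ v w, B (T v) (T w) = inner ℝ v w) {f : X → ℂ} (hf : Continuous f) (hfi : Integrable f)
    (hft : Integrable (ft B f)) (x : X) : ∫ w, expChar (B x w) * ft B f w = f x := by
  have hg : Integrable (fun v => f (T v)) :=
    (hT.integrable_comp_emb T.toHomeomorph.measurableEmbedding).2 hfi
  have hF : Integrable (𝓕 (fun v => f (T v))) := by
    have := (hT.integrable_comp_emb T.toHomeomorph.measurableEmbedding).2 hft
    refine this.congr (Filter.Eventually.of_forall fun v => ?_)
    exact ft_comp_equiv T hT hB f v
  have h := congrFun (Continuous.fourierInv_fourier_eq (hf.comp T.continuous) hg hF) (T.symm x)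
  simp only [Function.comp, ContinuousLinearEquiv.apply_symm_apply] at h
  rw [← h, Real.fourierInv_eq, ← hT.integral_comp T.toHomeomorph.measurableEmbedding]
  refine integral_congr_ae (Filter.Eventually.of_forall fun v => ?_)
  simp only [Circle.smul_def, ← expChar_eq, smul_eq_mul]
  have hx : B x (T v) = inner ℝ v (T.symm x) := by
    rw [real_inner_comm, ← hB, T.apply_symm_apply]
  rw [ft_comp_equiv T hT hB, hx]
  rfl

theorem plancherel_of_equiv {B : X →L[ℝ] X →L[ℝ] ℝ} (T : V ≃L[ℝ] X) (hT : MeasurePreserving T)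
    (hB : ∀ v w, B (T v) (T w) = inner ℝ v w) {f : X → ℂ} (hfi : Integrable f) (hf2 : MemLp f 2) :
    ∫⁻ w, ‖ft B f w‖ₑ ^ 2 = ∫⁻ v, ‖f v‖ₑ ^ 2 := by
  have hg : Integrable (fun v => f (T v)) :=
    (hT.integrable_comp_emb T.toHomeomorph.measurableEmbedding).2 hfi
  have hg2 : MemLp (fun v => f (T v)) 2 := hf2.comp_measurePreserving hT
  have := lintegral_enorm_fourier_sq hg hg2
  rw [← hT.lintegral_comp_emb T.toHomeomorph.measurableEmbedding,
    ← hT.lintegral_comp_emb T.toHomeomorph.measurableEmbedding, ← this]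
  simp only [ft_comp_equiv T hT hB]

end InnerProduct

/-- The sum of two bilinear forms on a product. -/
def prodForm {X Y : Type*} [NormedAddCommGroup X] [NormedSpace ℝ X] [NormedAddCommGroup Y]
    [NormedSpace ℝ Y] (B : X →L[ℝ] X →L[ℝ] ℝ) (C : Y →L[ℝ] Y →L[ℝ] ℝ) :
    (X × Y) →L[ℝ] (X × Y) →L[ℝ] ℝ :=
  B.bilinearComp (.fst ℝ X Y) (.fst ℝ X Y) + C.bilinearComp (.snd ℝ X Y) (.snd ℝ X Y)

@[simp] theorem prodForm_apply {X Y : Type*} [NormedAddCommGroup X] [NormedSpace ℝ X]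
    [NormedAddCommGroup Y] [NormedSpace ℝ Y] (B : X →L[ℝ] X →L[ℝ] ℝ) (C : Y →L[ℝ] Y →L[ℝ] ℝ)
    (z w : X × Y) : prodForm B C z w = B z.1 w.1 + C z.2 w.2 := by
  simp [prodForm]

theorem Nondeg.prod {X Y : Type*} [NormedAddCommGroup X] [NormedSpace ℝ X] [NormedAddCommGroup Y]
    [NormedSpace ℝ Y] {B : X →L[ℝ] X →L[ℝ] ℝ} {C : Y →L[ℝ] Y →L[ℝ] ℝ} (hB : Nondeg B)
    (hC : Nondeg C) : Nondeg (prodForm B C) := by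
  obtain ⟨b, hb, h1⟩ := hB
  obtain ⟨c, hc, h2⟩ := hC
  refine ⟨min b c, lt_min hb hc, fun w => ?_⟩
  rcases le_total ‖w.1‖ ‖w.2‖ with h | h
  · obtain ⟨e, he, h3⟩ := h2 w.2
    refine ⟨(0, e), by simpa [Prod.norm_def] using he, ?_⟩
    rw [Prod.norm_def, max_eq_right h]
    simpa using (mul_le_mul_of_nonneg_right (min_le_right b c) (norm_nonneg _)).trans h3
  · obtain ⟨e, he, h3⟩ := h1 w.1
    refine ⟨(e, 0), by simpa [Prod.norm_def] using he, ?_⟩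
    rw [Prod.norm_def, max_eq_left h]
    simpa using (mul_le_mul_of_nonneg_right (min_le_left b c) (norm_nonneg _)).trans h3

variable {d : ℕ}

instance : (volume : Measure (Phase d)).IsAddHaarMeasure := by
  rw [Measure.volume_eq_prod]; infer_instance

instance : (volume : Measure (Phase d × Phase d)).IsAddHaarMeasure := by
  rw [Measure.volume_eq_prod]; exact Measure.prod.instIsAddHaarMeasure _ _

/-- The Euclidean inner product of configuration space as a bilinear form. -/
def confForm (d : ℕ) : Conf d →L[ℝ] Conf d →L[ℝ] ℝ := innerSL ℝ

/-- The Euclidean inner product of phase space. -/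
def phaseForm (d : ℕ) : Phase d →L[ℝ] Phase d →L[ℝ] ℝ := prodForm (confForm d) (confForm d)

/-- The Euclidean inner product of pairs of points of phase space. -/
def pairForm (d : ℕ) : (Phase d × Phase d) →L[ℝ] (Phase d × Phase d) →L[ℝ] ℝ :=
  prodForm (phaseForm d) (phaseForm d)

@[simp] theorem confForm_apply (x y : Conf d) : confForm d x y = inner ℝ x y := rfl

@[simp] theorem phaseForm_apply (z w : Phase d) :
    phaseForm d z w = inner ℝ z.1 w.1 + inner ℝ z.2 w.2 := by simp [phaseForm]

theorem phaseForm_comm (z w : Phase d) : phaseForm d z w = phaseForm d w z := by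
  simp only [phaseForm_apply, real_inner_comm]

@[simp] theorem pairForm_apply (z w : Phase d × Phase d) :
    pairForm d z w = phaseForm d z.1 w.1 + phaseForm d z.2 w.2 := by simp [pairForm]

theorem nondeg_confForm : Nondeg (confForm d) := by
  refine ⟨1, one_pos, fun w => ?_⟩
  by_cases h : w = 0
  · exact ⟨0, by simp, by simp [h]⟩
  · refine ⟨‖w‖⁻¹ • w, ?_, ?_⟩
    · rw [norm_smul, norm_inv, norm_norm, inv_mul_cancel₀ (norm_ne_zero_iff.2 h)]
    · rw [confForm_apply, real_inner_smul_left, real_inner_self_eq_norm_sq, one_mul]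
      rw [abs_of_nonneg (by positivity)]
      have := norm_pos_iff.2 h
      apply le_of_eq; field_simp

theorem nondeg_phaseForm : Nondeg (phaseForm d) := nondeg_confForm.prod nondeg_confForm

theorem nondeg_pairForm : Nondeg (pairForm d) := nondeg_phaseForm.prod nondeg_phaseForm

/-- Phase space as an inner product space. -/
def phaseEquiv (d : ℕ) : WithLp 2 (Phase d) ≃L[ℝ] Phase d :=
  WithLp.prodContinuousLinearEquiv 2 ℝ (Conf d) (Conf d)

theorem measurePreserving_phaseEquiv : MeasurePreserving (phaseEquiv d) :=
  WithLp.volume_preserving_ofLp (Conf d) (Conf d)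

theorem phaseForm_phaseEquiv (v w : WithLp 2 (Phase d)) :
    phaseForm d (phaseEquiv d v) (phaseEquiv d w) = inner ℝ v w := by
  rw [WithLp.prod_inner_apply]; simp [phaseEquiv]

/-- The space of pairs of points of phase space as an inner product space. -/
def pairEquiv (d : ℕ) : WithLp 2 (WithLp 2 (Phase d) × WithLp 2 (Phase d)) ≃L[ℝ] Phase d × Phase d :=
  (WithLp.prodContinuousLinearEquiv 2 ℝ _ _).trans ((phaseEquiv d).prodCongr (phaseEquiv d))

theorem measurePreserving_pairEquiv : MeasurePreserving (pairEquiv d) :=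
  (measurePreserving_phaseEquiv.prod measurePreserving_phaseEquiv).comp
    (WithLp.volume_preserving_ofLp (WithLp 2 (Phase d)) (WithLp 2 (Phase d)))

theorem pairForm_pairEquiv (v w : WithLp 2 (WithLp 2 (Phase d) × WithLp 2 (Phase d))) :
    pairForm d (pairEquiv d v) (pairEquiv d w) = inner ℝ v w := by
  rw [WithLp.prod_inner_apply, ← phaseForm_phaseEquiv, ← phaseForm_phaseEquiv, pairForm_apply]; rfl

theorem phase_inversion {f : Phase d → ℂ} (hf : SL1 f) (z : Phase d) :
    ∫ w, expChar (phaseForm d z w) * ft (phaseForm d) f w = f z :=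
  inversion_of_equiv (phaseEquiv d) measurePreserving_phaseEquiv phaseForm_phaseEquiv
    hf.continuous hf.integrable (integrable_ft nondeg_phaseForm hf) z

theorem pair_inversion {f : Phase d × Phase d → ℂ} (hf : SL1 f) (z : Phase d × Phase d) :
    ∫ w, expChar (pairForm d z w) * ft (pairForm d) f w = f z :=
  inversion_of_equiv (pairEquiv d) measurePreserving_pairEquiv pairForm_pairEquiv
    hf.continuous hf.integrable (integrable_ft nondeg_pairForm hf) z

theorem phase_plancherel {f : Phase d → ℂ} (hf : Integrable f) (hf2 : MemLp f 2) :
    ∫⁻ w, ‖ft (phaseForm d) f w‖ₑ ^ 2 = ∫⁻ v, ‖f v‖ₑ ^ 2 :=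
  plancherel_of_equiv (phaseEquiv d) measurePreserving_phaseEquiv phaseForm_phaseEquiv hf hf2

theorem conf_plancherel {f : Conf d → ℂ} (hf : Integrable f) (hf2 : MemLp f 2) :
    ∫⁻ w, ‖ft (confForm d) f w‖ₑ ^ 2 = ∫⁻ v, ‖f v‖ₑ ^ 2 :=
  plancherel_of_equiv (.refl ℝ (Conf d)) (MeasurePreserving.id _) (fun _ _ => rfl) hf hf2

end

section

/-! ### Derivative bounds -/

section Symbols

variable {X : Type*} [NormedAddCommGroup X] [NormedSpace ℝ X]

/-- Smooth functions all of whose derivatives are dominated by the weight `ρ`. -/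
def DerivBdd (ρ : X → ℝ) (g : X → ℝ) : Prop :=
  ContDiff ℝ ∞ g ∧ ∀ k, ∃ C, 0 ≤ C ∧ ∀ x, ‖iteratedFDeriv ℝ k g x‖ ≤ C * ρ x

theorem DerivBdd.mono {ρ ρ' g : X → ℝ} (h : DerivBdd ρ g) (hρ : ∀ x, ρ x ≤ ρ' x) :
    DerivBdd ρ' g := by
  refine ⟨h.1, fun k => ?_⟩
  obtain ⟨C, h0, hC⟩ := h.2 k
  exact ⟨C, h0, fun x => (hC x).trans (by gcongr; exact hρ x)⟩

theorem DerivBdd.mul {ρ₁ ρ₂ g₁ g₂ : X → ℝ} (h₁ : DerivBdd ρ₁ g₁) (h₂ : DerivBdd ρ₂ g₂) :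
    DerivBdd (fun x => ρ₁ x * ρ₂ x) (fun x => g₁ x * g₂ x) := by
  refine ⟨h₁.1.mul h₂.1, fun k => ?_⟩
  choose C hC0 hC using h₁.2
  choose D hD0 hD using h₂.2
  refine ⟨∑ i ∈ Finset.range (k + 1), (k.choose i : ℝ) * C i * D (k - i),
    Finset.sum_nonneg fun i _ => by have := hC0 i; have := hD0 (k - i); positivity, fun x => ?_⟩
  refine (norm_iteratedFDeriv_mul_le h₁.1 h₂.1 x (by exact_mod_cast le_top)).trans ?_
  rw [Finset.sum_mul]
  refine Finset.sum_le_sum fun i _ => ?_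
  calc _ ≤ (k.choose i : ℝ) * (C i * ρ₁ x) * (D (k - i) * ρ₂ x) := by
        gcongr
        · have := (norm_nonneg _).trans (hC i x); positivity
        · exact hC i x
        · exact hD _ x
    _ = _ := by ring

theorem DerivBdd.add {ρ g₁ g₂ : X → ℝ} (h₁ : DerivBdd ρ g₁) (h₂ : DerivBdd ρ g₂) :
    DerivBdd ρ (fun x => g₁ x + g₂ x) := by
  refine ⟨h₁.1.add h₂.1, fun k => ?_⟩
  obtain ⟨C, hC0, hC⟩ := h₁.2 k
  obtain ⟨D, hD0, hD⟩ := h₂.2 k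
  refine ⟨C + D, by positivity, fun x => ?_⟩
  have := iteratedFDeriv_add_apply (𝕜 := ℝ) (i := k) (x := x)
    (h₁.1.contDiffAt.of_le (by exact_mod_cast le_top)) (h₂.1.contDiffAt.of_le (by exact_mod_cast le_top))
  change ‖iteratedFDeriv ℝ k (g₁ + g₂) x‖ ≤ _
  rw [this, add_mul]
  exact (norm_add_le _ _).trans (add_le_add (hC x) (hD x))

theorem derivBdd_const (c : ℝ) : DerivBdd (fun _ : X => 1) (fun _ => c) := by
  refine ⟨contDiff_const, fun k => ⟨‖c‖, norm_nonneg _, fun x => ?_⟩⟩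
  rcases Nat.eq_zero_or_pos k with rfl | hk
  · simp
  · rw [iteratedFDeriv_const_of_ne hk.ne']; simp

theorem derivBdd_clm (ℓ : X →L[ℝ] ℝ) {ρ : X → ℝ} (h1 : ∀ x, 1 ≤ ρ x) (hℓ : ∀ x, |ℓ x| ≤ ρ x) :
    DerivBdd ρ ℓ := by
  refine ⟨ℓ.contDiff, fun k => ⟨1 + ‖ℓ‖, by positivity, fun x => ?_⟩⟩
  have hρ := (zero_le_one.trans (h1 x))
  rcases k with _ | k
  · rw [norm_iteratedFDeriv_zero, Real.norm_eq_abs]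
    exact (hℓ x).trans (le_mul_of_one_le_left hρ (by linarith [norm_nonneg ℓ]))
  · rw [← norm_iteratedFDeriv_fderiv]
    have : fderiv ℝ ℓ = fun _ => ℓ := by funext y; exact ℓ.fderiv
    rw [this]
    have hb : ‖ℓ‖ ≤ (1 + ‖ℓ‖) * ρ x := by
      nlinarith [norm_nonneg ℓ, h1 x]
    rcases Nat.eq_zero_or_pos k with rfl | hk
    · simpa using hb
    · rw [iteratedFDeriv_const_of_ne hk.ne']; simpa using (norm_nonneg ℓ).trans hb

/-- If `u ≥ 1` and the derivatives of `u` are dominated by `u`, those of `1 / u` are dominated by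
`1 / u`. -/
theorem DerivBdd.inv {u : X → ℝ} (h1 : ∀ x, 0 < u x) (hu : DerivBdd u u) :
    DerivBdd (fun x => (u x)⁻¹) (fun x => (u x)⁻¹) := by
  have hc : ContDiff ℝ ∞ (fun x => (u x)⁻¹) := hu.1.inv fun x => (h1 x).ne'
  refine ⟨hc, fun k => ?_⟩
  induction k using Nat.strong_induction_on with
  | _ k ih =>
    rcases k with _ | k
    · refine ⟨1, zero_le_one, fun x => ?_⟩
      rw [norm_iteratedFDeriv_zero, Real.norm_of_nonneg (inv_nonneg.2 (h1 x).le), one_mul]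
    have hfd : fderiv ℝ (fun x => (u x)⁻¹) = fun x => (-((u x)⁻¹ * (u x)⁻¹)) • fderiv ℝ u x := by
      funext x
      have := ((hasDerivAt_inv (h1 x).ne').comp_hasFDerivAt x
        (hu.1.differentiable (by simp) x).hasFDerivAt).fderiv
      simp only [Function.comp_def] at this
      rw [this]; congr 1; field_simp
    choose! C hC0 hC using ih
    choose D hD0 hD using hu.2
    have hsq : ∀ i ≤ k, ∃ A, 0 ≤ A ∧ ∀ x, ‖iteratedFDeriv ℝ i (fun x => -((u x)⁻¹ * (u x)⁻¹)) x‖ ≤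
        A * ((u x)⁻¹ * (u x)⁻¹) := by
      intro i hi
      refine ⟨∑ j ∈ Finset.range (i + 1), (i.choose j : ℝ) * C j * C (i - j),
        Finset.sum_nonneg fun j hj => ?_, fun x => ?_⟩
      · have hj' := Finset.mem_range.1 hj
        have := hC0 j (by omega); have := hC0 (i - j) (by omega)
        positivity
      · have e : iteratedFDeriv ℝ i (fun x => -((u x)⁻¹ * (u x)⁻¹)) x =
            -iteratedFDeriv ℝ i (fun x => ((u x)⁻¹ * (u x)⁻¹)) x :=
          iteratedFDeriv_neg_apply
        rw [e, norm_neg]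
        refine (norm_iteratedFDeriv_mul_le hc hc x (by exact_mod_cast le_top)).trans ?_
        rw [Finset.sum_mul]
        refine Finset.sum_le_sum fun j hj => ?_
        have hj' := Finset.mem_range.1 hj
        have hux := inv_nonneg.2 (h1 x).le
        have := hC0 j (by omega)
        calc _ ≤ (i.choose j : ℝ) * (C j * (u x)⁻¹) * (C (i - j) * (u x)⁻¹) := by
              gcongr
              · exact hC j (by omega) x
              · exact hC (i - j) (by omega) x
          _ = _ := by ring
    choose! A hA0 hA using hsq
    refine ⟨∑ i ∈ Finset.range (k + 1), (k.choose i : ℝ) * A i * D (k - i + 1),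
      Finset.sum_nonneg fun i hi => ?_, fun x => ?_⟩
    · have hi' := Finset.mem_range.1 hi
      have := hA0 i (by omega); have := hD0 (k - i + 1)
      positivity
    rw [← norm_iteratedFDeriv_fderiv, hfd]
    have hfu : ContDiff ℝ ∞ (fderiv ℝ u) := hu.1.fderiv_right (m := ∞) (by simp)
    refine (norm_iteratedFDeriv_smul_le (hc.mul hc).neg hfu x
      (by exact_mod_cast le_top)).trans ?_
    rw [Finset.sum_mul]
    refine Finset.sum_le_sum fun i hi => ?_
    have hi' := Finset.mem_range.1 hi
    have hux := (h1 x)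
    have := hA0 i (by omega)
    calc _ ≤ (k.choose i : ℝ) * (A i * ((u x)⁻¹ * (u x)⁻¹)) * (D (k - i + 1) * u x) := by
          gcongr
          · exact hA i (by omega) x
          · rw [norm_iteratedFDeriv_fderiv]; exact hD _ x
      _ = _ := by field_simp

theorem contDiff_ofReal {χ : X → ℝ} (hχ : ContDiff ℝ ∞ χ) : ContDiff ℝ ∞ (fun x => (χ x : ℂ)) :=
  Complex.ofRealCLM.contDiff.comp hχ

theorem norm_iteratedFDeriv_ofReal {χ : X → ℝ} (hχ : ContDiff ℝ ∞ χ) (k : ℕ) (x : X) :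
    ‖iteratedFDeriv ℝ k (fun x => (χ x : ℂ)) x‖ = ‖iteratedFDeriv ℝ k χ x‖ :=
  Complex.ofRealLI.norm_iteratedFDeriv_comp_left (hχ.contDiffAt) (by exact_mod_cast le_top)

/-- The sum of the norms of the derivatives of order at most `D`. -/
def derivSum (D : ℕ) (f : X → ℂ) (x : X) : ℝ := ∑ k ∈ Finset.range (D + 1), ‖iteratedFDeriv ℝ k f x‖

theorem derivSum_nonneg (D : ℕ) (f : X → ℂ) (x : X) : 0 ≤ derivSum D f x :=
  Finset.sum_nonneg fun _ _ => norm_nonneg _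

theorem norm_iteratedFDeriv_le_derivSum {D k : ℕ} (hk : k ≤ D) (f : X → ℂ) (x : X) :
    ‖iteratedFDeriv ℝ k f x‖ ≤ derivSum D f x :=
  Finset.single_le_sum (f := fun k => ‖iteratedFDeriv ℝ k f x‖) (fun _ _ => norm_nonneg _)
    (Finset.mem_range.2 (by omega))

theorem derivSum_mono {D D' : ℕ} (h : D ≤ D') (f : X → ℂ) (x : X) :
    derivSum D f x ≤ derivSum D' f x :=
  Finset.sum_le_sum_of_subset_of_nonneg (Finset.range_mono (by omega)) fun _ _ _ => norm_nonneg _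

theorem derivSum_add_le {f g : X → ℂ} (hf : ContDiff ℝ ∞ f) (hg : ContDiff ℝ ∞ g) (D : ℕ) (x : X) :
    derivSum D (fun y => f y + g y) x ≤ derivSum D f x + derivSum D g x := by
  rw [derivSum, derivSum, derivSum, ← Finset.sum_add_distrib]
  refine Finset.sum_le_sum fun k _ => ?_
  have := iteratedFDeriv_add_apply (𝕜 := ℝ) (i := k) (x := x)
    (hf.contDiffAt.of_le (by exact_mod_cast le_top)) (hg.contDiffAt.of_le (by exact_mod_cast le_top))
  change ‖iteratedFDeriv ℝ k (f + g) x‖ ≤ _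
  rw [this]
  exact norm_add_le _ _

theorem derivSum_zero (D : ℕ) (x : X) : derivSum D (fun _ : X => (0 : ℂ)) x = 0 := by
  refine Finset.sum_eq_zero fun k _ => ?_
  have : iteratedFDeriv ℝ k (fun _ : X => (0 : ℂ)) = 0 := iteratedFDeriv_fun_zero
  rw [this]; simp

theorem derivSum_sum_le {ι : Type*} (s : Finset ι) {f : ι → X → ℂ} (hf : ∀ i, ContDiff ℝ ∞ (f i))
    (D : ℕ) (x : X) : derivSum D (fun y => ∑ i ∈ s, f i y) x ≤ ∑ i ∈ s, derivSum D (f i) x := by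
  classical
  induction s using Finset.induction_on with
  | empty => simp [derivSum_zero]
  | insert a s ha ih =>
    simp only [Finset.sum_insert ha]
    exact (derivSum_add_le (hf a) (ContDiff.sum fun i _ => hf i) D x).trans
      (add_le_add le_rfl ih)

theorem derivSum_const_mul {f : X → ℂ} (hf : ContDiff ℝ ∞ f) (c : ℂ) (D : ℕ) (x : X) :
    derivSum D (fun y => c * f y) x = ‖c‖ * derivSum D f x := by
  rw [derivSum, derivSum, Finset.mul_sum]
  refine Finset.sum_congr rfl fun k _ => ?_
  have := iteratedFDeriv_const_smul_apply (𝕜 := ℝ) (i := k) (x := x) (a := c)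
    (hf.contDiffAt.of_le (by exact_mod_cast le_top))
  change ‖iteratedFDeriv ℝ k (c • f) x‖ = _
  rw [this, norm_smul]

theorem derivSum_dirDeriv_le {f : X → ℂ} (hf : ContDiff ℝ ∞ f) (e : X) (D : ℕ) (x : X) :
    derivSum D (dirDeriv e f) x ≤ ‖e‖ * derivSum (D + 1) f x := by
  rw [derivSum, derivSum, Finset.sum_range_succ' _ (D + 1), mul_add, Finset.mul_sum]
  refine le_trans (Finset.sum_le_sum fun k _ => norm_iteratedFDeriv_dirDeriv_le hf e k x) ?_
  exact le_add_of_nonneg_right (by positivity)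

/-- Leibniz' rule for a factor that depends on a linear image of the variable. -/
theorem exists_derivSum_mul_le {Y : Type*} [NormedAddCommGroup Y] [NormedSpace ℝ Y] {ρ χ : Y → ℝ}
    (h : DerivBdd ρ χ) (D : ℕ) : ∃ C, 0 ≤ C ∧ ∀ (a : Y) (L : X →L[ℝ] Y), ‖L‖ ≤ 1 → ∀ f : X → ℂ,
      ContDiff ℝ ∞ f → ∀ x, derivSum D (fun x => (χ (L x + a) : ℂ) * f x) x ≤
        C * ρ (L x + a) * derivSum D f x := by
  choose C hC0 hC using h.2
  refine ⟨∑ k ∈ Finset.range (D + 1), ∑ i ∈ Finset.range (k + 1), (k.choose i : ℝ) * C i,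
    Finset.sum_nonneg fun k _ => Finset.sum_nonneg fun i _ => by have := hC0 i; positivity,
    fun a L hL f hf x => ?_⟩
  have ha : ContDiff ℝ ∞ (fun y => (χ (y + a) : ℂ)) :=
    contDiff_ofReal (h.1.comp (contDiff_id.add contDiff_const))
  have hχ : ContDiff ℝ ∞ (fun x => (χ (L x + a) : ℂ)) := ha.comp L.contDiff
  have hb : ∀ i, ‖iteratedFDeriv ℝ i (fun x => (χ (L x + a) : ℂ)) x‖ ≤ C i * ρ (L x + a) := by
    intro i
    have h1 : ‖iteratedFDeriv ℝ i (fun x => (χ (L x + a) : ℂ)) x‖ ≤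
        ‖L‖ ^ i * ‖iteratedFDeriv ℝ i (fun y => (χ (y + a) : ℂ)) (L x)‖ := by
      have h := L.iteratedFDeriv_comp_right (f := (fun y => (χ (y + a) : ℂ))) ha x (i := i)
        (by exact_mod_cast le_top)
      change ‖iteratedFDeriv ℝ i ((fun y => (χ (y + a) : ℂ)) ∘ L) x‖ ≤ _
      rw [h]
      refine (ContinuousMultilinearMap.norm_compContinuousLinearMap_le _ _).trans ?_
      simp [mul_comm]
    refine h1.trans ((mul_le_of_le_one_left (norm_nonneg _) (pow_le_one₀ (norm_nonneg _) hL)).trans ?_)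
    rw [norm_iteratedFDeriv_ofReal (χ := fun y => χ (y + a))
      (h.1.comp (contDiff_id.add contDiff_const)), iteratedFDeriv_comp_add_right]
    exact hC i _
  rw [derivSum, mul_assoc, Finset.sum_mul]
  refine Finset.sum_le_sum fun k hk => ?_
  rw [Finset.sum_mul]
  refine (norm_iteratedFDeriv_mul_le_of_smooth hχ hf k x).trans (Finset.sum_le_sum fun i hi => ?_)
  have hk' := Finset.mem_range.1 hk
  have := (norm_nonneg _).trans (hb i)
  calc _ ≤ (k.choose i : ℝ) * (C i * ρ (L x + a)) * derivSum D f x := by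
        gcongr
        · exact hb i
        · exact norm_iteratedFDeriv_le_derivSum (by omega) f x
    _ = _ := by ring

end Symbols

end

section

/-! ### The symplectic phase and weighted pairings -/

variable {d : ℕ}

theorem japBracket_sq (z : Phase d) : japBracket z ^ 2 = 1 + (‖z.1‖ ^ 2 + ‖z.2‖ ^ 2) :=
  Real.sq_sqrt (by positivity)

theorem one_le_japBracket (z : Phase d) : 1 ≤ japBracket z := by
  rw [japBracket, Real.one_le_sqrt]
  nlinarith [sq_nonneg ‖z.1‖, sq_nonneg ‖z.2‖]

theorem japBracket_pos (z : Phase d) : 0 < japBracket z := one_pos.trans_le (one_le_japBracket z)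

/-- The coordinate functions of phase space. -/
def coord (k : Fin d ⊕ Fin d) : Phase d →L[ℝ] ℝ := (phaseForm d).flip (phaseDir k)

theorem coord_apply (k : Fin d ⊕ Fin d) (z : Phase d) : coord k z = phaseForm d z (phaseDir k) := rfl

@[simp] theorem coord_inl (i : Fin d) (z : Phase d) : coord (.inl i) z = z.1 i := by
  simp [coord_apply, phaseDir, EuclideanSpace.inner_single_right]

@[simp] theorem coord_inr (i : Fin d) (z : Phase d) : coord (.inr i) z = z.2 i := by
  simp [coord_apply, phaseDir, EuclideanSpace.inner_single_right]

theorem sum_coord_sq (z : Phase d) : ∑ k, coord k z ^ 2 = ‖z.1‖ ^ 2 + ‖z.2‖ ^ 2 := by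
  rw [Fintype.sum_sum_type, EuclideanSpace.real_norm_sq_eq, EuclideanSpace.real_norm_sq_eq]
  simp

theorem abs_coord_le_japBracket (k : Fin d ⊕ Fin d) (z : Phase d) : |coord k z| ≤ japBracket z := by
  refine Real.abs_le_sqrt ?_
  rw [← sum_coord_sq]
  have := Finset.single_le_sum (f := fun k => coord k z ^ 2) (fun _ _ => sq_nonneg _)
    (Finset.mem_univ k)
  linarith

theorem derivBdd_coord (k : Fin d ⊕ Fin d) : DerivBdd japBracket (coord k) :=
  derivBdd_clm _ one_le_japBracket (abs_coord_le_japBracket k)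

theorem DerivBdd.sum {X ι : Type*} [NormedAddCommGroup X] [NormedSpace ℝ X] {ρ : X → ℝ}
    (s : Finset ι)
    {g : ι → X → ℝ} (h : ∀ i, DerivBdd ρ (g i)) : DerivBdd ρ (fun x => ∑ i ∈ s, g i x) := by
  classical
  induction s using Finset.induction_on with
  | empty =>
    refine ⟨by simpa using contDiff_const, fun k => ⟨0, le_rfl, fun x => ?_⟩⟩
    simp only [Finset.sum_empty]
    have : iteratedFDeriv ℝ k (fun _ : X => (0 : ℝ)) = 0 := iteratedFDeriv_fun_zero
    rw [this]; simp
  | insert a s ha ih =>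
    simp only [Finset.sum_insert ha]
    exact (h a).add ih

theorem derivBdd_japBracket_sq :
    DerivBdd (fun z : Phase d => japBracket z ^ 2) (fun z => japBracket z ^ 2) := by
  have h1 : DerivBdd (fun z : Phase d => japBracket z ^ 2) (fun z => ∑ k, coord k z ^ 2) := by
    refine DerivBdd.sum _ fun k => ?_
    simpa only [sq] using (derivBdd_coord k).mul (derivBdd_coord k)
  have h2 : DerivBdd (fun z : Phase d => japBracket z ^ 2) (fun z => 1) :=
    (derivBdd_const 1).mono fun z => by nlinarith [one_le_japBracket z]
  convert h2.add h1 using 2 with z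
  rw [japBracket_sq, sum_coord_sq]

theorem derivBdd_inv_japBracket_sq :
    DerivBdd (fun z : Phase d => (japBracket z ^ 2)⁻¹) (fun z => (japBracket z ^ 2)⁻¹) :=
  derivBdd_japBracket_sq.inv fun z => by have := japBracket_pos z; positivity

/-- The coefficients of the partition `1 = ⟨v⟩⁻² + ∑ₖ vₖ (vₖ ⟨v⟩⁻²)`. -/
def coordQuot (k : Fin d ⊕ Fin d) (z : Phase d) : ℝ := coord k z * (japBracket z ^ 2)⁻¹

theorem partition_japBracket (z : Phase d) :
    (japBracket z ^ 2)⁻¹ + ∑ k, coord k z * coordQuot k z = 1 := by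
  simp only [coordQuot, ← mul_assoc]
  rw [← Finset.sum_mul]
  simp only [← sq]
  rw [sum_coord_sq]
  have h := japBracket_sq z
  have hp : japBracket z ^ 2 ≠ 0 := by have := japBracket_pos z; positivity
  rw [show ‖z.1‖ ^ 2 + ‖z.2‖ ^ 2 = japBracket z ^ 2 - 1 by linarith, sub_mul, mul_inv_cancel₀ hp]
  ring

theorem derivBdd_coordQuot (k : Fin d ⊕ Fin d) :
    DerivBdd (fun z : Phase d => (japBracket z)⁻¹) (coordQuot k) := by
  refine ((derivBdd_coord k).mul derivBdd_inv_japBracket_sq).mono fun z => ?_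
  have := japBracket_pos z
  apply le_of_eq; field_simp

theorem derivBdd_coord_mul_coordQuot (k : Fin d ⊕ Fin d) :
    DerivBdd (fun _ : Phase d => 1) (fun z => coord k z * coordQuot k z) := by
  refine ((derivBdd_coord k).mul (derivBdd_coordQuot k)).mono fun z => ?_
  have := japBracket_pos z
  apply le_of_eq; field_simp

theorem SL1.mul_snd {f : Phase d × Phase d → ℂ} (hf : SL1 f) {ρ χ : Phase d → ℝ}
    (h : DerivBdd ρ χ) (h1 : ∀ z, ρ z ≤ 1) : SL1 (fun w => (χ w.2 : ℂ) * f w) := by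
  have h' := h.mono h1
  refine SL1.of_bound (((contDiff_ofReal h.1).comp contDiff_snd).mul hf.1) fun k => ?_
  obtain ⟨C, h0, hC⟩ := exists_derivSum_mul_le (X := Phase d × Phase d) h' k
  refine ⟨fun w => C * derivSum k f w, ?_, fun w => ?_⟩
  · exact (integrable_finsetSum _ fun i _ => (hf.2 i).norm).const_mul _
  · have := hC 0 (.snd ℝ _ _) (ContinuousLinearMap.norm_snd_le ..) f hf.1 w
    simp only [ContinuousLinearMap.coe_snd', add_zero, mul_one] at this
    exact (norm_iteratedFDeriv_le_derivSum le_rfl _ w).trans this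

/-- The symplectic rotation `(z₁, z₂) ↦ (-z₂, z₁)`. -/
def rot (d : ℕ) : Phase d →L[ℝ] Phase d :=
  (-ContinuousLinearMap.snd ℝ (Conf d) (Conf d)).prod (ContinuousLinearMap.fst ℝ (Conf d) (Conf d))

@[simp] theorem rot_apply (z : Phase d) : rot d z = (-z.2, z.1) := rfl

theorem norm_rot (z : Phase d) : ‖rot d z‖ = ‖z‖ := by
  simp [Prod.norm_def, max_comm]

/-- The symplectic form. -/
def symp (z w : Phase d) : ℝ := phaseForm d (rot d z) w

theorem symp_eq (z w : Phase d) : symp z w = inner ℝ z.1 w.2 - inner ℝ z.2 w.1 := by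
  simp [symp]; ring

/-- The weighted integral of the Fourier transform of `f` against the symplectic phase. -/
def phasePairing (t : ℝ) (x : Phase d → ℂ) (f : Phase d × Phase d → ℂ) : ℂ :=
  ∫ θ : Phase d × Phase d,
    ft (pairForm d) f θ * (expChar (-(Real.pi * t * symp θ.2 θ.1)) * x θ.1)

theorem hasLineDerivAt_ft {X Y : Type*} [NormedAddCommGroup X] [NormedSpace ℝ X] [MeasureSpace X]
    [NormedAddCommGroup Y] [NormedSpace ℝ Y] [BorelSpace X] [FiniteDimensional ℝ X]
    (B : X →L[ℝ] Y →L[ℝ] ℝ) {f : X → ℂ} (hf : Integrable f) {e : Y}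
    (hfe : Integrable fun v => (B v e : ℂ) * f v) (w : Y) :
    HasLineDerivAt ℝ (ft B f)
      (-(2 * Real.pi * Complex.I) * ft B (fun v => (B v e : ℂ) * f v) w) w e := by
  rw [HasLineDerivAt]
  have key := hasDerivAt_integral_of_dominated_loc_of_deriv_le (μ := (volume : Measure X))
    (F := fun (t : ℝ) v => expChar (-B v (w + t • e)) * f v)
    (F' := fun (t : ℝ) v => (2 * Real.pi * Complex.I * expChar (-B v (w + t • e)) * (-(B v e))) * f v)
    (bound := fun v => 2 * Real.pi * ‖(B v e : ℂ) * f v‖) (x₀ := 0) (s := Set.univ)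
    Filter.univ_mem ?_ ?_ ?_ ?_ ?_ ?_
  · have h := key.2
    simp only [zero_smul, add_zero] at h
    refine h.congr_deriv ?_
    rw [ft, ← integral_const_mul]
    refine integral_congr_ae (Filter.Eventually.of_forall fun v => ?_)
    simp only; ring
  · exact Filter.Eventually.of_forall fun t =>
      (integrable_expChar_mul (B.flip (w + t • e)) hf).aestronglyMeasurable
  · exact integrable_expChar_mul (B.flip (w + (0 : ℝ) • e)) hf
  · have := ((integrable_expChar_mul (B.flip (w + (0 : ℝ) • e)) hfe).const_mul
      (-(2 * Real.pi * Complex.I))).aestronglyMeasurable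
    refine this.congr (Filter.Eventually.of_forall fun v => ?_)
    simp only [ContinuousLinearMap.flip_apply]; ring
  · refine Filter.Eventually.of_forall fun v t _ => ?_
    simp only [norm_mul, norm_neg, norm_expChar, Complex.norm_I, Complex.norm_real,
      Complex.norm_ofNat]
    rw [Real.norm_of_nonneg Real.pi_pos.le]
    apply le_of_eq; ring
  · exact hfe.norm.const_mul _
  · refine Filter.Eventually.of_forall fun v t _ => ?_
    have h1 : HasDerivAt (fun t : ℝ => -B v (w + t • e)) (-(B v e)) t := by
      simp only [map_add, map_smul, smul_eq_mul]
      exact (((hasDerivAt_mul_const (B v e)).const_add (B v w))).neg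
    have h2 := (hasDerivAt_expChar (-B v (w + t • e))).scomp t h1
    have h3 := h2.mul_const (f v)
    refine h3.congr_deriv ?_
    rw [Complex.real_smul]; push_cast; ring

theorem integrable_ft_mul {f : Phase d × Phase d → ℂ} (hf : SL1 f) {E : Phase d × Phase d → ℂ}
    (hE : Continuous E) {C : ℝ} (hC : ∀ θ, ‖E θ‖ ≤ C) :
    Integrable fun θ => ft (pairForm d) f θ * E θ :=
  (integrable_ft nondeg_pairForm hf).mul_bdd hE.aestronglyMeasurable (Filter.Eventually.of_forall hC)

@[fun_prop] theorem continuous_symp : Continuous fun p : Phase d × Phase d => symp p.1 p.2 := by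
  simp only [symp_eq]; fun_prop

theorem continuous_phaseFactor (t : ℝ) {x : Phase d → ℂ} (hx : Continuous x) :
    Continuous fun θ : Phase d × Phase d => expChar (-(Real.pi * t * symp θ.2 θ.1)) * x θ.1 := by
  have : Continuous fun θ : Phase d × Phase d => symp θ.2 θ.1 := by
    simp only [symp_eq]; fun_prop
  exact (continuous_expChar.comp (continuous_const.mul this).neg).mul (hx.comp continuous_fst)

theorem norm_phaseFactor_le (t : ℝ) {x : Phase d → ℂ} {C : ℝ} (hC : ∀ α, ‖x α‖ ≤ C)
    (θ : Phase d × Phase d) : ‖expChar (-(Real.pi * t * symp θ.2 θ.1)) * x θ.1‖ ≤ C := by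
  simpa using hC θ.1

theorem phasePairing_add (t : ℝ) {x : Phase d → ℂ} (hx : Continuous x) {C : ℝ}
    (hC : ∀ α, ‖x α‖ ≤ C) {f g : Phase d × Phase d → ℂ} (hf : SL1 f) (hg : SL1 g) :
    phasePairing t x (fun w => f w + g w) = phasePairing t x f + phasePairing t x g := by
  rw [phasePairing, phasePairing, phasePairing, ← integral_add]
  · refine integral_congr_ae (Filter.Eventually.of_forall fun θ => ?_)
    simp only
    rw [← add_mul]; congr 1
    rw [ft, ft, ft, ← integral_add]
    · simp only [mul_add]
    · exact integrable_expChar_mul ((pairForm d).flip θ) hf.integrable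
    · exact integrable_expChar_mul ((pairForm d).flip θ) hg.integrable
  · exact integrable_ft_mul hf (continuous_phaseFactor t hx) (norm_phaseFactor_le t hC)
  · exact integrable_ft_mul hg (continuous_phaseFactor t hx) (norm_phaseFactor_le t hC)

theorem phasePairing_const_mul (t : ℝ) (x : Phase d → ℂ) (c : ℂ) (f : Phase d × Phase d → ℂ) :
    phasePairing t x (fun w => c * f w) = c * phasePairing t x f := by
  rw [phasePairing, phasePairing, ← integral_const_mul]
  refine integral_congr_ae (Filter.Eventually.of_forall fun θ => ?_)
  simp only
  have : ft (pairForm d) (fun w => c * f w) θ = c * ft (pairForm d) f θ := by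
    rw [ft, ft, ← integral_const_mul]
    refine integral_congr_ae (Filter.Eventually.of_forall fun v => ?_)
    simp only; ring
  rw [this]; ring

/-- Integration by parts: multiplication by a coordinate of `v` acts as a derivative in `s`. -/
theorem phasePairing_mul_coord (t : ℝ) {x : Phase d → ℂ} (hx : Continuous x) {C : ℝ}
    (hC : ∀ α, ‖x α‖ ≤ C) {h : Phase d × Phase d → ℂ} (hh : SL1 h) (e : Phase d)
    (he : SL1 fun w => (phaseForm d w.2 e : ℂ) * h w) :
    phasePairing t x (fun w => (phaseForm d w.2 e : ℂ) * h w) =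
      (Complex.I * t / 2) * phasePairing t x (dirDeriv (rot d e, 0) h) := by
  set E : Phase d × Phase d → ℂ := fun θ => expChar (-(Real.pi * t * symp θ.2 θ.1)) * x θ.1
  have hEc : Continuous E := continuous_phaseFactor t hx
  have hEb : ∀ θ, ‖E θ‖ ≤ C := norm_phaseFactor_le t hC
  have hpe : ∀ w : Phase d × Phase d, pairForm d w (0, e) = phaseForm d w.2 e := by
    intro w; rw [pairForm_apply, map_zero, zero_add]
  have hd : ∀ θ, ft (pairForm d) (dirDeriv (rot d e, 0) h) θ =
      2 * Real.pi * Complex.I * symp e θ.1 * ft (pairForm d) h θ := by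
    intro θ
    rw [ft_dirDeriv _ hh, pairForm_apply, map_zero]; simp [symp]
  have h1 : ∀ θ, HasLineDerivAt ℝ (ft (pairForm d) h)
      (-(2 * Real.pi * Complex.I) * ft (pairForm d) (fun w => (phaseForm d w.2 e : ℂ) * h w) θ) θ
      (0, e) := by
    intro θ
    have := hasLineDerivAt_ft (pairForm d) hh.integrable (e := (0, e)) (by simpa only [hpe] using he.integrable) θ
    simpa only [hpe] using this
  have h2 : ∀ θ, HasLineDerivAt ℝ E
      (2 * Real.pi * Complex.I * (-(Real.pi * t * symp e θ.1)) * E θ) θ (0, e) := by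
    intro θ
    rw [HasLineDerivAt]
    have e1 : ∀ r : ℝ, symp (θ + r • ((0 : Phase d), e)).2 (θ + r • ((0 : Phase d), e)).1 =
        symp θ.2 θ.1 + r * symp e θ.1 := by
      intro r
      simp only [symp, Prod.snd_add, Prod.smul_snd, Prod.fst_add, Prod.smul_fst, smul_zero, add_zero,
        map_add, map_smul]
      simp
    have e2 : (fun r : ℝ => E (θ + r • ((0 : Phase d), e))) = fun r =>
        expChar (-(Real.pi * t * (symp θ.2 θ.1 + r * symp e θ.1))) * x θ.1 := by
      funext r
      simp only [E, e1]
      simp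
    rw [e2]
    have h3 : HasDerivAt (fun r : ℝ => -(Real.pi * t * (symp θ.2 θ.1 + r * symp e θ.1)))
        (-(Real.pi * t * symp e θ.1)) 0 :=
      (((hasDerivAt_mul_const (symp e θ.1)).const_add _).const_mul (Real.pi * t)).neg
    have h4 := ((hasDerivAt_expChar _).scomp (0 : ℝ) h3).mul_const (x θ.1)
    refine h4.congr_deriv ?_
    simp only [E, Complex.real_smul, zero_mul, add_zero]
    push_cast; ring
  have i1 := integrable_ft_mul he hEc hEb
  have i2 := integrable_ft_mul (hh.dirDeriv (rot d e, 0)) hEc hEb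
  have i3 := integrable_ft_mul hh hEc hEb
  have key := integral_bilinear_hasLineDerivAt_right_eq_neg_left_of_integrable
    (μ := (volume : Measure (Phase d × Phase d))) (B := ContinuousLinearMap.mul ℝ ℂ)
    (f := ft (pairForm d) h) (g := E) (v := (0, e))
    (f' := fun θ => -(2 * Real.pi * Complex.I) *
      ft (pairForm d) (fun w => (phaseForm d w.2 e : ℂ) * h w) θ)
    (g' := fun θ => 2 * Real.pi * Complex.I * (-(Real.pi * t * symp e θ.1)) * E θ)
    (by simpa only [ContinuousLinearMap.mul_apply', mul_assoc] using i1.const_mul _)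
    (by
      refine (i2.const_mul (-(Real.pi * t : ℂ))).congr (Filter.Eventually.of_forall fun θ => ?_)
      simp only [hd, ContinuousLinearMap.mul_apply']; ring)
    (by simpa only [ContinuousLinearMap.mul_apply'] using i3)
    (fun θ _ => h1 θ) (fun θ _ => h2 θ)
  simp only [ContinuousLinearMap.mul_apply'] at key
  have k1 : ∫ θ, ft (pairForm d) h θ * (2 * Real.pi * Complex.I * (-(Real.pi * t * symp e θ.1)) * E θ) =
      -(Real.pi * t : ℂ) * phasePairing t x (dirDeriv (rot d e, 0) h) := by
    rw [phasePairing, ← integral_const_mul]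
    refine integral_congr_ae (Filter.Eventually.of_forall fun θ => ?_)
    simp only [hd, E]; ring
  have k2 : ∫ θ, -(2 * Real.pi * Complex.I) *
      ft (pairForm d) (fun w => (phaseForm d w.2 e : ℂ) * h w) θ * E θ =
      -(2 * Real.pi * Complex.I) * phasePairing t x (fun w => (phaseForm d w.2 e : ℂ) * h w) := by
    rw [phasePairing, ← integral_const_mul]
    refine integral_congr_ae (Filter.Eventually.of_forall fun θ => ?_)
    simp only [E]; ring
  rw [k1, k2] at key
  have hpi : (Real.pi : ℂ) ≠ 0 := by exact_mod_cast Real.pi_pos.ne'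
  have hI : (2 * Real.pi * Complex.I : ℂ) ≠ 0 := by simp [hpi]
  apply mul_left_cancel₀ hI
  have hII : Complex.I * Complex.I = -1 := Complex.I_mul_I
  linear_combination -key + (-(Real.pi : ℂ) * t * phasePairing t x (dirDeriv (rot d e, 0) h)) * hII

/-- One step of the reduction of the weight. -/
def weightStep (t : ℝ) (f : Phase d × Phase d → ℂ) : Phase d × Phase d → ℂ := fun w =>
  (((japBracket w.2 ^ 2)⁻¹ : ℝ) : ℂ) * f w +
    ∑ k, (Complex.I * t / 2) * dirDeriv (rot d (phaseDir k), 0) (fun w => (coordQuot k w.2 : ℂ) * f w) w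

theorem inv_japBracket_le_one (z : Phase d) : (japBracket z)⁻¹ ≤ 1 :=
  inv_le_one_of_one_le₀ (one_le_japBracket z)

theorem inv_japBracket_sq_le_one (z : Phase d) : (japBracket z ^ 2)⁻¹ ≤ 1 :=
  inv_le_one_of_one_le₀ (one_le_pow₀ (one_le_japBracket z))

theorem SL1.sum {X ι : Type*} [NormedAddCommGroup X] [NormedSpace ℝ X] [MeasureSpace X] [BorelSpace X]
    [FiniteDimensional ℝ X] (s : Finset ι) {g : ι → X → ℂ} (h : ∀ i, SL1 (g i)) :
    SL1 (fun x => ∑ i ∈ s, g i x) := by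
  classical
  induction s using Finset.induction_on with
  | empty =>
    refine SL1.of_bound (by simpa using contDiff_const) fun k => ⟨0, integrable_zero _ _ _, fun x => ?_⟩
    simp only [Finset.sum_empty]
    have : iteratedFDeriv ℝ k (fun _ : X => (0 : ℂ)) = 0 := iteratedFDeriv_fun_zero
    rw [this]; simp
  | insert a s ha ih =>
    simp only [Finset.sum_insert ha]
    exact (h a).add ih

theorem phasePairing_sum {ι : Type*} (s : Finset ι) (t : ℝ) {x : Phase d → ℂ} (hx : Continuous x) {C : ℝ}
    (hC : ∀ α, ‖x α‖ ≤ C) {f : ι → Phase d × Phase d → ℂ} (hf : ∀ i, SL1 (f i)) :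
    phasePairing t x (fun w => ∑ i ∈ s, f i w) = ∑ i ∈ s, phasePairing t x (f i) := by
  classical
  induction s using Finset.induction_on with
  | empty => simp [phasePairing, ft]
  | insert a s ha ih =>
    simp only [Finset.sum_insert ha]
    rw [phasePairing_add t hx hC (hf a) (SL1.sum s hf), ih]

theorem SL1.weightStep (t : ℝ) {f : Phase d × Phase d → ℂ} (hf : SL1 f) : SL1 (weightStep t f) :=
  (hf.mul_snd derivBdd_inv_japBracket_sq inv_japBracket_sq_le_one).add
    (SL1.sum _ fun k => ((hf.mul_snd (derivBdd_coordQuot k) inv_japBracket_le_one).dirDeriv _).const_mul _)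

theorem phasePairing_weightStep (t : ℝ) {x : Phase d → ℂ} (hx : Continuous x) {C : ℝ}
    (hC : ∀ α, ‖x α‖ ≤ C) {f : Phase d × Phase d → ℂ} (hf : SL1 f) :
    phasePairing t x (weightStep t f) = phasePairing t x f := by
  have a1 := hf.mul_snd derivBdd_inv_japBracket_sq inv_japBracket_sq_le_one
  have a2 k := hf.mul_snd (derivBdd_coordQuot k) inv_japBracket_le_one
  have a3 k : SL1 fun w : Phase d × Phase d => (phaseForm d w.2 (phaseDir k) : ℂ) * ((coordQuot k w.2 : ℂ) * f w) := by
    have := hf.mul_snd (derivBdd_coord_mul_coordQuot k) (fun _ => le_rfl)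
    convert this using 2 with w
    rw [← mul_assoc, ← coord_apply]; push_cast; rfl
  have e : f = fun w => (((japBracket w.2 ^ 2)⁻¹ : ℝ) : ℂ) * f w +
      ∑ k, (phaseForm d w.2 (phaseDir k) : ℂ) * ((coordQuot k w.2 : ℂ) * f w) := by
    funext w
    have h := congrArg (fun r : ℝ => (r : ℂ)) (partition_japBracket w.2)
    simp only [coord_apply] at h
    simp only [← mul_assoc]
    rw [← Finset.sum_mul, ← add_mul]
    push_cast at h ⊢
    rw [h, one_mul]
  have r1 : phasePairing t x (weightStep t f) =
      phasePairing t x (fun w => (((japBracket w.2 ^ 2)⁻¹ : ℝ) : ℂ) * f w) +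
      ∑ k, (Complex.I * t / 2) * phasePairing t x
        (dirDeriv (rot d (phaseDir k), 0) (fun w => (coordQuot k w.2 : ℂ) * f w)) := by
    refine (phasePairing_add t hx hC a1 (SL1.sum _ fun k => ((a2 k).dirDeriv _).const_mul _)).trans ?_
    rw [phasePairing_sum _ t hx hC fun k => ((a2 k).dirDeriv _).const_mul _]
    simp only [phasePairing_const_mul]
  have r2 : phasePairing t x f =
      phasePairing t x (fun w => (((japBracket w.2 ^ 2)⁻¹ : ℝ) : ℂ) * f w) +
      ∑ k, phasePairing t x
        (fun w => (phaseForm d w.2 (phaseDir k) : ℂ) * ((coordQuot k w.2 : ℂ) * f w)) := by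
    conv_lhs => rw [e]
    rw [phasePairing_add t hx hC a1 (SL1.sum _ a3), phasePairing_sum _ t hx hC a3]
  rw [r1, r2]
  congr 1
  exact Finset.sum_congr rfl fun k _ => (phasePairing_mul_coord t hx hC (a2 k) _ (a3 k)).symm

theorem exists_derivSum_weightStep_le (d D : ℕ) : ∃ C, 0 ≤ C ∧ ∀ t : ℝ, |t| ≤ 1 →
    ∀ f : Phase d × Phase d → ℂ, ContDiff ℝ ∞ f → ∀ w,
      derivSum D (weightStep t f) w ≤ C * derivSum (D + 1) f w * (japBracket w.2)⁻¹ := by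
  obtain ⟨C₀, h0, hC₀⟩ := exists_derivSum_mul_le (X := Phase d × Phase d)
    (derivBdd_inv_japBracket_sq (d := d)) D
  choose C h1 hC using fun k : Fin d ⊕ Fin d =>
    exists_derivSum_mul_le (X := Phase d × Phase d) (derivBdd_coordQuot k) (D + 1)
  refine ⟨C₀ + ∑ k, ‖((rot d (phaseDir k), 0) : Phase d × Phase d)‖ * C k,
    add_nonneg h0 (Finset.sum_nonneg fun k _ => mul_nonneg (norm_nonneg _) (h1 k)),
    fun t ht f hf w => ?_⟩
  have hs : ‖ContinuousLinearMap.snd ℝ (Phase d) (Phase d)‖ ≤ 1 := ContinuousLinearMap.norm_snd_le ..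
  have b0 := hC₀ 0 _ hs f hf w
  have bk k := hC k 0 _ hs f hf w
  simp only [ContinuousLinearMap.coe_snd', add_zero] at b0 bk
  have c0 : ContDiff ℝ ∞ fun w : Phase d × Phase d => (((japBracket w.2 ^ 2)⁻¹ : ℝ) : ℂ) * f w :=
    ((contDiff_ofReal derivBdd_inv_japBracket_sq.1).comp contDiff_snd).mul hf
  have ck k : ContDiff ℝ ∞ fun w : Phase d × Phase d => (coordQuot k w.2 : ℂ) * f w :=
    ((contDiff_ofReal (derivBdd_coordQuot k).1).comp contDiff_snd).mul hf
  have hj := japBracket_pos w.2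
  have hn := derivSum_nonneg (D + 1) f w
  refine (derivSum_add_le c0 (ContDiff.sum fun k _ => contDiff_const.mul
    (contDiff_dirDeriv (ck k) _)) D w).trans ?_
  rw [add_mul, add_mul]
  refine add_le_add ?_ ?_
  · refine b0.trans ?_
    rw [mul_right_comm]
    gcongr
    · exact derivSum_mono (by omega) f w
    · nlinarith [one_le_japBracket w.2]
  · refine (derivSum_sum_le _ (fun k => contDiff_const.mul (contDiff_dirDeriv (ck k) _)) D w).trans ?_
    rw [Finset.sum_mul, Finset.sum_mul]
    refine Finset.sum_le_sum fun k _ => ?_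
    rw [derivSum_const_mul (contDiff_dirDeriv (ck k) _)]
    have hc : ‖Complex.I * t / 2‖ ≤ 1 := by
      simp only [norm_div, norm_mul, Complex.norm_I, Complex.norm_real, Real.norm_eq_abs, Complex.norm_ofNat]
      linarith
    refine (mul_le_of_le_one_left (derivSum_nonneg _ _ _) hc).trans ?_
    refine (derivSum_dirDeriv_le (ck k) _ D w).trans ?_
    calc _ ≤ ‖((rot d (phaseDir k), 0) : Phase d × Phase d)‖ *
          (C k * (japBracket w.2)⁻¹ * derivSum (D + 1) f w) := by gcongr; exact bk k
      _ = _ := by ring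

/-- The weight can be traded for derivatives without changing the pairing. -/
theorem exists_weighted (d G D : ℕ) : ∃ C, 0 ≤ C ∧ ∀ t : ℝ, |t| ≤ 1 →
    ∀ f : Phase d × Phase d → ℂ, SL1 f → ∃ h, SL1 h ∧
      (∀ x : Phase d → ℂ, Continuous x → ∀ B, (∀ α, ‖x α‖ ≤ B) →
        phasePairing t x h = phasePairing t x f) ∧
      ∀ w, derivSum D h w ≤ C * (derivSum (G + D) f w / japBracket w.2 ^ G) := by
  induction G generalizing D with
  | zero => exact ⟨1, zero_le_one, fun t _ f hf => ⟨f, hf, fun _ _ _ _ => rfl, fun w => by simp⟩⟩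
  | succ G ih =>
    obtain ⟨A, hA0, hA⟩ := exists_derivSum_weightStep_le d D
    obtain ⟨C, hC0, hC⟩ := ih (D + 1)
    refine ⟨A * C, by positivity, fun t ht f hf => ?_⟩
    obtain ⟨h, hh, h1, h2⟩ := hC t ht f hf
    refine ⟨weightStep t h, hh.weightStep t, fun x hx B hB => ?_, fun w => ?_⟩
    · rw [phasePairing_weightStep t hx hB hh, h1 x hx B hB]
    · refine (hA t ht h hh.1 w).trans ?_
      have hj := japBracket_pos w.2
      calc _ ≤ A * (C * (derivSum (G + (D + 1)) f w / japBracket w.2 ^ G)) * (japBracket w.2)⁻¹ := by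
            gcongr; exact h2 w
        _ = _ := by
            rw [show G + (D + 1) = G + 1 + D by ring, pow_succ, ← div_div]
            rw [div_eq_mul_inv _ (japBracket w.2)]; ring

end

section

/-! ### Localisation in the first variable -/

variable {d : ℕ}

/-- The polynomial weight `(1 + ‖x‖)^{-p}`. -/
def decay {X : Type*} [NormedAddCommGroup X] (p : ℕ) (x : X) : ℝ := ((1 + ‖x‖) ^ p)⁻¹

theorem decay_pos {X : Type*} [NormedAddCommGroup X] (p : ℕ) (x : X) : 0 < decay p x := by
  have := norm_nonneg x
  rw [decay]; positivity

theorem decay_le_one {X : Type*} [NormedAddCommGroup X] (p : ℕ) (x : X) : decay p x ≤ 1 := by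
  refine inv_le_one_of_one_le₀ (one_le_pow₀ ?_)
  linarith [norm_nonneg x]

@[fun_prop] theorem continuous_decay {X : Type*} [NormedAddCommGroup X] (p : ℕ) :
    Continuous (decay p : X → ℝ) := by
  unfold decay
  refine Continuous.inv₀ (by fun_prop) fun x => ?_
  have := norm_nonneg x
  positivity

theorem lintegral_decay_lt_top {X : Type*} [NormedAddCommGroup X] [NormedSpace ℝ X]
    [FiniteDimensional ℝ X] [MeasureSpace X] [BorelSpace X] [(volume : Measure X).IsAddHaarMeasure]
    {p : ℕ} (hp : Module.finrank ℝ X < p) : ∫⁻ x : X, ENNReal.ofReal (decay p x) < ⊤ := by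
  have := finite_integral_one_add_norm (μ := (volume : Measure X)) (r := p) (by exact_mod_cast hp)
  refine lt_of_eq_of_lt ?_ this
  refine lintegral_congr fun x => ?_
  rw [decay, Real.rpow_neg (by positivity), Real.rpow_natCast]

theorem finrank_phase (d : ℕ) : Module.finrank ℝ (Phase d) = 2 * d := by
  rw [Module.finrank_prod, finrank_euclideanSpace, Fintype.card_fin]; ring

/-- The Gaussian window on phase space. -/
def gauss (z : Phase d) : ℝ := Real.exp (-(‖z.1‖ ^ 2 + ‖z.2‖ ^ 2))

theorem gauss_pos (z : Phase d) : 0 < gauss z := Real.exp_pos _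

theorem gauss_le_one (z : Phase d) : gauss z ≤ 1 := by
  rw [gauss, Real.exp_le_one_iff]; nlinarith [sq_nonneg ‖z.1‖, sq_nonneg ‖z.2‖]

@[fun_prop] theorem continuous_gauss : Continuous (gauss : Phase d → ℝ) := by
  unfold gauss; fun_prop

theorem gauss_eq (z : Phase d) : gauss z = Real.exp (1 - japBracket z ^ 2) := by
  rw [japBracket_sq, gauss]; ring_nf

theorem exists_norm_iteratedFDeriv_gauss_le (k : ℕ) : ∃ C, 0 ≤ C ∧ ∀ z : Phase d,
    ‖iteratedFDeriv ℝ k gauss z‖ ≤ C * ((japBracket z ^ 2) ^ k * gauss z) := by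
  have hu := derivBdd_japBracket_sq (d := d)
  have hg : ContDiff ℝ ∞ (gauss : Phase d → ℝ) := by
    have : (gauss : Phase d → ℝ) = fun z => Real.exp (1 - japBracket z ^ 2) := funext gauss_eq
    rw [this]
    exact (contDiff_const.sub hu.1).exp
  induction k using Nat.strong_induction_on with
  | _ k ih =>
    rcases k with _ | k
    · exact ⟨1, zero_le_one, fun z => by
        rw [norm_iteratedFDeriv_zero, Real.norm_of_nonneg (gauss_pos z).le]; simp⟩
    have hfd : fderiv ℝ (gauss : Phase d → ℝ) =
        fun z => (-gauss z) • fderiv ℝ (fun z => japBracket z ^ 2) z := by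
      funext z
      have h1 : HasFDerivAt (fun z : Phase d => 1 - japBracket z ^ 2)
          (-fderiv ℝ (fun z => japBracket z ^ 2) z) z :=
        (hu.1.differentiable (by simp) z).hasFDerivAt.const_sub 1
      have h2 := h1.exp.fderiv
      have : (gauss : Phase d → ℝ) = fun z => Real.exp (1 - japBracket z ^ 2) := funext gauss_eq
      rw [this, h2, smul_neg]; exact (neg_smul _ _).symm
    choose! C hC0 hC using ih
    choose D hD0 hD using hu.2
    refine ⟨∑ i ∈ Finset.range (k + 1), (k.choose i : ℝ) * C i * D (k - i + 1),
      Finset.sum_nonneg fun i hi => ?_, fun z => ?_⟩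
    · have hi' := Finset.mem_range.1 hi
      have := hC0 i (by omega); have := hD0 (k - i + 1)
      positivity
    rw [← norm_iteratedFDeriv_fderiv, hfd]
    have hfu : ContDiff ℝ ∞ (fderiv ℝ (fun z : Phase d => japBracket z ^ 2)) :=
      hu.1.fderiv_right (m := ∞) (by simp)
    refine (norm_iteratedFDeriv_smul_le hg.neg hfu z (by exact_mod_cast le_top)).trans ?_
    rw [Finset.sum_mul]
    refine Finset.sum_le_sum fun i hi => ?_
    have hi' := Finset.mem_range.1 hi
    have hj : 1 ≤ japBracket z ^ 2 := one_le_pow₀ (one_le_japBracket z)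
    have h0 := hC0 i (by omega)
    have h0' := hD0 (k - i + 1)
    have hgp := gauss_pos z
    have e : iteratedFDeriv ℝ i (fun z : Phase d => -gauss z) z = -iteratedFDeriv ℝ i gauss z :=
      iteratedFDeriv_neg_apply
    rw [e, norm_neg, norm_iteratedFDeriv_fderiv]
    calc _ ≤ (k.choose i : ℝ) * (C i * ((japBracket z ^ 2) ^ i * gauss z)) *
            (D (k - i + 1) * japBracket z ^ 2) := by
          gcongr
          · exact hC i (by omega) z
          · exact hD _ z
      _ = (k.choose i : ℝ) * C i * D (k - i + 1) * ((japBracket z ^ 2) ^ (i + 1) * gauss z) := by ring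
      _ ≤ _ := by gcongr <;> first | exact hj | omega

theorem one_add_norm_le_japBracket (z : Phase d) : 1 + ‖z‖ ≤ 2 * japBracket z := by
  have h : ‖z‖ ≤ japBracket z := by
    refine Real.le_sqrt_of_sq_le ?_
    rcases le_total ‖z.1‖ ‖z.2‖ with h | h
    · rw [Prod.norm_def, max_eq_right h]; nlinarith [sq_nonneg ‖z.1‖]
    · rw [Prod.norm_def, max_eq_left h]; nlinarith [sq_nonneg ‖z.2‖]
  linarith [one_le_japBracket z]

theorem derivBdd_gauss (p : ℕ) : DerivBdd (decay p) (gauss : Phase d → ℝ) := by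
  have hg : ContDiff ℝ ∞ (gauss : Phase d → ℝ) := by
    have : (gauss : Phase d → ℝ) = fun z => Real.exp (1 - japBracket z ^ 2) := funext gauss_eq
    rw [this]
    exact (contDiff_const.sub derivBdd_japBracket_sq.1).exp
  refine ⟨hg, fun k => ?_⟩
  obtain ⟨C, hC0, hC⟩ := exists_norm_iteratedFDeriv_gauss_le (d := d) k
  refine ⟨C * (2 ^ p * ((k + p).factorial * Real.exp 1)), by positivity, fun z => (hC z).trans ?_⟩
  rw [mul_assoc]
  refine mul_le_mul_of_nonneg_left ?_ hC0
  have hn := norm_nonneg z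
  rw [decay, ← div_eq_mul_inv, le_div_iff₀ (by positivity)]
  have hj : 1 ≤ japBracket z := one_le_japBracket z
  have h1 : (1 + ‖z‖) ^ p ≤ 2 ^ p * (japBracket z ^ 2) ^ p := by
    rw [← mul_pow]
    refine pow_le_pow_left₀ (by positivity) ((one_add_norm_le_japBracket z).trans ?_) p
    nlinarith
  have h2 : (japBracket z ^ 2) ^ (k + p) ≤ (k + p).factorial * Real.exp (japBracket z ^ 2) := by
    have := Real.pow_div_factorial_le_exp (japBracket z ^ 2) (by positivity) (k + p)
    rwa [div_le_iff₀ (by positivity), mul_comm] at this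
  have hgp := gauss_pos z
  calc _ ≤ (japBracket z ^ 2) ^ k * gauss z * (2 ^ p * (japBracket z ^ 2) ^ p) := by gcongr
    _ = 2 ^ p * ((japBracket z ^ 2) ^ (k + p) * gauss z) := by ring
    _ ≤ 2 ^ p * ((k + p).factorial * Real.exp (japBracket z ^ 2) * gauss z) := by gcongr
    _ = _ := by
      rw [gauss_eq, mul_assoc ((k + p).factorial : ℝ), ← Real.exp_add]; ring_nf

/-- The function `f` localised in its first variable near `a`. -/
def windowed (f : Phase d × Phase d → ℂ) (a : Phase d) : Phase d × Phase d → ℂ :=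
  fun w => (gauss (w.1 + -a) : ℂ) * f w

theorem contDiff_windowed {f : Phase d × Phase d → ℂ} (hf : ContDiff ℝ ∞ f) (a : Phase d) :
    ContDiff ℝ ∞ (windowed f a) :=
  (contDiff_ofReal ((derivBdd_gauss 0).1.comp (contDiff_fst.add contDiff_const))).mul hf

theorem exists_derivSum_windowed_le (d p D : ℕ) : ∃ C, 0 ≤ C ∧ ∀ (a : Phase d)
    (f : Phase d × Phase d → ℂ), ContDiff ℝ ∞ f → ∀ w,
      derivSum D (windowed f a) w ≤ C * decay p (w.1 + -a) * derivSum D f w := by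
  obtain ⟨C, hC0, hC⟩ := exists_derivSum_mul_le (X := Phase d × Phase d) (derivBdd_gauss (d := d) p) D
  exact ⟨C, hC0, fun a f hf w => hC (-a) (.fst ℝ _ _) (ContinuousLinearMap.norm_fst_le ..) f hf w⟩

theorem integrable_derivSum {X : Type*} [NormedAddCommGroup X] [NormedSpace ℝ X] [MeasureSpace X]
    {f : X → ℂ} (hf : SL1 f) (D : ℕ) : Integrable (derivSum D f) :=
  integrable_finsetSum _ fun i _ => (hf.2 i).norm

theorem SL1.windowed {f : Phase d × Phase d → ℂ} (hf : SL1 f) (a : Phase d) :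
    SL1 (windowed f a) := by
  refine SL1.of_bound (contDiff_windowed hf.1 a) fun k => ?_
  obtain ⟨C, h0, hC⟩ := exists_derivSum_windowed_le d 0 k
  refine ⟨fun w => C * derivSum k f w, (integrable_derivSum hf k).const_mul C, fun w => ?_⟩
  have := hC a f hf.1 w
  simp only [decay, pow_zero, inv_one, mul_one] at this
  exact (norm_iteratedFDeriv_le_derivSum le_rfl _ w).trans this

/-- A mixed derivative of the localised function. -/
def mixedDeriv (f : Phase d × Phase d → ℂ) (a e₁ : Phase d) (k : ℕ) (e₂ : Phase d) (K : ℕ) :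
    Phase d × Phase d → ℂ :=
  (dirDeriv (0, e₂))^[K] ((dirDeriv (e₁, 0))^[k] (windowed f a))

theorem SL1.mixedDeriv {f : Phase d × Phase d → ℂ} (hf : SL1 f) (a e₁ : Phase d) (k : ℕ)
    (e₂ : Phase d) (K : ℕ) : SL1 (mixedDeriv f a e₁ k e₂ K) :=
  ((hf.windowed a).iterate_dirDeriv _ k).iterate_dirDeriv _ K

theorem ft_mixedDeriv {f : Phase d × Phase d → ℂ} (hf : SL1 f) (a e₁ : Phase d) (k : ℕ)
    (e₂ : Phase d) (K : ℕ) (θ : Phase d × Phase d) :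
    ft (pairForm d) (mixedDeriv f a e₁ k e₂ K) θ = (2 * Real.pi * Complex.I * phaseForm d e₂ θ.2) ^ K *
      ((2 * Real.pi * Complex.I * phaseForm d e₁ θ.1) ^ k * ft (pairForm d) (windowed f a) θ) := by
  rw [mixedDeriv, ft_iterate_dirDeriv _ ((hf.windowed a).iterate_dirDeriv _ k),
    ft_iterate_dirDeriv _ (hf.windowed a), pairForm_apply, pairForm_apply]
  simp only [map_zero, zero_apply, zero_add, add_zero]

theorem exists_norm_mixedDeriv_le (d p D : ℕ) : ∃ C, 0 ≤ C ∧ ∀ (a e₁ e₂ : Phase d), ‖e₁‖ ≤ 1 → ‖e₂‖ ≤ 1 →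
    ∀ k K, k + K ≤ D → ∀ (f : Phase d × Phase d → ℂ), ContDiff ℝ ∞ f → ∀ w,
      ‖mixedDeriv f a e₁ k e₂ K w‖ ≤ C * decay p (w.1 + -a) * derivSum D f w := by
  obtain ⟨C, hC0, hC⟩ := exists_derivSum_windowed_le d p D
  refine ⟨C, hC0, fun a e₁ e₂ h1 h2 k K hkK f hf w => le_trans ?_ (hC a f hf w)⟩
  have hw := contDiff_windowed hf a
  have b1 := norm_iteratedFDeriv_iterate_dirDeriv_le (contDiff_iterate_dirDeriv hw (e₁, 0) k)
    (0, e₂) 0 K w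
  have b2 := norm_iteratedFDeriv_iterate_dirDeriv_le hw (e₁, 0) (0 + K) k w
  have n1 : ‖((e₁, 0) : Phase d × Phase d)‖ ≤ 1 := by rw [Prod.norm_def]; simpa using h1
  have n2 : ‖((0, e₂) : Phase d × Phase d)‖ ≤ 1 := by rw [Prod.norm_def]; simpa using h2
  rw [norm_iteratedFDeriv_zero] at b1
  refine b1.trans ((mul_le_of_le_one_left (norm_nonneg _) (pow_le_one₀ (norm_nonneg _) n2)).trans
    (b2.trans ((mul_le_of_le_one_left (norm_nonneg _) (pow_le_one₀ (norm_nonneg _) n1)).trans ?_)))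
  exact norm_iteratedFDeriv_le_derivSum (by omega) _ w

/-- Powers of `1 + ‖ξ‖` are detected by powers of a single component of `ξ`. -/
theorem exists_component (d K : ℕ) : ∃ C : ℝ, 0 < C ∧ ∀ ξ : Phase d, ∃ e : Phase d, ‖e‖ ≤ 1 ∧ ∃ K' ≤ K,
    (1 + ‖ξ‖) ^ K ≤ C * ‖(2 * Real.pi * Complex.I * phaseForm d e ξ) ^ K'‖ := by
  obtain ⟨c, hc, h⟩ := nondeg_phaseForm (d := d)
  refine ⟨2 ^ K * (1 + ((2 * Real.pi * c) ^ K)⁻¹), by positivity, fun ξ => ?_⟩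
  obtain ⟨e, he, h2⟩ := h ξ
  rcases le_total ‖ξ‖ 1 with h1 | h1
  · refine ⟨0, by simp, 0, Nat.zero_le _, ?_⟩
    rw [pow_zero, norm_one, mul_one]
    calc (1 + ‖ξ‖) ^ K ≤ 2 ^ K := pow_le_pow_left₀ (by positivity) (by linarith) K
      _ ≤ _ := le_mul_of_one_le_right (by positivity) (le_add_of_nonneg_right (by positivity))
  · refine ⟨e, he, K, le_rfl, ?_⟩
    have e1 : ‖(2 * Real.pi * Complex.I * phaseForm d e ξ : ℂ) ^ K‖ = (2 * Real.pi * |phaseForm d e ξ|) ^ K := by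
      simp [-phaseForm_apply, abs_of_pos Real.pi_pos]
    rw [e1]
    calc (1 + ‖ξ‖) ^ K ≤ (2 * ‖ξ‖) ^ K := pow_le_pow_left₀ (by positivity) (by linarith) K
      _ = 2 ^ K * (((2 * Real.pi * c) ^ K)⁻¹ * (2 * Real.pi * (c * ‖ξ‖)) ^ K) := by
        rw [← mul_assoc (2 * Real.pi), mul_pow _ ‖ξ‖, mul_pow _ ‖ξ‖]; field_simp
      _ ≤ 2 ^ K * ((1 + ((2 * Real.pi * c) ^ K)⁻¹) * (2 * Real.pi * |phaseForm d e ξ|) ^ K) := by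
        gcongr
        exact le_add_of_nonneg_left zero_le_one
      _ = _ := by ring

end

section

/-! ### Decay of the localised Fourier transform -/

variable {d : ℕ}

theorem exists_norm_ft_windowed_le (d p k K : ℕ) : ∃ C, 0 ≤ C ∧ ∀ (f : Phase d × Phase d → ℂ), SL1 f →
    ∀ a β ξ : Phase d, ‖ft (pairForm d) (windowed f a) (β, ξ)‖ ≤
      C * decay k β * decay K ξ * ∫ w, decay p (w.1 + -a) * derivSum (k + K) f w := by
  obtain ⟨C₁, h1, hC₁⟩ := exists_component d k
  obtain ⟨C₂, h2, hC₂⟩ := exists_component d K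
  obtain ⟨C, h0, hC⟩ := exists_norm_mixedDeriv_le d p (k + K)
  refine ⟨C₁ * C₂ * C, by positivity, fun f hf a β ξ => ?_⟩
  obtain ⟨e₁, he₁, k', hk', hb⟩ := hC₁ β
  obtain ⟨e₂, he₂, K', hK', hx⟩ := hC₂ ξ
  have hi : Integrable fun w : Phase d × Phase d => decay p (w.1 + -a) * derivSum (k + K) f w := by
    refine (integrable_derivSum hf (k + K)).bdd_mul (c := 1)
      (Continuous.aestronglyMeasurable (by fun_prop)) (Filter.Eventually.of_forall fun w => ?_)
    rw [Real.norm_of_nonneg (decay_pos _ _).le]; exact decay_le_one _ _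
  have b : ‖ft (pairForm d) (mixedDeriv f a e₁ k' e₂ K') (β, ξ)‖ ≤
      C * ∫ w, decay p (w.1 + -a) * derivSum (k + K) f w := by
    refine (norm_ft_le _ _ _).trans ?_
    rw [← integral_const_mul]
    refine integral_mono (hf.mixedDeriv a e₁ k' e₂ K').integrable.norm (hi.const_mul C) fun w => ?_
    refine (hC a e₁ e₂ he₁ he₂ k' K' (by omega) f hf.1 w).trans (le_of_eq ?_)
    ring
  rw [ft_mixedDeriv hf, norm_mul, norm_mul] at b
  have nb := norm_nonneg β
  have nx := norm_nonneg ξ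
  have q : (1 + ‖β‖) ^ k * (1 + ‖ξ‖) ^ K * ‖ft (pairForm d) (windowed f a) (β, ξ)‖ ≤
      C₁ * C₂ * C * ∫ w, decay p (w.1 + -a) * derivSum (k + K) f w := by
    calc _ ≤ (C₁ * ‖(2 * Real.pi * Complex.I * phaseForm d e₁ β : ℂ) ^ k'‖) *
          (C₂ * ‖(2 * Real.pi * Complex.I * phaseForm d e₂ ξ : ℂ) ^ K'‖) *
          ‖ft (pairForm d) (windowed f a) (β, ξ)‖ := by
          gcongr
      _ = C₁ * C₂ * (‖(2 * Real.pi * Complex.I * phaseForm d e₂ ξ : ℂ) ^ K'‖ *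
          (‖(2 * Real.pi * Complex.I * phaseForm d e₁ β : ℂ) ^ k'‖ *
            ‖ft (pairForm d) (windowed f a) (β, ξ)‖)) := by ring
      _ ≤ C₁ * C₂ * (C * ∫ w, decay p (w.1 + -a) * derivSum (k + K) f w) := by gcongr
      _ = _ := by ring
  rw [decay, decay]
  calc _ = ((1 + ‖β‖) ^ k)⁻¹ * ((1 + ‖ξ‖) ^ K)⁻¹ *
      ((1 + ‖β‖) ^ k * (1 + ‖ξ‖) ^ K * ‖ft (pairForm d) (windowed f a) (β, ξ)‖) := by
        field_simp
    _ ≤ ((1 + ‖β‖) ^ k)⁻¹ * ((1 + ‖ξ‖) ^ K)⁻¹ *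
        (C₁ * C₂ * C * ∫ w, decay p (w.1 + -a) * derivSum (k + K) f w) := by gcongr
    _ = _ := by ring

theorem exists_one_add_norm_pow_le (d k : ℕ) : ∃ C : ℝ, 0 < C ∧ ∀ β : Phase d,
    (1 + ‖β‖) ^ (2 * k) ≤
      C * (1 + ∑ j, ‖(2 * Real.pi * Complex.I * phaseForm d (phaseDir j) β : ℂ) ^ k‖ ^ 2) := by
  rcases k with _ | k
  · refine ⟨1, one_pos, fun β => ?_⟩
    simp only [mul_zero, pow_zero, one_mul]
    exact le_add_of_nonneg_right (by positivity)
  set n : ℝ := ((Finset.univ : Finset (Fin d ⊕ Fin d)).card : ℝ)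
  refine ⟨4 ^ (k + 1) * (1 + n ^ k), by positivity, fun β => ?_⟩
  have h1 : ‖β‖ ^ 2 ≤ ∑ j, coord j β ^ 2 := by
    rw [sum_coord_sq]
    rcases le_total ‖β.1‖ ‖β.2‖ with h | h
    · rw [Prod.norm_def, max_eq_right h]; nlinarith [sq_nonneg ‖β.1‖]
    · rw [Prod.norm_def, max_eq_left h]; nlinarith [sq_nonneg ‖β.2‖]
  have h2 : (∑ j, coord j β ^ 2) ^ (k + 1) ≤ n ^ k * ∑ j, (coord j β ^ 2) ^ (k + 1) := by
    have := pow_sum_div_card_le_sum_pow (s := (Finset.univ : Finset (Fin d ⊕ Fin d)))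
      (f := fun j => coord j β ^ 2) (fun _ _ => sq_nonneg _) k
    rcases Nat.eq_zero_or_pos (Finset.univ : Finset (Fin d ⊕ Fin d)).card with hc | hc
    · have he : (Finset.univ : Finset (Fin d ⊕ Fin d)) = ∅ := Finset.card_eq_zero.1 hc
      rw [he]; simp
    · rwa [div_le_iff₀ (by positivity), mul_comm] at this
  have h3 : ∀ j, (coord j β ^ 2) ^ (k + 1) ≤
      ‖(2 * Real.pi * Complex.I * phaseForm d (phaseDir j) β : ℂ) ^ (k + 1)‖ ^ 2 := by
    intro j
    have e : ‖(2 * Real.pi * Complex.I * phaseForm d (phaseDir j) β : ℂ)‖ = 2 * Real.pi * |coord j β| := by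
      rw [coord_apply, phaseForm_comm β]
      simp [-phaseForm_apply, abs_of_pos Real.pi_pos]
    rw [norm_pow, e, ← pow_mul, ← pow_mul, mul_comm (k + 1) 2, pow_mul, pow_mul]
    rw [← sq_abs (coord j β)]
    gcongr
    have := Real.pi_gt_three
    nlinarith [abs_nonneg (coord j β)]
  have hb := norm_nonneg β
  have h4 : (1 + ‖β‖) ^ 2 ≤ 2 * (1 + ‖β‖ ^ 2) := by nlinarith [sq_nonneg (1 - ‖β‖)]
  have h5 : (1 + ‖β‖ ^ 2) ^ (k + 1) ≤ 2 ^ (k + 1) * (1 + (‖β‖ ^ 2) ^ (k + 1)) := by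
    rcases le_total (‖β‖ ^ 2) 1 with h | h
    · calc (1 + ‖β‖ ^ 2) ^ (k + 1) ≤ 2 ^ (k + 1) := pow_le_pow_left₀ (by positivity) (by linarith) _
        _ ≤ _ := le_mul_of_one_le_right (by positivity) (le_add_of_nonneg_right (by positivity))
    · calc (1 + ‖β‖ ^ 2) ^ (k + 1) ≤ (2 * ‖β‖ ^ 2) ^ (k + 1) :=
            pow_le_pow_left₀ (by positivity) (by linarith) _
        _ = 2 ^ (k + 1) * (‖β‖ ^ 2) ^ (k + 1) := mul_pow _ _ _
        _ ≤ _ := by gcongr; linarith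
  set T := ∑ j, ‖(2 * Real.pi * Complex.I * phaseForm d (phaseDir j) β : ℂ) ^ (k + 1)‖ ^ 2
  have h6 : (‖β‖ ^ 2) ^ (k + 1) ≤ n ^ k * T := by
    refine (pow_le_pow_left₀ (by positivity) h1 _).trans (h2.trans ?_)
    exact mul_le_mul_of_nonneg_left (Finset.sum_le_sum fun j _ => h3 j) (by positivity)
  have hs : 0 ≤ T := by positivity
  have hn : 0 ≤ n ^ k := by positivity
  calc (1 + ‖β‖) ^ (2 * (k + 1)) = ((1 + ‖β‖) ^ 2) ^ (k + 1) := pow_mul _ _ _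
    _ ≤ (2 * (1 + ‖β‖ ^ 2)) ^ (k + 1) := by gcongr
    _ = 2 ^ (k + 1) * (1 + ‖β‖ ^ 2) ^ (k + 1) := mul_pow _ _ _
    _ ≤ 2 ^ (k + 1) * (2 ^ (k + 1) * (1 + n ^ k * T)) := by
      gcongr; refine h5.trans ?_; gcongr
    _ = 4 ^ (k + 1) * (1 + n ^ k * T) := by
      rw [← mul_assoc, ← mul_pow]; norm_num
    _ ≤ 4 ^ (k + 1) * ((1 + n ^ k) * (1 + T)) := by
      gcongr; nlinarith [mul_nonneg hn hs]
    _ = _ := by ring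

/-- The integral over `v` of the supremum over `s` of the derivatives of `f (s, v)`. -/
def supNorm (D : ℕ) (f : Phase d × Phase d → ℂ) : ℝ≥0∞ :=
  ∫⁻ v, ⨆ s, ENNReal.ofReal (derivSum D f (s, v))

theorem exists_lintegral_ft_mixedDeriv_le (d D : ℕ) : ∃ C : ℝ≥0, ∀ (f : Phase d × Phase d → ℂ), SL1 f →
    ∀ (a e₁ e₂ : Phase d), ‖e₁‖ ≤ 1 → ‖e₂‖ ≤ 1 → ∀ k K, k + K ≤ D → ∀ ξ,
      ∫⁻ β, ‖ft (pairForm d) (mixedDeriv f a e₁ k e₂ K) (β, ξ)‖ₑ ^ 2 ≤ C * supNorm D f ^ 2 := by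
  obtain ⟨C, h0, hC⟩ := exists_norm_mixedDeriv_le d (2 * d + 1) D
  set I := ∫⁻ s : Phase d, ENNReal.ofReal (decay (2 * d + 1) s)
  have hI : I ≠ ⊤ := (lintegral_decay_lt_top (by rw [finrank_phase]; omega)).ne
  refine ⟨(ENNReal.ofReal C ^ 2 * I).toNNReal + 1, fun f hf a e₁ e₂ h1 h2 k K hkK ξ => ?_⟩
  rw [ENNReal.coe_add, ENNReal.coe_toNNReal (ENNReal.mul_ne_top (by simp) hI)]
  set g := mixedDeriv f a e₁ k e₂ K with hgdef
  have hg : SL1 g := hf.mixedDeriv a e₁ k e₂ K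
  by_cases hS : supNorm D f = ⊤
  · rw [hS]; simp [ENNReal.top_pow]
  set G : Phase d → ℂ := fun s => ∫ v, expChar (-phaseForm d v ξ) * g (s, v)
  have hgi : Integrable fun w : Phase d × Phase d => expChar (-phaseForm d w.2 ξ) * g w :=
    hg.integrable.bdd_mul (c := 1) (Continuous.aestronglyMeasurable (by fun_prop)) (by simp)
  have hGi : Integrable G := hgi.integral_prod_left
  have hft : ∀ β, ft (phaseForm d) G β = ft (pairForm d) g (β, ξ) := by
    intro β
    have hi : Integrable fun w : Phase d × Phase d => expChar (-pairForm d w (β, ξ)) * g w :=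
      integrable_expChar_mul ((pairForm d).flip (β, ξ)) hg.integrable
    refine Eq.trans ?_ (integral_prod _ hi).symm
    rw [ft]
    refine integral_congr_ae (Filter.Eventually.of_forall fun s => ?_)
    simp only [G]
    rw [← integral_const_mul]
    refine integral_congr_ae (Filter.Eventually.of_forall fun v => ?_)
    simp only
    rw [pairForm_apply, neg_add, expChar_add, mul_assoc]
  have hGb : ∀ s, ‖G s‖ₑ ≤ ENNReal.ofReal (C * decay (2 * d + 1) (s + -a)) * supNorm D f := by
    intro s
    refine (enorm_integral_le_lintegral_enorm _).trans ?_
    rw [supNorm, ← lintegral_const_mul' _ _ ENNReal.ofReal_ne_top]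
    refine lintegral_mono fun v => ?_
    rw [enorm_mul]
    have e1 : ‖expChar (-phaseForm d v ξ)‖ₑ = 1 := by
      rw [← ofReal_norm, norm_expChar, ENNReal.ofReal_one]
    rw [e1, one_mul, ← ofReal_norm]
    refine (ENNReal.ofReal_le_ofReal (hC a e₁ e₂ h1 h2 k K hkK f hf.1 (s, v))).trans ?_
    rw [ENNReal.ofReal_mul (mul_nonneg h0 (decay_pos _ _).le)]
    gcongr
    exact le_iSup (fun s => ENNReal.ofReal (derivSum D f (s, v))) s
  have hG2 : ∫⁻ s, ‖G s‖ₑ ^ 2 ≤ ENNReal.ofReal C ^ 2 * I * supNorm D f ^ 2 := by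
    calc _ ≤ ∫⁻ s, ENNReal.ofReal C ^ 2 * supNorm D f ^ 2 *
          ENNReal.ofReal (decay (2 * d + 1) (s + -a)) := by
          refine lintegral_mono fun s => ?_
          refine (pow_le_pow_left' (hGb s) 2).trans ?_
          rw [mul_pow, ENNReal.ofReal_mul h0, mul_pow]
          have : ENNReal.ofReal (decay (2 * d + 1) (s + -a)) ≤ 1 := by
            rw [← ENNReal.ofReal_one]; exact ENNReal.ofReal_le_ofReal (decay_le_one _ _)
          calc _ = ENNReal.ofReal C ^ 2 * supNorm D f ^ 2 * (ENNReal.ofReal (decay (2 * d + 1) (s + -a)) *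
                ENNReal.ofReal (decay (2 * d + 1) (s + -a))) := by ring
            _ ≤ ENNReal.ofReal C ^ 2 * supNorm D f ^ 2 * (ENNReal.ofReal (decay (2 * d + 1) (s + -a)) * 1) := by
              gcongr
            _ = _ := by rw [mul_one]
      _ = ENNReal.ofReal C ^ 2 * supNorm D f ^ 2 * I := by
          rw [lintegral_const_mul' _ _ (by finiteness)]
          congr 1
          exact lintegral_add_right_eq_self (fun s => ENNReal.ofReal (decay (2 * d + 1) s)) (-a)
      _ = _ := by ring
  have hGm : MemLp G 2 := by
    refine ⟨hGi.aestronglyMeasurable, ?_⟩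
    rw [eLpNorm_lt_top_iff_lintegral_rpow_enorm_lt_top (by norm_num) (by norm_num)]
    refine lt_of_le_of_lt (le_of_eq_of_le ?_ hG2) (by finiteness)
    simp
  simp_rw [← hft]
  rw [phase_plancherel hGi hGm]
  refine hG2.trans ?_
  gcongr
  exact le_self_add

theorem exists_lintegral_ft_windowed_le (d k K : ℕ) : ∃ C : ℝ≥0, ∀ (f : Phase d × Phase d → ℂ), SL1 f →
    ∀ (a ξ : Phase d),
      ∫⁻ β, ENNReal.ofReal ((1 + ‖β‖) ^ (2 * k)) * ‖ft (pairForm d) (windowed f a) (β, ξ)‖ₑ ^ 2 ≤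
        C * ENNReal.ofReal (decay K ξ) ^ 2 * supNorm (k + K) f ^ 2 := by
  obtain ⟨C₁, h1, hC₁⟩ := exists_one_add_norm_pow_le d k
  obtain ⟨C₂, h2, hC₂⟩ := exists_component d K
  obtain ⟨C, hC⟩ := exists_lintegral_ft_mixedDeriv_le d (k + K)
  refine ⟨(C₁.toNNReal * C₂.toNNReal ^ 2) * (C + ∑ _j : Fin d ⊕ Fin d, C), fun f hf a ξ => ?_⟩
  obtain ⟨e₂, he₂, K', hK', hx⟩ := hC₂ ξ
  have nx := norm_nonneg ξ
  set Z : Phase d → ℂ := fun β => ft (pairForm d) (windowed f a) (β, ξ)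
  set M : Fin d ⊕ Fin d → Phase d → ℂ := fun j β =>
    ft (pairForm d) (mixedDeriv f a (phaseDir j) k e₂ K') (β, ξ)
  set M0 : Phase d → ℂ := fun β => ft (pairForm d) (mixedDeriv f a 0 0 e₂ K') (β, ξ)
  have hdir : ∀ j : Fin d ⊕ Fin d, ‖(phaseDir j : Phase d)‖ ≤ 1 := by
    rintro (j | j) <;> simp [phaseDir, Prod.norm_def]
  have key : ∀ β, (1 + ‖β‖) ^ (2 * k) * ‖Z β‖ ^ 2 ≤
      C₁ * C₂ ^ 2 * decay K ξ ^ 2 * (‖M0 β‖ ^ 2 + ∑ j, ‖M j β‖ ^ 2) := by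
    intro β
    have e0 : ‖M0 β‖ = ‖(2 * Real.pi * Complex.I * phaseForm d e₂ ξ : ℂ) ^ K'‖ * ‖Z β‖ := by
      simp only [M0, Z]; rw [ft_mixedDeriv hf, pow_zero, one_mul, norm_mul]
    have ej : ∀ j, ‖M j β‖ = ‖(2 * Real.pi * Complex.I * phaseForm d e₂ ξ : ℂ) ^ K'‖ *
        (‖(2 * Real.pi * Complex.I * phaseForm d (phaseDir j) β : ℂ) ^ k‖ * ‖Z β‖) := by
      intro j
      simp only [M, Z]; rw [ft_mixedDeriv hf, norm_mul, norm_mul]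
    set x := ‖(2 * Real.pi * Complex.I * phaseForm d e₂ ξ : ℂ) ^ K'‖
    have hx' : 1 ≤ C₂ * decay K ξ * x := by
      rw [decay]
      rw [mul_right_comm, ← div_eq_mul_inv, le_div_iff₀ (by positivity), one_mul]
      exact hx
    have hdp := decay_pos K ξ
    calc _ ≤ (C₁ * (1 + ∑ j, ‖(2 * Real.pi * Complex.I * phaseForm d (phaseDir j) β : ℂ) ^ k‖ ^ 2)) *
          ‖Z β‖ ^ 2 * 1 := by
          rw [mul_one]; gcongr; exact hC₁ β
      _ ≤ (C₁ * (1 + ∑ j, ‖(2 * Real.pi * Complex.I * phaseForm d (phaseDir j) β : ℂ) ^ k‖ ^ 2)) *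
          ‖Z β‖ ^ 2 * (C₂ * decay K ξ * x) ^ 2 := by
          gcongr; exact one_le_pow₀ hx'
      _ = _ := by
          simp only [e0, ej, mul_pow]
          rw [← Finset.mul_sum, ← Finset.sum_mul]; ring
  have hm : ∀ (u : Phase d × Phase d → ℂ), SL1 u → Measurable fun β => ‖ft (pairForm d) u (β, ξ)‖ₑ ^ 2 := by
    intro u hu
    have : Continuous fun β => ft (pairForm d) u (β, ξ) :=
      (continuous_ft (pairForm d) hu.integrable).comp (by fun_prop)
    exact (this.measurable.enorm).pow_const 2
  calc _ ≤ ∫⁻ β, (C₁.toNNReal * C₂.toNNReal ^ 2 : ℝ≥0) * ENNReal.ofReal (decay K ξ) ^ 2 *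
        (‖M0 β‖ₑ ^ 2 + ∑ j, ‖M j β‖ₑ ^ 2) := by
        refine lintegral_mono fun β => ?_
        have := ENNReal.ofReal_le_ofReal (key β)
        rw [ENNReal.ofReal_mul (by positivity), ENNReal.ofReal_mul (by have := decay_pos K ξ; positivity),
          ENNReal.ofReal_mul (by positivity), ENNReal.ofReal_mul h1.le,
          ENNReal.ofReal_add (by positivity) (by positivity),
          ENNReal.ofReal_sum_of_nonneg (fun _ _ => by positivity)] at this
        simp only [ENNReal.ofReal_pow (norm_nonneg _), ofReal_norm, ENNReal.ofReal_pow h2.le,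
          ENNReal.ofReal_pow (decay_pos K ξ).le] at this
        exact this
    _ = (C₁.toNNReal * C₂.toNNReal ^ 2 : ℝ≥0) * ENNReal.ofReal (decay K ξ) ^ 2 *
        ((∫⁻ β, ‖M0 β‖ₑ ^ 2) + ∑ j, ∫⁻ β, ‖M j β‖ₑ ^ 2) := by
        rw [lintegral_const_mul' _ _ (by finiteness), lintegral_add_left (hm _ (hf.mixedDeriv ..)),
          lintegral_finsetSum _ fun j _ => hm _ (hf.mixedDeriv ..)]
    _ ≤ (C₁.toNNReal * C₂.toNNReal ^ 2 : ℝ≥0) * ENNReal.ofReal (decay K ξ) ^ 2 *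
        (C * supNorm (k + K) f ^ 2 + ∑ _j : Fin d ⊕ Fin d, C * supNorm (k + K) f ^ 2) := by
        gcongr with j _
        · exact hC f hf a 0 e₂ (by simp) he₂ 0 K' (by omega) ξ
        · exact hC f hf a _ e₂ (hdir j) he₂ k K' (by omega) ξ
    _ = _ := by
        rw [← Finset.sum_mul]; push_cast; ring

end

section

/-! ### Wave packets -/

variable {d : ℕ}

theorem phaseForm_sub_left (a b z : Phase d) :
    phaseForm d (a - b) z = phaseForm d a z - phaseForm d b z := by
  simp only [phaseForm_apply, Prod.fst_sub, Prod.snd_sub, inner_sub_left]; ring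

theorem phaseForm_add_left (a b z : Phase d) :
    phaseForm d (a + b) z = phaseForm d a z + phaseForm d b z := by
  simp only [phaseForm_apply, Prod.fst_add, Prod.snd_add, inner_add_left]; ring

theorem phaseForm_smul_left (r : ℝ) (a z : Phase d) :
    phaseForm d (r • a) z = r * phaseForm d a z := by
  simp only [phaseForm_apply, Prod.smul_fst, Prod.smul_snd, real_inner_smul_left]; ring

theorem integral_expChar_mul_gauss {r : ℝ} (hr : 0 < r) (c : Phase d) :
    ∫ z, expChar (phaseForm d c z) * (gauss (r • z) : ℂ) =
      ((Real.pi / r ^ 2) ^ d * gauss ((Real.pi / r) • c) : ℝ) := by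
  have h1 : ∀ u : Conf d, ∫ v : Conf d, Complex.exp (-(r ^ 2 : ℂ) * ‖v‖ ^ 2 +
      (2 * Real.pi * Complex.I) * (inner ℝ u v : ℝ)) =
      (Real.pi / r ^ 2 : ℂ) ^ (d / 2 : ℂ) * (Real.exp (-(‖(Real.pi / r) • u‖ ^ 2)) : ℂ) := by
    intro u
    have hb : 0 < ((r ^ 2 : ℂ)).re := by
      rw [← Complex.ofReal_pow, Complex.ofReal_re]; positivity
    rw [GaussianFourier.integral_cexp_neg_mul_sq_norm_add hb, finrank_euclideanSpace,
      Fintype.card_fin, Complex.ofReal_exp]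
    congr 2
    rw [norm_smul, Real.norm_of_nonneg (by positivity)]
    push_cast
    rw [mul_pow, mul_pow, Complex.I_sq]
    have : (r : ℂ) ≠ 0 := by exact_mod_cast hr.ne'
    field_simp
    norm_num [mul_comm]
  have h2 : ∀ z : Phase d, expChar (phaseForm d c z) * (gauss (r • z) : ℂ) =
      (fun v : Conf d => Complex.exp (-(r ^ 2 : ℂ) * ‖v‖ ^ 2 +
        (2 * Real.pi * Complex.I) * (inner ℝ c.1 v : ℝ))) z.1 *
      (fun v : Conf d => Complex.exp (-(r ^ 2 : ℂ) * ‖v‖ ^ 2 +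
        (2 * Real.pi * Complex.I) * (inner ℝ c.2 v : ℝ))) z.2 := by
    intro z
    simp only
    rw [gauss, Complex.ofReal_exp, expChar_eq]
    refine (Complex.exp_add _ _).symm.trans (Eq.trans ?_ (Complex.exp_add _ _))
    congr 1
    simp only [phaseForm_apply, Prod.smul_fst, Prod.smul_snd, norm_smul, Real.norm_of_nonneg hr.le]
    push_cast
    ring
  refine (integral_congr_ae (Filter.Eventually.of_forall h2)).trans ?_
  refine (integral_prod_mul (μ := (volume : Measure (Conf d))) (ν := (volume : Measure (Conf d)))
    (fun v : Conf d => Complex.exp (-(r ^ 2 : ℂ) * ‖v‖ ^ 2 +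
        (2 * Real.pi * Complex.I) * (inner ℝ c.1 v : ℝ)))
    (fun v : Conf d => Complex.exp (-(r ^ 2 : ℂ) * ‖v‖ ^ 2 +
        (2 * Real.pi * Complex.I) * (inner ℝ c.2 v : ℝ)))).trans ?_
  rw [h1, h1, gauss]
  have h3 : ((Real.pi / r ^ 2 : ℂ) ^ (d / 2 : ℂ)) * (Real.pi / r ^ 2 : ℂ) ^ (d / 2 : ℂ) =
      ((Real.pi / r ^ 2) ^ d : ℝ) := by
    rw [← Complex.cpow_add _ _ (by
      have := Real.pi_pos.ne'
      have := hr.ne'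
      exact_mod_cast div_ne_zero Real.pi_pos.ne' (pow_ne_zero 2 hr.ne')), add_halves,
      Complex.cpow_natCast]
    push_cast; rfl
  rw [Complex.ofReal_mul, ← h3, Prod.smul_fst, Prod.smul_snd, neg_add, Real.exp_add,
    Complex.ofReal_mul]
  ring

theorem integrable_gauss {r : ℝ} (hr : 0 < r) : Integrable fun z : Phase d => gauss (r • z) := by
  have h := integral_expChar_mul_gauss hr (0 : Phase d)
  by_contra hn
  have : ¬ Integrable fun z : Phase d => expChar (phaseForm d 0 z) * (gauss (r • z) : ℂ) := by
    intro hi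
    refine hn ?_
    have := hi.norm
    simpa [abs_of_pos (gauss_pos _), norm_expChar] using this
  rw [integral_undef this] at h
  have hp : 0 < (Real.pi / r ^ 2) ^ d * gauss ((Real.pi / r) • (0 : Phase d)) := by
    have := gauss_pos ((Real.pi / r) • (0 : Phase d))
    have := Real.pi_pos
    positivity
  exact hp.ne (by exact_mod_cast h)

theorem integral_expChar_mul_gauss_sub {r : ℝ} (hr : 0 < r) (c β : Phase d) :
    ∫ z, expChar (phaseForm d c z) * (gauss (r • (z - β)) : ℂ) =
      expChar (phaseForm d c β) * ((Real.pi / r ^ 2) ^ d * gauss ((Real.pi / r) • c) : ℝ) := by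
  rw [← integral_expChar_mul_gauss hr c, ← integral_const_mul,
    ← integral_sub_right_eq_self (fun z => expChar (phaseForm d c β) * (expChar (phaseForm d c z) * (gauss (r • z) : ℂ))) β]
  refine integral_congr_ae (Filter.Eventually.of_forall fun z => ?_)
  simp only
  rw [← mul_assoc, ← expChar_add, ← map_add, add_sub_cancel]

/-- A wave packet in the frequency variable: a plane wave times a Gaussian centred at `β`. -/
def packet (a β α : Phase d) : ℂ :=
  expChar (phaseForm d a α) * (gauss (Real.pi • (α - β)) : ℂ)

@[fun_prop] theorem continuous_packet :
    Continuous fun q : Phase d × Phase d × Phase d => packet q.1 q.2.1 q.2.2 := by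
  unfold packet
  simp only [phaseForm_apply]
  refine Continuous.mul (continuous_expChar.comp (by fun_prop)) ?_
  exact Complex.continuous_ofReal.comp (continuous_gauss.comp (by fun_prop))

theorem norm_packet_le_one (a β α : Phase d) : ‖packet a β α‖ ≤ 1 := by
  rw [packet, norm_mul, norm_expChar, one_mul, Complex.norm_real, Real.norm_of_nonneg (gauss_pos _).le]
  exact gauss_le_one _

theorem integral_ft_mul_packet {f : Phase d × Phase d → ℂ} (hf : Integrable f) (a β ξ : Phase d) :
    ∫ α, ft (pairForm d) f (α, ξ) * packet a β α =
      ((Real.pi⁻¹ ^ d : ℝ) : ℂ) * (expChar (phaseForm d a β) * ft (pairForm d) (windowed f a) (β, ξ)) := by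
  have hg : Integrable fun α : Phase d => (gauss (Real.pi • (α - β)) : ℂ) :=
    ((integrable_gauss (d := d) Real.pi_pos).comp_sub_right β).ofReal
  have hi : Integrable (fun q : Phase d × (Phase d × Phase d) =>
      expChar (-pairForm d q.2 (q.1, ξ)) * f q.2 * packet a β q.1)
      ((volume : Measure (Phase d)).prod volume) := by
    have h0 : Integrable (fun q : Phase d × (Phase d × Phase d) =>
      (gauss (Real.pi • (q.1 - β)) : ℂ) * f q.2) ((volume : Measure (Phase d)).prod volume) :=
      hg.mul_prod hf
    have := h0.bdd_mul (c := 1) (f := fun q : Phase d × (Phase d × Phase d) =>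
      expChar (-pairForm d q.2 (q.1, ξ)) * expChar (phaseForm d a q.1)) ?_
      (Filter.Eventually.of_forall fun q => by rw [norm_mul, norm_expChar, norm_expChar, one_mul])
    · refine this.congr (Filter.Eventually.of_forall fun q => ?_)
      simp only [packet]; ring
    · refine Continuous.aestronglyMeasurable ?_
      simp only [pairForm_apply, phaseForm_apply]
      exact (continuous_expChar.comp (by fun_prop)).mul (continuous_expChar.comp (by fun_prop))
  calc _ = ∫ α, ∫ w, expChar (-pairForm d w (α, ξ)) * f w * packet a β α := by
        refine integral_congr_ae (Filter.Eventually.of_forall fun α => ?_)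
        simp only [ft]
        rw [← integral_mul_const]
    _ = ∫ w, ∫ α, expChar (-pairForm d w (α, ξ)) * f w * packet a β α :=
        integral_integral_swap hi
    _ = _ := by
        rw [ft, ← integral_const_mul, ← integral_const_mul]
        refine integral_congr_ae (Filter.Eventually.of_forall fun w => ?_)
        simp only
        have e : ∀ α, expChar (-pairForm d w (α, ξ)) * f w * packet a β α =
            expChar (-phaseForm d w.2 ξ) * f w *
              (expChar (phaseForm d (a - w.1) α) * (gauss (Real.pi • (α - β)) : ℂ)) := by
          intro α
          rw [phaseForm_sub_left, sub_eq_add_neg (phaseForm d a α)]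
          simp only [packet, pairForm_apply, neg_add, expChar_add]
          ring
        simp_rw [e]
        rw [integral_const_mul, integral_expChar_mul_gauss_sub Real.pi_pos, div_self Real.pi_pos.ne',
          one_smul, windowed]
        have g : gauss (w.1 + -a) = gauss (a - w.1) := by
          simp only [gauss]
          rw [← sub_eq_add_neg, Prod.fst_sub, Prod.snd_sub, Prod.fst_sub, Prod.snd_sub, norm_sub_rev, norm_sub_rev w.1.2]
        have k : (Real.pi / Real.pi ^ 2) = Real.pi⁻¹ := by
          have := Real.pi_pos.ne'
          field_simp
        have m : pairForm d w (β, ξ) = phaseForm d w.1 β + phaseForm d w.2 ξ := pairForm_apply ..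
        rw [g, k, m, neg_add, expChar_add, phaseForm_sub_left, sub_eq_add_neg, expChar_add,
          Complex.ofReal_mul]
        ring

theorem enorm_phasePairing_packet_le {f : Phase d × Phase d → ℂ} (hf : SL1 f) (t : ℝ) (a β : Phase d) :
    ‖phasePairing t (packet a β) f‖ₑ ≤
      ∫⁻ ξ, ‖ft (pairForm d) (windowed f (a - (Real.pi * t) • rot d ξ)) (β, ξ)‖ₑ := by
  have hx : Continuous (packet a β) := by
    exact continuous_packet.comp (g := fun q : Phase d × Phase d × Phase d => packet q.1 q.2.1 q.2.2)
      (f := fun α => (a, β, α)) (by fun_prop)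
  have hi : Integrable (fun θ : Phase d × Phase d => ft (pairForm d) f θ *
      (expChar (-(Real.pi * t * symp θ.2 θ.1)) * packet a β θ.1)) :=
    integrable_ft_mul hf (continuous_phaseFactor t hx) (C := 1)
      (norm_phaseFactor_le t (norm_packet_le_one a β))
  rw [phasePairing]
  have e := integral_prod_symm _ hi
  refine le_of_eq_of_le (congrArg _ e) ?_
  refine (enorm_integral_le_lintegral_enorm _).trans (lintegral_mono fun ξ => ?_)
  have e2 : ∀ α, ft (pairForm d) f (α, ξ) *
      (expChar (-(Real.pi * t * symp ξ α)) * packet a β α) =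
      ft (pairForm d) f (α, ξ) * packet (a - (Real.pi * t) • rot d ξ) β α := by
    intro α
    simp only [packet, symp]
    rw [← mul_assoc (expChar _), ← expChar_add]
    congr 3
    rw [phaseForm_sub_left, phaseForm_smul_left]
    ring
  simp only [e2]
  rw [integral_ft_mul_packet hf.integrable, enorm_mul, enorm_mul]
  have e3 : ‖expChar (phaseForm d (a - (Real.pi * t) • rot d ξ) β)‖ₑ = 1 := by
    rw [← ofReal_norm, norm_expChar, ENNReal.ofReal_one]
  have e4 : ‖((Real.pi⁻¹ ^ d : ℝ) : ℂ)‖ₑ ≤ 1 := by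
    have := Real.pi_gt_three
    rw [← ofReal_norm, Complex.norm_real, Real.norm_of_nonneg (by positivity), ← ENNReal.ofReal_one]
    exact ENNReal.ofReal_le_ofReal (pow_le_one₀ (by positivity) (inv_le_one_of_one_le₀ (by linarith)))
  rw [e3, one_mul]
  exact mul_le_of_le_one_left' e4

end

section

/-! ### Integral inequalities -/

variable {d : ℕ}

theorem lintegral_mul_sq_le {X : Type*} [MeasurableSpace X] {μ : Measure X} {f g : X → ℝ≥0∞}
    (hf : AEMeasurable f μ) (hg : AEMeasurable g μ) :
    (∫⁻ x, f x * g x ∂μ) ^ 2 ≤ (∫⁻ x, f x ^ 2 ∂μ) * ∫⁻ x, g x ^ 2 ∂μ := by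
  have h := ENNReal.lintegral_mul_le_Lp_mul_Lq μ (p := 2) (q := 2) (by constructor <;> norm_num) hf hg
  refine (pow_le_pow_left' h 2).trans (le_of_eq ?_)
  rw [mul_pow]
  simp only [← ENNReal.rpow_natCast, ← ENNReal.rpow_mul]
  norm_num

theorem exists_lintegral_comp_equiv {E : Type*} [NormedAddCommGroup E] [NormedSpace ℝ E]
    [MeasurableSpace E] [BorelSpace E] [FiniteDimensional ℝ E] (μ : Measure E) [μ.IsAddHaarMeasure]
    (L : E ≃L[ℝ] E) : ∃ C : ℝ≥0, 0 < C ∧ ∀ g : E → ℝ≥0∞, ∫⁻ x, g (L x) ∂μ = C * ∫⁻ x, g x ∂μ := by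
  have hL : LinearMap.det (L : E →ₗ[ℝ] E) ≠ 0 := L.toLinearEquiv.isUnit_det'.ne_zero
  refine ⟨(|(LinearMap.det (L : E →ₗ[ℝ] E))⁻¹|).toNNReal,
    Real.toNNReal_pos.2 (abs_pos.2 (inv_ne_zero hL)), fun g => ?_⟩
  have h := lintegral_map_equiv (μ := μ) g L.toHomeomorph.toMeasurableEquiv
  have h2 := Measure.map_linearMap_addHaar_eq_smul_addHaar μ hL
  have h3 : Measure.map (L.toHomeomorph.toMeasurableEquiv) μ = Measure.map (L : E →ₗ[ℝ] E) μ := rfl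
  rw [h3, h2, lintegral_smul_measure] at h
  exact h.symm

theorem lintegral_midpoint_sub {H : Phase d → Phase d → ℝ≥0∞} (hH : Measurable (Function.uncurry H)) :
    ∫⁻ w : Phase d × Phase d, H ((1 / 2 : ℝ) • (w.1 + w.2)) (w.1 - w.2) = ∫⁻ b, ∫⁻ a, H a b := by
  have h1 : Measurable fun w : Phase d × Phase d => H ((1 / 2 : ℝ) • (w.1 + w.2)) (w.1 - w.2) :=
    hH.comp (g := Function.uncurry H)
      (f := fun w : Phase d × Phase d => ((1 / 2 : ℝ) • (w.1 + w.2), w.1 - w.2))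
      (Continuous.measurable (by fun_prop))
  have h2 : Measurable fun w : Phase d × Phase d => H (w.1 + (1 / 2 : ℝ) • w.2) w.2 :=
    hH.comp (g := Function.uncurry H)
      (f := fun w : Phase d × Phase d => (w.1 + (1 / 2 : ℝ) • w.2, w.2))
      (Continuous.measurable (by fun_prop))
  calc _ = ∫⁻ w' : Phase d, ∫⁻ w : Phase d, H ((1 / 2 : ℝ) • (w + w')) (w - w') :=
        lintegral_prod_symm _ h1.aemeasurable
    _ = ∫⁻ w' : Phase d, ∫⁻ b : Phase d, H (w' + (1 / 2 : ℝ) • b) b := by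
        refine lintegral_congr fun w' => ?_
        rw [← lintegral_add_right_eq_self _ w']
        refine lintegral_congr fun b => ?_
        rw [add_sub_cancel_right]
        congr 1
        module
    _ = ∫⁻ b : Phase d, ∫⁻ w' : Phase d, H (w' + (1 / 2 : ℝ) • b) b :=
        lintegral_lintegral_swap h2.aemeasurable
    _ = _ := by
        refine lintegral_congr fun b => ?_
        exact lintegral_add_right_eq_self (fun a => H a b) _

/-- A weight concentrated where both `w` and `w'` are close to `c`. -/
def pairWeight (c w w' : Phase d) : ℝ := ((1 + ‖w - c‖ + ‖w' - c‖) ^ (2 * d + 1))⁻¹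

theorem continuous_pairWeight :
    Continuous fun q : Phase d × Phase d × Phase d => pairWeight q.1 q.2.1 q.2.2 := by
  unfold pairWeight
  refine Continuous.inv₀ (by fun_prop) fun q => ?_
  positivity

theorem pairWeight_pos (c w w' : Phase d) : 0 < pairWeight c w w' := by
  unfold pairWeight; positivity

theorem exists_one_le_lintegral_pairWeight (d : ℕ) : ∃ C : ℝ≥0, ∀ w w' : Phase d,
    1 ≤ C * ENNReal.ofReal ((1 + ‖w - w'‖) ^ (2 * d + 2)) *
      ∫⁻ c, ENNReal.ofReal (pairWeight c w w' ^ 2) := by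
  set V : ℝ≥0∞ := (volume : Measure (Phase d)) (Metric.ball 0 1)
  have hV0 : V ≠ 0 := (Metric.measure_ball_pos _ _ one_pos).ne'
  have hV : V ≠ ⊤ := measure_ball_lt_top.ne
  refine ⟨(3 ^ (4 * d + 2) * V⁻¹).toNNReal, fun w w' => ?_⟩
  rw [ENNReal.coe_toNNReal (ENNReal.mul_ne_top (by finiteness) (ENNReal.inv_ne_top.2 hV0))]
  set R : ℝ := 1 + ‖w - w'‖
  have hR : 0 < R := by positivity
  have h1 : ∀ c ∈ Metric.ball w R, ENNReal.ofReal (((3 * R) ^ (4 * d + 2))⁻¹) ≤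
      ENNReal.ofReal (pairWeight c w w' ^ 2) := by
    intro c hc
    rw [Metric.mem_ball, dist_comm, dist_eq_norm] at hc
    refine ENNReal.ofReal_le_ofReal ?_
    rw [pairWeight, inv_pow, ← pow_mul, show (2 * d + 1) * 2 = 4 * d + 2 by ring]
    refine inv_anti₀ (by positivity) (pow_le_pow_left₀ (by positivity) ?_ _)
    have : ‖w' - c‖ ≤ ‖w - w'‖ + ‖w - c‖ := by
      rw [norm_sub_rev w w']
      refine le_of_eq_of_le ?_ (norm_add_le _ _)
      rw [sub_add_sub_cancel]
    have : ‖w - w'‖ = R - 1 := by simp [R]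
    linarith
  have h2 : ENNReal.ofReal (R ^ (2 * d)) * V * ENNReal.ofReal (((3 * R) ^ (4 * d + 2))⁻¹) ≤
      ∫⁻ c, ENNReal.ofReal (pairWeight c w w' ^ 2) := by
    refine le_trans ?_ (setLIntegral_le_lintegral (Metric.ball w R) _)
    refine le_trans ?_ (setLIntegral_mono' measurableSet_ball h1)
    rw [setLIntegral_const, Measure.addHaar_ball_of_pos _ _ hR, finrank_phase, mul_comm]
  calc (1 : ℝ≥0∞) = (V⁻¹ * V) * ENNReal.ofReal (3 ^ (4 * d + 2) * R ^ (2 * d + 2) * (R ^ (2 * d) *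
        ((3 * R) ^ (4 * d + 2))⁻¹)) := by
        rw [ENNReal.inv_mul_cancel hV0 hV, one_mul, ← ENNReal.ofReal_one]
        congr 1
        rw [mul_pow, show 4 * d + 2 = 2 * d + 2 + 2 * d by ring, pow_add R]
        field_simp
        ring
    _ = 3 ^ (4 * d + 2) * V⁻¹ * ENNReal.ofReal (R ^ (2 * d + 2)) * (ENNReal.ofReal (R ^ (2 * d)) * V *
          ENNReal.ofReal (((3 * R) ^ (4 * d + 2))⁻¹)) := by
        rw [ENNReal.ofReal_mul (by positivity), ENNReal.ofReal_mul (by positivity),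
          ENNReal.ofReal_mul (by positivity), ENNReal.ofReal_pow (by norm_num : (0 : ℝ) ≤ 3), ENNReal.ofReal_ofNat]
        ring
    _ ≤ _ := by gcongr

theorem pairWeight_sq_le_mul (c w w' : Phase d) :
    pairWeight c w w' ^ 2 ≤ decay (2 * d + 1) (w - c) * decay (2 * d + 1) (w' - c) := by
  have h1 := norm_nonneg (w - c)
  have h2 := norm_nonneg (w' - c)
  rw [pairWeight, decay, decay, ← mul_inv, ← mul_pow, inv_pow, ← pow_mul, mul_comm _ 2, pow_mul]
  refine inv_anti₀ (by positivity) (pow_le_pow_left₀ (by positivity) ?_ _)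
  nlinarith [mul_nonneg h1 h2]

theorem pairWeight_sq_le_midpoint (c w w' : Phase d) :
    pairWeight c w w' ^ 2 ≤
      decay (2 * d + 1) ((1 / 2 : ℝ) • (w + w') - c) * decay (2 * d + 1) (w - w') := by
  have h1 := norm_nonneg (w - c)
  have h2 := norm_nonneg (w' - c)
  have h3 : ‖(1 / 2 : ℝ) • (w + w') - c‖ ≤ ‖w - c‖ + ‖w' - c‖ := by
    have : (1 / 2 : ℝ) • (w + w') - c = (1 / 2 : ℝ) • (w - c) + (1 / 2 : ℝ) • (w' - c) := by module
    rw [this]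
    refine (norm_add_le _ _).trans ?_
    rw [norm_smul, norm_smul]
    norm_num
    linarith
  have h4 : ‖w - w'‖ ≤ ‖w - c‖ + ‖w' - c‖ := by
    rw [norm_sub_rev w' c, ← sub_add_sub_cancel w c w']
    exact norm_add_le _ _
  rw [pairWeight, decay, decay, ← mul_inv, inv_pow, sq]
  refine inv_anti₀ (by positivity) (mul_le_mul (pow_le_pow_left₀ (by positivity) (by linarith) _)
    (pow_le_pow_left₀ (by positivity) (by linarith) _) (by positivity) (by positivity))

set_option maxHeartbeats 1000000 in
/-- An `L²` bound for integral operators on phase space whose kernel has square-integrable decay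
off the diagonal, uniformly along the diagonal. -/
theorem exists_lintegral_kernel_le (d : ℕ) : ∃ C : ℝ≥0, ∀ (m : Phase d → Phase d → ℝ≥0∞)
    (U V : Phase d → ℝ≥0∞) (B : ℝ≥0∞), Measurable (Function.uncurry m) → Measurable U → Measurable V →
    (∀ a, ∫⁻ b, ENNReal.ofReal ((1 + ‖b‖) ^ (2 * (d + 2))) * m a b ^ 2 ≤ B) →
    (∫⁻ w : Phase d × Phase d, m ((1 / 2 : ℝ) • (w.1 + w.2)) (w.1 - w.2) * (U w.1 * V w.2)) ^ 2 ≤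
      C * B * ((∫⁻ w, U w ^ 2) * ∫⁻ w, V w ^ 2) := by
  obtain ⟨C, hC⟩ := exists_one_le_lintegral_pairWeight d
  set I := ∫⁻ s : Phase d, ENNReal.ofReal (decay (2 * d + 1) s)
  have hI : I ≠ ⊤ := (lintegral_decay_lt_top (by rw [finrank_phase]; omega)).ne
  have hIs : ∀ c : Phase d, ∫⁻ s : Phase d, ENNReal.ofReal (decay (2 * d + 1) (s - c)) = I := fun c =>
    lintegral_sub_right_eq_self (fun s => ENNReal.ofReal (decay (2 * d + 1) s)) c
  have hIs' : ∀ w : Phase d, ∫⁻ c : Phase d, ENNReal.ofReal (decay (2 * d + 1) (w - c)) = I := fun w => by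
    rw [← hIs w]
    refine lintegral_congr fun c => ?_
    rw [decay, decay, norm_sub_rev]
  have hdm : Measurable fun s : Phase d => ENNReal.ofReal (decay (2 * d + 1) s) :=
    (continuous_decay _).measurable.ennreal_ofReal
  have hdc : ∀ c : Phase d, Measurable fun s : Phase d => ENNReal.ofReal (decay (2 * d + 1) (s - c)) :=
    fun c => hdm.comp (measurable_id.sub_const c)
  have hdc' : ∀ w : Phase d, Measurable fun c : Phase d => ENNReal.ofReal (decay (2 * d + 1) (w - c)) :=
    fun w => hdm.comp (measurable_id.const_sub w)
  refine ⟨(C ^ 2 * I.toNNReal ^ 3), fun m U V B hm hU hV hB => ?_⟩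
  push_cast
  rw [ENNReal.coe_toNNReal hI]
  set M : Phase d × Phase d → ℝ≥0∞ := fun w => m ((1 / 2 : ℝ) • (w.1 + w.2)) (w.1 - w.2)
  have hMm : Measurable M := hm.comp (g := Function.uncurry m)
      (f := fun w : Phase d × Phase d => ((1 / 2 : ℝ) • (w.1 + w.2), w.1 - w.2))
      (Continuous.measurable (by fun_prop))
  set ρ : Phase d × Phase d → ℝ≥0∞ := fun w => ENNReal.ofReal ((1 + ‖w.1 - w.2‖) ^ (2 * d + 2))
  have hρm : Measurable ρ := by
    have : Continuous fun w : Phase d × Phase d => (1 + ‖w.1 - w.2‖) ^ (2 * d + 2) := by fun_prop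
    exact this.measurable.ennreal_ofReal
  set χ : Phase d → Phase d × Phase d → ℝ≥0∞ := fun c w => ENNReal.ofReal (pairWeight c w.1 w.2)
  have hχm : Measurable (Function.uncurry χ) := (continuous_pairWeight (d := d)).measurable.ennreal_ofReal
  have hχm1 : ∀ c, Measurable (χ c) := fun c => hχm.of_uncurry_left
  have hχsq : ∀ c w, χ c w ^ 2 = ENNReal.ofReal (pairWeight c w.1 w.2 ^ 2) := fun c w => by
    simp only [χ]; rw [ENNReal.ofReal_pow (pairWeight_pos _ _ _).le]
  set UV : Phase d × Phase d → ℝ≥0∞ := fun w => U w.1 * V w.2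
  have hUVm : Measurable UV := (hU.comp measurable_fst).mul (hV.comp measurable_snd)
  set P : Phase d → ℝ≥0∞ := fun c => ∫⁻ w, ENNReal.ofReal (decay (2 * d + 1) (w - c)) * U w ^ 2
  set Q : Phase d → ℝ≥0∞ := fun c => ∫⁻ w, ENNReal.ofReal (decay (2 * d + 1) (w - c)) * V w ^ 2
  set J : Phase d → ℝ≥0∞ := fun c => ∫⁻ w, (M w * ρ w * χ c w) * (χ c w * UV w)
  have hdm2 : Measurable fun q : Phase d × Phase d => ENNReal.ofReal (decay (2 * d + 1) (q.2 - q.1)) :=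
    hdm.comp (Continuous.measurable (by fun_prop))
  have hPm : Measurable P := by
    exact Measurable.lintegral_prod_right (f := fun c w => ENNReal.ofReal (decay (2 * d + 1) (w - c)) * U w ^ 2)
      (hdm2.mul ((hU.comp measurable_snd).pow_const 2))
  have hQm : Measurable Q := by
    exact Measurable.lintegral_prod_right (f := fun c w => ENNReal.ofReal (decay (2 * d + 1) (w - c)) * V w ^ 2)
      (hdm2.mul ((hV.comp measurable_snd).pow_const 2))
  have intP : ∀ {W : Phase d → ℝ≥0∞}, Measurable W →
      ∫⁻ c, ∫⁻ w, ENNReal.ofReal (decay (2 * d + 1) (w - c)) * W w ^ 2 = I * ∫⁻ w, W w ^ 2 := by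
    intro W hW
    rw [lintegral_lintegral_swap (hdm2.mul ((hW.comp measurable_snd).pow_const 2)).aemeasurable]
    rw [← lintegral_const_mul _ (hW.pow_const 2)]
    refine lintegral_congr fun w => ?_
    rw [lintegral_mul_const _ (hdc' w), hIs']
  have stepJ : ∀ c, J c ^ 2 ≤ (I * B) * (P c * Q c) := by
    intro c
    refine (lintegral_mul_sq_le ((hMm.mul hρm).mul (hχm1 c)).aemeasurable
      ((hχm1 c).mul hUVm).aemeasurable).trans (mul_le_mul' ?_ ?_)
    · calc _ ≤ ∫⁻ w : Phase d × Phase d, (fun a b => ENNReal.ofReal (decay (2 * d + 1) (a - c)) *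
              (ENNReal.ofReal ((1 + ‖b‖) ^ (2 * (d + 2))) * m a b ^ 2)) ((1 / 2 : ℝ) • (w.1 + w.2)) (w.1 - w.2) := by
            refine lintegral_mono fun w => ?_
            simp only [Pi.mul_apply]
            rw [mul_pow, hχsq, mul_pow]
            have h1 : ρ w ^ 2 * ENNReal.ofReal (pairWeight c w.1 w.2 ^ 2) ≤
                ENNReal.ofReal (decay (2 * d + 1) ((1 / 2 : ℝ) • (w.1 + w.2) - c)) *
                  ENNReal.ofReal ((1 + ‖w.1 - w.2‖) ^ (2 * (d + 2))) := by
              simp only [ρ]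
              rw [← ENNReal.ofReal_pow (by positivity), ← ENNReal.ofReal_mul (by positivity),
                ← ENNReal.ofReal_mul (decay_pos _ _).le]
              refine ENNReal.ofReal_le_ofReal ?_
              refine (mul_le_mul_of_nonneg_left (pairWeight_sq_le_midpoint c w.1 w.2) (by positivity)).trans ?_
              rw [mul_left_comm]
              refine mul_le_mul_of_nonneg_left ?_ (decay_pos _ _).le
              rw [decay, ← pow_mul, ← div_eq_mul_inv, div_le_iff₀ (by positivity), ← pow_add]
              refine pow_le_pow_right₀ (by linarith [norm_nonneg (w.1 - w.2)]) (by omega)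
            calc _ = M w ^ 2 * (ρ w ^ 2 * ENNReal.ofReal (pairWeight c w.1 w.2 ^ 2)) := by ring
              _ ≤ M w ^ 2 * _ := mul_le_mul_right h1 _
              _ = _ := by simp only [M]; ring
        _ = ∫⁻ b, ∫⁻ a, ENNReal.ofReal (decay (2 * d + 1) (a - c)) *
              (ENNReal.ofReal ((1 + ‖b‖) ^ (2 * (d + 2))) * m a b ^ 2) := by
            refine lintegral_midpoint_sub (H := fun a b => ENNReal.ofReal (decay (2 * d + 1) (a - c)) *
              (ENNReal.ofReal ((1 + ‖b‖) ^ (2 * (d + 2))) * m a b ^ 2)) ?_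
            refine ((hdc c).comp measurable_fst).mul (Measurable.mul ?_ (hm.pow_const 2))
            have : Continuous fun q : Phase d × Phase d => (1 + ‖q.2‖) ^ (2 * (d + 2)) := by fun_prop
            exact this.measurable.ennreal_ofReal
        _ = ∫⁻ a, ∫⁻ b, ENNReal.ofReal (decay (2 * d + 1) (a - c)) *
              (ENNReal.ofReal ((1 + ‖b‖) ^ (2 * (d + 2))) * m a b ^ 2) := by
            refine (lintegral_lintegral_swap (Measurable.aemeasurable ?_)).symm
            refine ((hdc c).comp measurable_fst).mul (Measurable.mul ?_ (hm.pow_const 2))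
            have : Continuous fun q : Phase d × Phase d => (1 + ‖q.2‖) ^ (2 * (d + 2)) := by fun_prop
            exact this.measurable.ennreal_ofReal
        _ ≤ ∫⁻ a, ENNReal.ofReal (decay (2 * d + 1) (a - c)) * B := by
            refine lintegral_mono fun a => ?_
            rw [lintegral_const_mul' _ _ ENNReal.ofReal_ne_top]
            exact mul_le_mul_right (hB a) _
        _ = _ := by rw [lintegral_mul_const _ (hdc c), hIs]
    · calc _ ≤ ∫⁻ w : Phase d × Phase d, (ENNReal.ofReal (decay (2 * d + 1) (w.1 - c)) * U w.1 ^ 2) *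
              (ENNReal.ofReal (decay (2 * d + 1) (w.2 - c)) * V w.2 ^ 2) := by
            refine lintegral_mono fun w => ?_
            simp only [Pi.mul_apply]
            rw [mul_pow, hχsq]
            have h1 : ENNReal.ofReal (pairWeight c w.1 w.2 ^ 2) ≤
                ENNReal.ofReal (decay (2 * d + 1) (w.1 - c)) * ENNReal.ofReal (decay (2 * d + 1) (w.2 - c)) := by
              rw [← ENNReal.ofReal_mul (decay_pos _ _).le]
              exact ENNReal.ofReal_le_ofReal (pairWeight_sq_le_mul c w.1 w.2)
            refine (mul_le_mul_left h1 _).trans (le_of_eq ?_)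
            simp only [UV]; ring
        _ = P c * Q c := by
            refine lintegral_prod_mul (μ := (volume : Measure (Phase d))) (ν := (volume : Measure (Phase d)))
              (f := fun w => ENNReal.ofReal (decay (2 * d + 1) (w - c)) * U w ^ 2)
              (g := fun w => ENNReal.ofReal (decay (2 * d + 1) (w - c)) * V w ^ 2) ?_ ?_
            · exact ((hdc c).mul (hU.pow_const 2)).aemeasurable
            · exact ((hdc c).mul (hV.pow_const 2)).aemeasurable
  have hsqrt : ∀ x : ℝ≥0∞, (x ^ (1 / 2 : ℝ)) ^ 2 = x := by
    intro x
    rw [← ENNReal.rpow_natCast, ← ENNReal.rpow_mul]; norm_num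
  have hJ : ∀ c, J c ≤ (I * B) ^ (1 / 2 : ℝ) * (P c ^ (1 / 2 : ℝ) * Q c ^ (1 / 2 : ℝ)) := by
    intro c
    have := stepJ c
    rw [← hsqrt (I * B), ← hsqrt (P c), ← hsqrt (Q c), ← mul_pow, ← mul_pow] at this
    exact (ENNReal.pow_le_pow_left_iff two_ne_zero).1 this
  have step1 : ∫⁻ w, M w * UV w ≤ C * ∫⁻ c, J c := by
    have hJm : Measurable fun q : Phase d × (Phase d × Phase d) =>
        (M q.2 * ρ q.2 * χ q.1 q.2) * (χ q.1 q.2 * UV q.2) :=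
      (((hMm.comp measurable_snd).mul (hρm.comp measurable_snd)).mul hχm).mul
        (hχm.mul (hUVm.comp measurable_snd))
    calc _ ≤ ∫⁻ w, C * ∫⁻ c, (M w * ρ w * χ c w) * (χ c w * UV w) := by
          refine lintegral_mono fun w => ?_
          have e : ∀ c, (M w * ρ w * χ c w) * (χ c w * UV w) =
              (M w * ρ w * UV w) * ENNReal.ofReal (pairWeight c w.1 w.2 ^ 2) := by
            intro c; rw [← hχsq]; ring
          simp only [e]
          rw [lintegral_const_mul _ (by
            simp only [← fun c => hχsq c w]
            exact (hχm.of_uncurry_right (y := w)).pow_const 2)]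
          calc M w * UV w = M w * UV w * 1 := (mul_one _).symm
            _ ≤ M w * UV w * (C * ρ w * ∫⁻ c, ENNReal.ofReal (pairWeight c w.1 w.2 ^ 2)) :=
              mul_le_mul_right (hC w.1 w.2) _
            _ = _ := by ring
      _ = C * ∫⁻ w, ∫⁻ c, (M w * ρ w * χ c w) * (χ c w * UV w) :=
          lintegral_const_mul' _ _ ENNReal.coe_ne_top
      _ = _ := by
          congr 1
          exact (lintegral_lintegral_swap hJm.aemeasurable).symm
  calc _ ≤ (C * ∫⁻ c, J c) ^ 2 := pow_le_pow_left' step1 2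
    _ ≤ (C * ∫⁻ c, (I * B) ^ (1 / 2 : ℝ) * (P c ^ (1 / 2 : ℝ) * Q c ^ (1 / 2 : ℝ))) ^ 2 := by
        gcongr with c; exact hJ c
    _ = C ^ 2 * (I * B) * (∫⁻ c, P c ^ (1 / 2 : ℝ) * Q c ^ (1 / 2 : ℝ)) ^ 2 := by
        rw [lintegral_const_mul _ (show Measurable fun c => P c ^ (1 / 2 : ℝ) * Q c ^ (1 / 2 : ℝ) from
          (hPm.pow_const _).mul (hQm.pow_const _)), mul_pow, mul_pow, hsqrt, ← mul_assoc]
    _ ≤ C ^ 2 * (I * B) * ((∫⁻ c, P c) * ∫⁻ c, Q c) := by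
        gcongr
        refine (lintegral_mul_sq_le (hPm.pow_const _).aemeasurable (hQm.pow_const _).aemeasurable).trans ?_
        simp only [hsqrt, le_refl]
    _ = _ := by
        simp only [P, Q]
        rw [intP hU, intP hV]; ring

end

section

/-! ### The packet kernel -/

variable {d : ℕ}

theorem rot_rot (z : Phase d) : rot d (rot d z) = -z := by
  ext1 <;> simp

/-- The displacement in phase space, expressed as a frequency. -/
def freq (d : ℕ) : Phase d ≃L[ℝ] Phase d :=
  ContinuousLinearEquiv.equivOfInverse (-(2 * Real.pi)⁻¹ • rot d) ((2 * Real.pi) • rot d)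
    (fun z => by
      have := Real.pi_pos.ne'
      simp only [_root_.smul_apply, map_smul, rot_rot, smul_smul]
      rw [show -(2 * Real.pi)⁻¹ * (2 * Real.pi) = -1 by field_simp]
      simp)
    (fun z => by
      have := Real.pi_pos.ne'
      simp only [_root_.smul_apply, map_smul, rot_rot, smul_smul]
      rw [show 2 * Real.pi * -(2 * Real.pi)⁻¹ = -1 by field_simp]
      simp)

theorem freq_apply (z : Phase d) : freq d z = -(2 * Real.pi)⁻¹ • rot d z := rfl

theorem one_add_norm_le_freq (b : Phase d) : 1 + ‖b‖ ≤ 2 * Real.pi * (1 + ‖freq d b‖) := by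
  rw [freq_apply, norm_smul, norm_rot, Real.norm_eq_abs, abs_neg, abs_inv,
    abs_of_pos (by have := Real.pi_pos; positivity), mul_add, mul_inv_cancel_left₀
      (by have := Real.pi_pos; positivity)]
  linarith [Real.pi_gt_three]

theorem continuous_phasePairing_packet {f : Phase d × Phase d → ℂ} (hf : SL1 f) :
    Continuous fun q : ℝ × Phase d × Phase d => phasePairing q.1 (packet q.2.1 q.2.2) f := by
  unfold phasePairing
  have hc : Continuous (ft (pairForm d) f) := continuous_ft (pairForm d) hf.integrable
  have hE : Continuous fun q : (ℝ × Phase d × Phase d) × (Phase d × Phase d) =>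
      expChar (-(Real.pi * q.1.1 * symp q.2.2 q.2.1)) * packet q.1.2.1 q.1.2.2 q.2.1 := by
    refine Continuous.mul (continuous_expChar.comp ?_) ?_
    · simp only [symp_eq]; fun_prop
    · exact continuous_packet.comp (g := fun q : Phase d × Phase d × Phase d => packet q.1 q.2.1 q.2.2)
        (f := fun q : (ℝ × Phase d × Phase d) × (Phase d × Phase d) => (q.1.2.1, q.1.2.2, q.2.1)) (by fun_prop)
  refine continuous_of_dominated (bound := fun θ => ‖ft (pairForm d) f θ‖) (fun q => ?_)
    (fun q => Filter.Eventually.of_forall fun θ => ?_) ?_ (Filter.Eventually.of_forall fun θ => ?_)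
  · exact (hc.mul (hE.comp (by fun_prop : Continuous fun θ : Phase d × Phase d => (q, θ)))).aestronglyMeasurable
  · rw [norm_mul, norm_mul, norm_expChar, one_mul]
    exact mul_le_of_le_one_right (norm_nonneg _) (norm_packet_le_one _ _ _)
  · have := integrable_ft_mul hf (E := fun _ => 1) continuous_const (C := 1) (by simp)
    simpa using this.norm
  · exact continuous_const.mul (hE.comp (by fun_prop : Continuous fun q : ℝ × Phase d × Phase d => (q, θ)))

theorem continuous_ft_windowed {f : Phase d × Phase d → ℂ} (hf : SL1 f) :
    Continuous fun q : Phase d × Phase d × Phase d => ft (pairForm d) (windowed f q.1) q.2 := by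
  unfold ft windowed
  have hE : Continuous fun q : (Phase d × Phase d × Phase d) × (Phase d × Phase d) =>
      expChar (-pairForm d q.2 q.1.2) * ((gauss (q.2.1 + -q.1.1) : ℂ) * f q.2) := by
    refine Continuous.mul (continuous_expChar.comp ?_) (Continuous.mul ?_ (hf.continuous.comp continuous_snd))
    · simp only [pairForm_apply, phaseForm_apply]; fun_prop
    · exact Complex.continuous_ofReal.comp (continuous_gauss.comp (by fun_prop))
  refine continuous_of_dominated (bound := fun w => ‖f w‖) (fun q => ?_)
    (fun q => Filter.Eventually.of_forall fun w => ?_) hf.integrable.norm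
    (Filter.Eventually.of_forall fun w => ?_)
  · exact (hE.comp (by fun_prop : Continuous fun w : Phase d × Phase d => (q, w))).aestronglyMeasurable
  · rw [norm_mul, norm_mul, norm_expChar, one_mul, Complex.norm_real, Real.norm_of_nonneg (gauss_pos _).le]
    exact mul_le_of_le_one_left (norm_nonneg _) (gauss_le_one _)
  · have h := hE.comp' (by fun_prop : Continuous fun q : Phase d × Phase d × Phase d => (q, w))
    exact h

/-- The kernel obtained by pairing with wave packets. -/
def packetKernel (t : ℝ) (f : Phase d × Phase d → ℂ) (w : Phase d × Phase d) : ℂ :=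
  phasePairing t (packet ((1 / 2 : ℝ) • (w.1 + w.2)) (freq d (w.1 - w.2))) f

theorem continuous_packetKernel {f : Phase d × Phase d → ℂ} (hf : SL1 f) :
    Continuous fun q : ℝ × Phase d × Phase d => packetKernel q.1 f q.2 := by
  unfold packetKernel
  exact (continuous_phasePairing_packet hf).comp
    (by fun_prop : Continuous fun q : ℝ × Phase d × Phase d =>
      (q.1, (1 / 2 : ℝ) • (q.2.1 + q.2.2), freq d (q.2.1 - q.2.2)))

theorem measurable_packet_pairing {f : Phase d × Phase d → ℂ} (hf : SL1 f) (t : ℝ) :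
    Measurable (Function.uncurry fun a b : Phase d => ‖phasePairing t (packet a (freq d b)) f‖ₑ) := by
  have := (continuous_phasePairing_packet hf).comp'
    (by fun_prop : Continuous fun q : Phase d × Phase d => (t, q.1, freq d q.2))
  exact this.measurable.enorm

theorem exists_lintegral_packetKernel_le (d : ℕ) : ∃ C : ℝ≥0, ∀ (t : ℝ) (f : Phase d × Phase d → ℂ), SL1 f →
    ∫⁻ w, ‖packetKernel t f w‖ₑ ≤ C * ∫⁻ w, ENNReal.ofReal (derivSum (4 * d + 2) f w) := by
  obtain ⟨C, hC0, hC⟩ := exists_norm_ft_windowed_le d (2 * d + 1) (2 * d + 1) (2 * d + 1)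
  obtain ⟨C₁, -, hC₁⟩ := exists_lintegral_comp_equiv (volume : Measure (Phase d)) (freq d)
  set δ : Phase d → ℝ≥0∞ := fun s => ENNReal.ofReal (decay (2 * d + 1) s)
  have hδ : Measurable δ := (continuous_decay _).measurable.ennreal_ofReal
  set I := ∫⁻ s : Phase d, δ s
  have hI : I ≠ ⊤ := (lintegral_decay_lt_top (by rw [finrank_phase]; omega)).ne
  refine ⟨C.toNNReal * C₁ * I.toNNReal ^ 3, fun t f hf => ?_⟩
  push_cast
  rw [ENNReal.coe_toNNReal hI]
  set D : Phase d × Phase d → ℝ≥0∞ := fun w => ENNReal.ofReal (derivSum (4 * d + 2) f w)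
  have hDm : Measurable D := by
    have : Continuous (derivSum (4 * d + 2) f) := by
      unfold derivSum
      exact continuous_finsetSum _ fun k _ => (continuous_iteratedFDeriv_of_smooth hf.1 k).norm
    exact this.measurable.ennreal_ofReal
  have hδj : Measurable fun q : Phase d × (Phase d × Phase d) => δ (q.2.1 + -q.1) := by
    have : Continuous fun q : Phase d × (Phase d × Phase d) => decay (2 * d + 1) (q.2.1 + -q.1) := by fun_prop
    exact this.measurable.ennreal_ofReal
  have hHj : Measurable fun q : Phase d × (Phase d × Phase d) => δ (q.2.1 + -q.1) * D q.2 :=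
    hδj.mul (hDm.comp measurable_snd)
  set H : Phase d → ℝ≥0∞ := fun a => ∫⁻ w : Phase d × Phase d, δ (w.1 + -a) * D w
  have hHm : Measurable H := by
    exact Measurable.lintegral_prod_right
      (f := fun (a : Phase d) (w : Phase d × Phase d) => δ (w.1 + -a) * D w) hHj
  have hH : ∫⁻ a, H a = I * ∫⁻ w, D w := by
    simp only [H]
    rw [lintegral_lintegral_swap hHj.aemeasurable, ← lintegral_const_mul _ hDm]
    refine lintegral_congr fun w => ?_
    have hw : Measurable fun a : Phase d => δ (w.1 + -a) :=
      hδ.comp (measurable_const.add measurable_id.neg)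
    rw [lintegral_mul_const _ hw]
    congr 1
    refine Eq.trans ?_ (lintegral_sub_right_eq_self δ w.1)
    refine lintegral_congr fun a => ?_
    simp only [δ, decay]
    rw [← sub_eq_add_neg, norm_sub_rev]
  have hb : ∀ a b : Phase d, ‖phasePairing t (packet a (freq d b)) f‖ₑ ≤
      ∫⁻ ξ, ENNReal.ofReal C * δ (freq d b) * δ ξ * H (a - (Real.pi * t) • rot d ξ) := by
    intro a b
    refine (enorm_phasePairing_packet_le hf t a (freq d b)).trans (lintegral_mono fun ξ => ?_)
    simp only
    rw [← ofReal_norm]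
    refine (ENNReal.ofReal_le_ofReal (hC f hf _ (freq d b) ξ)).trans (le_of_eq ?_)
    have h1 := (decay_pos (2 * d + 1) (freq d b)).le
    have h2 := (decay_pos (2 * d + 1) ξ).le
    rw [ENNReal.ofReal_mul (by positivity), ENNReal.ofReal_mul (by positivity), ENNReal.ofReal_mul hC0]
    congr 1
    rw [show 2 * d + 1 + (2 * d + 1) = 4 * d + 2 by ring, ofReal_integral_eq_lintegral_ofReal]
    · refine lintegral_congr fun w => ?_
      rw [ENNReal.ofReal_mul (decay_pos _ _).le]
    · refine (integrable_derivSum hf (4 * d + 2)).bdd_mul (c := 1)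
        (Continuous.aestronglyMeasurable (by fun_prop)) (Filter.Eventually.of_forall fun w => ?_)
      rw [Real.norm_of_nonneg (decay_pos _ _).le]; exact decay_le_one _ _
    · exact Filter.Eventually.of_forall fun w => mul_nonneg (decay_pos _ _).le (derivSum_nonneg _ _ _)
  have hsm : Measurable fun q : Phase d × Phase d => H (q.1 - (Real.pi * t) • rot d q.2) := by
    have : Continuous fun q : Phase d × Phase d => q.1 - (Real.pi * t) • rot d q.2 := by fun_prop
    exact hHm.comp this.measurable
  calc ∫⁻ w, ‖packetKernel t f w‖ₑ = ∫⁻ b, ∫⁻ a, ‖phasePairing t (packet a (freq d b)) f‖ₑ :=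
        lintegral_midpoint_sub (measurable_packet_pairing hf t)
    _ ≤ ∫⁻ b, ∫⁻ a, ∫⁻ ξ, ENNReal.ofReal C * δ (freq d b) * δ ξ * H (a - (Real.pi * t) • rot d ξ) :=
        lintegral_mono fun b => lintegral_mono fun a => hb a b
    _ = ∫⁻ b, (ENNReal.ofReal C * I * ∫⁻ a, H a) * δ (freq d b) := by
        refine lintegral_congr fun b => ?_
        rw [lintegral_lintegral_swap ((((hδ.comp measurable_snd).const_mul _).mul hsm).aemeasurable)]
        have e : ∀ ξ, ∫⁻ a, ENNReal.ofReal C * δ (freq d b) * δ ξ * H (a - (Real.pi * t) • rot d ξ) =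
            (ENNReal.ofReal C * δ (freq d b) * ∫⁻ a, H a) * δ ξ := by
          intro ξ
          rw [lintegral_const_mul' _ _ (by simp only [δ]; finiteness), lintegral_sub_right_eq_self H]
          ring
        simp only [e]
        rw [lintegral_const_mul _ hδ]
        ring
    _ = _ := by
        rw [lintegral_const_mul _ (show Measurable fun b => δ (freq d b) from
          hδ.comp (freq d).continuous.measurable), hC₁ δ, hH]
        simp only [ENNReal.ofReal]
        ring

theorem exists_lintegral_packetKernel_mul_le (d : ℕ) : ∃ C : ℝ≥0, ∀ (t : ℝ) (f : Phase d × Phase d → ℂ),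
    SL1 f → ∀ U V : Phase d → ℝ≥0∞, Measurable U → Measurable V →
    (∫⁻ w, ‖packetKernel t f w‖ₑ * (U w.1 * V w.2)) ^ 2 ≤
      C * supNorm (3 * d + 3) f ^ 2 * ((∫⁻ w, U w ^ 2) * ∫⁻ w, V w ^ 2) := by
  obtain ⟨C, hC⟩ := exists_lintegral_ft_windowed_le d (d + 2) (2 * d + 1)
  obtain ⟨C₁, -, hC₁⟩ := exists_lintegral_comp_equiv (volume : Measure (Phase d)) (freq d)
  obtain ⟨C₂, hC₂⟩ := exists_lintegral_kernel_le d
  set I := ∫⁻ s : Phase d, ENNReal.ofReal (decay (2 * d + 1) s)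
  have hI : I ≠ ⊤ := (lintegral_decay_lt_top (by rw [finrank_phase]; omega)).ne
  set κ : ℝ := (2 * Real.pi) ^ (2 * (d + 2))
  have hκ : 0 ≤ κ := by have := Real.pi_pos; positivity
  have hδm : Measurable fun ξ : Phase d => ENNReal.ofReal (decay (2 * d + 1) ξ)⁻¹ :=
    (continuous_decay _).measurable.inv.ennreal_ofReal
  refine ⟨C₂ * (I.toNNReal ^ 2 * (κ.toNNReal * C₁ * C)), fun t f hf U V hU hV => ?_⟩
  push_cast
  rw [ENNReal.coe_toNNReal hI, show 3 * d + 3 = d + 2 + (2 * d + 1) by ring]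
  set S := supNorm (d + 2 + (2 * d + 1)) f
  have key := hC₂ (fun a b => ‖phasePairing t (packet a (freq d b)) f‖ₑ) U V
    (I ^ 2 * (ENNReal.ofReal κ * C₁ * C) * S ^ 2) (measurable_packet_pairing hf t) hU hV ?_
  · refine key.trans (le_of_eq ?_)
    simp only [ENNReal.ofReal]
    ring
  intro a
  set Z : Phase d → Phase d → ℂ := fun β ξ =>
    ft (pairForm d) (windowed f (a - (Real.pi * t) • rot d ξ)) (β, ξ)
  have hZ : Continuous fun q : Phase d × Phase d => Z q.1 q.2 := by
    have h := (continuous_ft_windowed hf).comp' (by fun_prop : Continuous fun q : Phase d × Phase d =>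
      (a - (Real.pi * t) • rot d q.2, q.1, q.2))
    exact h
  have hcs : ∀ b, ‖phasePairing t (packet a (freq d b)) f‖ₑ ^ 2 ≤
      I * ∫⁻ ξ, ENNReal.ofReal (decay (2 * d + 1) ξ)⁻¹ * ‖Z (freq d b) ξ‖ₑ ^ 2 := by
    intro b
    have hZb : Continuous fun ξ => Z (freq d b) ξ := by
      have h := hZ.comp' (by fun_prop : Continuous fun ξ : Phase d => (freq d b, ξ))
      exact h
    have hs : ∀ ξ : Phase d, 0 < √(decay (2 * d + 1) ξ) := fun ξ => Real.sqrt_pos.2 (decay_pos _ _)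
    have hsc : Continuous fun ξ : Phase d => √(decay (2 * d + 1) ξ) := by fun_prop
    have h1 := lintegral_mul_sq_le (μ := (volume : Measure (Phase d)))
      (f := fun ξ => ENNReal.ofReal √(decay (2 * d + 1) ξ))
      (g := fun ξ => ENNReal.ofReal (√(decay (2 * d + 1) ξ))⁻¹ * ‖Z (freq d b) ξ‖ₑ)
      hsc.measurable.ennreal_ofReal.aemeasurable
      ((hsc.measurable.inv.ennreal_ofReal).mul hZb.measurable.enorm).aemeasurable
    refine (pow_le_pow_left' (enorm_phasePairing_packet_le hf t a (freq d b)) 2).trans ?_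
    have e1 : ∀ ξ, ENNReal.ofReal √(decay (2 * d + 1) ξ) *
        (ENNReal.ofReal (√(decay (2 * d + 1) ξ))⁻¹ * ‖Z (freq d b) ξ‖ₑ) = ‖Z (freq d b) ξ‖ₑ := by
      intro ξ
      rw [← mul_assoc, ← ENNReal.ofReal_mul (hs ξ).le, mul_inv_cancel₀ (hs ξ).ne', ENNReal.ofReal_one, one_mul]
    have e2 : ∀ ξ : Phase d, ENNReal.ofReal √(decay (2 * d + 1) ξ) ^ 2 = ENNReal.ofReal (decay (2 * d + 1) ξ) := by
      intro ξ
      rw [← ENNReal.ofReal_pow (hs ξ).le, Real.sq_sqrt (decay_pos _ _).le]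
    have e3 : ∀ ξ : Phase d, (ENNReal.ofReal (√(decay (2 * d + 1) ξ))⁻¹ * ‖Z (freq d b) ξ‖ₑ) ^ 2 =
        ENNReal.ofReal (decay (2 * d + 1) ξ)⁻¹ * ‖Z (freq d b) ξ‖ₑ ^ 2 := by
      intro ξ
      rw [mul_pow, ← ENNReal.ofReal_pow (inv_pos.2 (hs ξ)).le, inv_pow, Real.sq_sqrt (decay_pos _ _).le]
    simp only [e1, e2, e3] at h1
    exact h1
  calc _ ≤ ∫⁻ b, ∫⁻ ξ, I * (ENNReal.ofReal κ * (ENNReal.ofReal (decay (2 * d + 1) ξ)⁻¹ *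
        (ENNReal.ofReal ((1 + ‖freq d b‖) ^ (2 * (d + 2))) * ‖Z (freq d b) ξ‖ₑ ^ 2))) := by
        refine lintegral_mono fun b => ?_
        simp only
        have h1 : ENNReal.ofReal ((1 + ‖b‖) ^ (2 * (d + 2))) ≤
            ENNReal.ofReal κ * ENNReal.ofReal ((1 + ‖freq d b‖) ^ (2 * (d + 2))) := by
          rw [← ENNReal.ofReal_mul hκ, ← mul_pow]
          exact ENNReal.ofReal_le_ofReal (pow_le_pow_left₀ (by positivity) (one_add_norm_le_freq b) _)
        refine (mul_le_mul' h1 (hcs b)).trans (le_of_eq ?_)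
        rw [lintegral_const_mul' _ _ hI, lintegral_const_mul' _ _ ENNReal.ofReal_ne_top]
        simp_rw [mul_left_comm (ENNReal.ofReal (decay (2 * d + 1) _)⁻¹)]
        rw [lintegral_const_mul' _ _ ENNReal.ofReal_ne_top]
        ring
    _ = I * (ENNReal.ofReal κ * ∫⁻ ξ, ENNReal.ofReal (decay (2 * d + 1) ξ)⁻¹ *
        ∫⁻ b, ENNReal.ofReal ((1 + ‖freq d b‖) ^ (2 * (d + 2))) * ‖Z (freq d b) ξ‖ₑ ^ 2) := by
        rw [lintegral_lintegral_swap]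
        · rw [← lintegral_const_mul' _ _ ENNReal.ofReal_ne_top, ← lintegral_const_mul' _ _ hI]
          refine lintegral_congr fun ξ => ?_
          rw [lintegral_const_mul' _ _ hI, lintegral_const_mul' _ _ ENNReal.ofReal_ne_top,
            lintegral_const_mul' _ _ ENNReal.ofReal_ne_top]
        · have hn : Continuous fun q : Phase d × Phase d => (1 + ‖freq d q.1‖) ^ (2 * (d + 2)) := by fun_prop
          have hZ' : Continuous fun q : Phase d × Phase d => Z (freq d q.1) q.2 := by
            have h := hZ.comp' (by fun_prop : Continuous fun q : Phase d × Phase d => (freq d q.1, q.2))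
            exact h
          exact (((((hδm.comp measurable_snd).mul (hn.measurable.ennreal_ofReal.mul
            (hZ'.measurable.enorm.pow_const 2))).const_mul _).const_mul _)).aemeasurable
    _ ≤ I * (ENNReal.ofReal κ * ∫⁻ ξ, (C₁ * C * S ^ 2) * ENNReal.ofReal (decay (2 * d + 1) ξ)) := by
        refine mul_le_mul_right (mul_le_mul_right (lintegral_mono fun ξ => ?_) _) _
        simp only
        rw [hC₁ fun β => ENNReal.ofReal ((1 + ‖β‖) ^ (2 * (d + 2))) * ‖Z β ξ‖ₑ ^ 2]
        have h1 : ENNReal.ofReal (decay (2 * d + 1) ξ)⁻¹ * ENNReal.ofReal (decay (2 * d + 1) ξ) = 1 := by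
          rw [← ENNReal.ofReal_mul (inv_pos.2 (decay_pos _ _)).le, inv_mul_cancel₀ (decay_pos _ _).ne',
            ENNReal.ofReal_one]
        calc _ ≤ ENNReal.ofReal (decay (2 * d + 1) ξ)⁻¹ * (C₁ * (C * ENNReal.ofReal (decay (2 * d + 1) ξ) ^ 2 * S ^ 2)) := by
              gcongr
              exact hC f hf _ ξ
          _ = (ENNReal.ofReal (decay (2 * d + 1) ξ)⁻¹ * ENNReal.ofReal (decay (2 * d + 1) ξ)) *
              ((C₁ * C * S ^ 2) * ENNReal.ofReal (decay (2 * d + 1) ξ)) := by ring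
          _ = _ := by rw [h1, one_mul]
    _ = _ := by
        rw [lintegral_const_mul _ (continuous_decay _).measurable.ennreal_ofReal]
        ring

end

section

/-! ### Weighted bounds for the packet kernel -/

variable {d : ℕ}

theorem packetKernel_congr {t : ℝ} {f h : Phase d × Phase d → ℂ}
    (hh : ∀ x : Phase d → ℂ, Continuous x → ∀ B : ℝ, (∀ α, ‖x α‖ ≤ B) →
      phasePairing t x h = phasePairing t x f) :
    packetKernel t h = packetKernel t f := by
  funext w
  refine hh _ ?_ 1 fun α => norm_packet_le_one _ _ _
  have := (continuous_packet (d := d)).comp' (by fun_prop : Continuous fun α : Phase d =>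
    ((1 / 2 : ℝ) • (w.1 + w.2), freq d (w.1 - w.2), α))
  exact this

theorem exists_lintegral_packetKernel_le_weighted (d G : ℕ) : ∃ C : ℝ≥0, ∀ (t : ℝ), |t| ≤ 1 →
    ∀ (f : Phase d × Phase d → ℂ), SL1 f →
    ∫⁻ w, ‖packetKernel t f w‖ₑ ≤
      C * ∫⁻ w : Phase d × Phase d, ENNReal.ofReal (derivSum (G + 4 * d + 2) f w / japBracket w.2 ^ G) := by
  obtain ⟨C, hC⟩ := exists_lintegral_packetKernel_le d
  obtain ⟨C', h0, hC'⟩ := exists_weighted d G (4 * d + 2)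
  refine ⟨C * C'.toNNReal, fun t ht f hf => ?_⟩
  obtain ⟨h, hh, hp, hb⟩ := hC' t ht f hf
  rw [← packetKernel_congr hp]
  refine (hC t h hh).trans ?_
  push_cast
  rw [mul_assoc, ← lintegral_const_mul' (C'.toNNReal : ℝ≥0∞) _ ENNReal.coe_ne_top]
  refine mul_le_mul_right (lintegral_mono fun w => ?_) _
  refine (ENNReal.ofReal_le_ofReal (hb w)).trans (le_of_eq ?_)
  rw [ENNReal.ofReal_mul h0, add_assoc]; rfl

theorem exists_lintegral_packetKernel_mul_le_weighted (d G : ℕ) : ∃ C : ℝ≥0, ∀ (t : ℝ), |t| ≤ 1 →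
    ∀ (f : Phase d × Phase d → ℂ), SL1 f → ∀ U V : Phase d → ℝ≥0∞, Measurable U → Measurable V →
    (∫⁻ w, ‖packetKernel t f w‖ₑ * (U w.1 * V w.2)) ^ 2 ≤
      C * (∫⁻ v : Phase d, ⨆ s : Phase d,
        ENNReal.ofReal (derivSum (G + 3 * d + 3) f (s, v) / japBracket v ^ G)) ^ 2 *
        ((∫⁻ w, U w ^ 2) * ∫⁻ w, V w ^ 2) := by
  obtain ⟨C, hC⟩ := exists_lintegral_packetKernel_mul_le d
  obtain ⟨C', h0, hC'⟩ := exists_weighted d G (3 * d + 3)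
  refine ⟨C * C'.toNNReal ^ 2, fun t ht f hf U V hU hV => ?_⟩
  obtain ⟨h, hh, hp, hb⟩ := hC' t ht f hf
  rw [← packetKernel_congr hp]
  refine (hC t h hh U V hU hV).trans ?_
  push_cast
  rw [mul_assoc (C : ℝ≥0∞) (_ ^ 2) (_ ^ 2), ← mul_pow, ← lintegral_const_mul' _ _ ENNReal.coe_ne_top]
  refine mul_le_mul_left (mul_le_mul_right (pow_le_pow_left' ?_ 2) _) _
  unfold supNorm
  refine lintegral_mono fun v => iSup_le fun s => ?_
  refine (ENNReal.ofReal_le_ofReal (hb (s, v))).trans ?_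
  rw [ENNReal.ofReal_mul h0, ← add_assoc]
  exact mul_le_mul_right (le_iSup (fun s => ENNReal.ofReal (derivSum (G + 3 * d + 3) f (s, v) / japBracket v ^ G)) s) _

end

section

/-! ### Coherent states -/

variable {d : ℕ}

/-- The coherent state centred at the phase space point `w`. -/
def cohFun (w : Phase d) (x : Conf d) : ℂ :=
  expChar ((2 * Real.pi)⁻¹ * inner ℝ w.2 (x - (1 / 2 : ℝ) • w.1)) * (Real.exp (-(‖x - w.1‖ ^ 2 / 2)) : ℂ)

theorem continuous_cohFun : Continuous fun q : Phase d × Conf d => cohFun q.1 q.2 := by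
  unfold cohFun
  refine (continuous_expChar.comp' ?_).mul (Complex.continuous_ofReal.comp' ?_)
  · fun_prop
  · fun_prop

theorem continuous_cohFun_right (w : Phase d) : Continuous (cohFun w) := by
  have h := continuous_cohFun.comp' (by fun_prop : Continuous fun x : Conf d => (w, x))
  exact h

theorem norm_cohFun (w : Phase d) (x : Conf d) : ‖cohFun w x‖ = Real.exp (-(‖x - w.1‖ ^ 2 / 2)) := by
  rw [cohFun, norm_mul, norm_expChar, one_mul, Complex.norm_real, Real.norm_of_nonneg (Real.exp_pos _).le]

theorem integrable_exp_neg_norm_sq {r : ℝ} (hr : 0 < r) (c : Conf d) :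
    Integrable fun x : Conf d => Real.exp (-(r * ‖x - c‖ ^ 2)) := by
  have h := GaussianFourier.integrable_cexp_neg_mul_sq_norm_add (V := Conf d) (b := r)
    (by simpa using hr) 0 0
  have h2 := (h.norm).comp_sub_right c
  refine h2.congr (Filter.Eventually.of_forall fun x => ?_)
  simp only [Complex.norm_exp]
  congr 1
  simp [← Complex.ofReal_pow]

theorem memLp_cohFun (w : Phase d) : MemLp (cohFun w) 2 (volume : Measure (Conf d)) := by
  rw [memLp_two_iff_integrable_sq_norm (continuous_cohFun_right w).aestronglyMeasurable]
  refine (integrable_exp_neg_norm_sq one_pos w.1).congr (Filter.Eventually.of_forall fun x => ?_)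
  simp only
  rw [norm_cohFun, ← Real.exp_nat_mul]
  congr 1; push_cast; ring

/-- The coherent state as a vector of `L²`. -/
def coh (w : Phase d) : L2 d := (memLp_cohFun w).toLp

theorem coh_coeFn (w : Phase d) : coh w =ᵐ[volume] cohFun w := MemLp.coeFn_toLp _

theorem conj_expChar (r : ℝ) : (starRingEnd ℂ) (expChar r) = expChar (-r) := by
  rw [expChar, expChar, ← Complex.exp_conj]
  congr 1
  simp
  exact Or.inl (map_ofNat _ 2)

/-- The squared norm of the coherent states. -/
def cohNormSq (d : ℕ) : ℝ := Real.pi ^ ((d : ℝ) / 2)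

theorem cohNormSq_pos (d : ℕ) : 0 < cohNormSq d := Real.rpow_pos_of_pos Real.pi_pos _

theorem inner_coh (w u : Phase d) : inner ℂ (coh w) (coh u) =
    cohNormSq d * (expChar ((4 * Real.pi)⁻¹ * symp w u) * (gauss ((1 / 2 : ℝ) • (w - u)) : ℂ)) := by
  have hpi := Real.pi_pos.ne'
  have e1 : inner ℂ (coh w) (coh u) = ∫ x, (starRingEnd ℂ) (cohFun w x) * cohFun u x := by
    rw [L2.inner_def]
    refine integral_congr_ae ?_
    filter_upwards [coh_coeFn w, coh_coeFn u] with x h1 h2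
    rw [h1, h2, RCLike.inner_apply, mul_comm]
  rw [e1, ← integral_add_right_eq_self _ ((1 / 2 : ℝ) • (w.1 + u.1))]
  have e2 : ∀ y : Conf d, (starRingEnd ℂ) (cohFun w (y + (1 / 2 : ℝ) • (w.1 + u.1))) *
      cohFun u (y + (1 / 2 : ℝ) • (w.1 + u.1)) =
      (expChar ((4 * Real.pi)⁻¹ * symp w u) * (Real.exp (-(‖(1 / 2 : ℝ) • (w - u).1‖ ^ 2)) : ℂ)) *
        Complex.exp (-(1 : ℂ) * ‖y‖ ^ 2 + Complex.I * (inner ℝ (u.2 - w.2) y : ℝ)) := by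
    intro y
    have hk1 : y + (1 / 2 : ℝ) • (w.1 + u.1) - w.1 = y - (1 / 2 : ℝ) • (w - u).1 := by
      rw [Prod.fst_sub]; module
    have hk2 : y + (1 / 2 : ℝ) • (w.1 + u.1) - u.1 = y + (1 / 2 : ℝ) • (w - u).1 := by
      rw [Prod.fst_sub]; module
    have hp := parallelogram_law_with_norm ℝ y ((1 / 2 : ℝ) • (w - u).1)
    simp only [cohFun, map_mul, conj_expChar, Complex.conj_ofReal, hk1, hk2]
    set k := (1 / 2 : ℝ) • (w - u).1
    have h1 : Real.exp (-(‖y - k‖ ^ 2 / 2)) * Real.exp (-(‖y + k‖ ^ 2 / 2)) =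
        Real.exp (-(‖k‖ ^ 2)) * Real.exp (-(‖y‖ ^ 2)) := by
      rw [← Real.exp_add, ← Real.exp_add]; congr 1; nlinarith
    have h2 : -((2 * Real.pi)⁻¹ * inner ℝ w.2 (y + (1 / 2 : ℝ) • (w.1 + u.1) - (1 / 2 : ℝ) • w.1)) +
        (2 * Real.pi)⁻¹ * inner ℝ u.2 (y + (1 / 2 : ℝ) • (w.1 + u.1) - (1 / 2 : ℝ) • u.1) =
        (4 * Real.pi)⁻¹ * symp w u + (2 * Real.pi)⁻¹ * inner ℝ (u.2 - w.2) y := by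
      rw [symp_eq]
      simp only [inner_sub_right, inner_add_right, real_inner_smul_right, inner_sub_left,
        real_inner_comm w.1 u.2, real_inner_comm w.1 w.2]
      field_simp
      ring
    have h3 : Complex.exp (-(1 : ℂ) * ‖y‖ ^ 2 + Complex.I * (inner ℝ (u.2 - w.2) y : ℝ)) =
        (Real.exp (-(‖y‖ ^ 2)) : ℂ) * expChar ((2 * Real.pi)⁻¹ * inner ℝ (u.2 - w.2) y) := by
      rw [Complex.exp_add, expChar, Complex.ofReal_exp]
      congr 2
      · push_cast; ring
      · push_cast
        have : (Real.pi : ℂ) ≠ 0 := by exact_mod_cast hpi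
        field_simp
    rw [h3]
    calc _ = (expChar (-((2 * Real.pi)⁻¹ * inner ℝ w.2 (y + (1 / 2 : ℝ) • (w.1 + u.1) - (1 / 2 : ℝ) • w.1))) *
          expChar ((2 * Real.pi)⁻¹ * inner ℝ u.2 (y + (1 / 2 : ℝ) • (w.1 + u.1) - (1 / 2 : ℝ) • u.1))) *
          ((Real.exp (-(‖y - k‖ ^ 2 / 2)) * Real.exp (-(‖y + k‖ ^ 2 / 2)) : ℝ) : ℂ) := by
          push_cast; ring
      _ = _ := by
          rw [← expChar_add, h1, h2, expChar_add]
          push_cast; ring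
  simp_rw [e2]
  rw [integral_const_mul, GaussianFourier.integral_cexp_neg_mul_sq_norm_add (by simp), finrank_euclideanSpace,
    Fintype.card_fin]
  have e3 : ((Real.pi : ℂ) / 1) ^ (d / 2 : ℂ) = (cohNormSq d : ℂ) := by
    rw [div_one, cohNormSq, Complex.ofReal_cpow Real.pi_pos.le]
    push_cast; rfl
  have e4 : Complex.exp (Complex.I ^ 2 * ‖u.2 - w.2‖ ^ 2 / (4 * 1)) =
      (Real.exp (-(‖(1 / 2 : ℝ) • (w - u).2‖ ^ 2)) : ℂ) := by
    rw [Complex.ofReal_exp, Complex.I_sq, norm_smul, Prod.snd_sub, norm_sub_rev]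
    congr 1
    push_cast
    norm_num
    ring
  have e5 : gauss ((1 / 2 : ℝ) • (w - u)) = Real.exp (-(‖(1 / 2 : ℝ) • (w - u).1‖ ^ 2)) *
      Real.exp (-(‖(1 / 2 : ℝ) • (w - u).2‖ ^ 2)) := by
    rw [gauss, Prod.smul_fst, Prod.smul_snd, neg_add, Real.exp_add]
  rw [e3, e4, e5]
  push_cast
  ring

theorem norm_coh_sq (w : Phase d) : ‖coh w‖ ^ 2 = cohNormSq d := by
  have h0 : symp w w = 0 := by rw [symp_eq, real_inner_comm]; ring
  have h1 : gauss ((1 / 2 : ℝ) • (w - w)) = 1 := by simp [gauss]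
  rw [← inner_self_eq_norm_sq (𝕜 := ℂ), inner_coh, h0, h1, mul_zero, expChar_zero, Complex.ofReal_one,
    mul_one, mul_one]
  exact Complex.ofReal_re _

theorem continuous_coh : Continuous (coh : Phase d → L2 d) := by
  rw [continuous_iff_continuousAt]
  intro w
  rw [ContinuousAt, tendsto_iff_norm_sub_tendsto_zero]
  have hc : Continuous fun u : Phase d => inner ℂ (coh u) (coh w) := by
    simp_rw [inner_coh]
    refine continuous_const.mul ((continuous_expChar.comp' ?_).mul (Complex.continuous_ofReal.comp' ?_))
    · simp only [symp_eq]; fun_prop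
    · exact continuous_gauss.comp' (by fun_prop)
  have h1 : ∀ u : Phase d, ‖coh u - coh w‖ = √(2 * cohNormSq d - 2 * (inner ℂ (coh u) (coh w)).re) := by
    intro u
    rw [← Real.sqrt_sq (norm_nonneg (coh u - coh w)), norm_sub_sq (𝕜 := ℂ), norm_coh_sq, norm_coh_sq]
    congr 1
    simp only [RCLike.re_eq_complex_re]; ring
  simp_rw [h1]
  have h2 : Continuous fun u : Phase d => √(2 * cohNormSq d - 2 * (inner ℂ (coh u) (coh w)).re) :=
    Real.continuous_sqrt.comp' (continuous_const.sub (continuous_const.mul (Complex.continuous_re.comp' hc)))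
  have h3 := h2.tendsto w
  rwa [← h1, sub_self, norm_zero] at h3

end

section

/-! ### Resolution of the identity -/

variable {d : ℕ}

theorem enorm_sq_L2 (g : L2 d) : ‖g‖ₑ ^ 2 = ∫⁻ x, ‖g x‖ₑ ^ 2 := by
  have h := eLpNorm_nnreal_pow_eq_lintegral (f := g) (μ := (volume : Measure (Conf d))) (p := 2) two_ne_zero
  rw [Lp.enorm_def]
  simp only [NNReal.coe_ofNat, ENNReal.rpow_ofNat] at h
  exact_mod_cast h

theorem inner_coh_eq_integral (w : Phase d) (g : L2 d) :
    inner ℂ (coh w) g = ∫ x, (starRingEnd ℂ) (cohFun w x) * g x := by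
  rw [L2.inner_def]
  refine integral_congr_ae ?_
  filter_upwards [coh_coeFn w] with x h1
  rw [h1, RCLike.inner_apply, mul_comm]

/-- The function `g` times the Gaussian profile of a coherent state. -/
def localized (g : L2 d) (c : Conf d) (x : Conf d) : ℂ := (Real.exp (-(‖x - c‖ ^ 2 / 2)) : ℂ) * g x

theorem memLp_two_exp (c : Conf d) :
    MemLp (fun x : Conf d => (Real.exp (-(‖x - c‖ ^ 2 / 2)) : ℂ)) 2 (volume : Measure (Conf d)) := by
  have hc : Continuous fun x : Conf d => (Real.exp (-(‖x - c‖ ^ 2 / 2)) : ℂ) :=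
    Complex.continuous_ofReal.comp' (by fun_prop)
  rw [memLp_two_iff_integrable_sq_norm hc.aestronglyMeasurable]
  refine (integrable_exp_neg_norm_sq one_pos c).congr (Filter.Eventually.of_forall fun x => ?_)
  simp only
  rw [Complex.norm_real, Real.norm_of_nonneg (Real.exp_pos _).le, ← Real.exp_nat_mul]
  congr 1; push_cast; ring

theorem integrable_localized (g : L2 d) (c : Conf d) : Integrable (localized g c) :=
  (memLp_two_exp c).integrable_mul (Lp.memLp g)

theorem memLp_localized (g : L2 d) (c : Conf d) : MemLp (localized g c) 2 := by
  refine (Lp.memLp g).of_le (integrable_localized g c).aestronglyMeasurable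
    (Filter.Eventually.of_forall fun x => ?_)
  rw [localized, norm_mul, Complex.norm_real, Real.norm_of_nonneg (Real.exp_pos _).le]
  refine mul_le_of_le_one_left (norm_nonneg _) (Real.exp_le_one_iff.2 ?_)
  nlinarith [sq_nonneg ‖x - c‖]

theorem enorm_inner_coh (w : Phase d) (g : L2 d) :
    ‖inner ℂ (coh w) g‖ₑ = ‖ft (confForm d) (localized g w.1) ((2 * Real.pi)⁻¹ • w.2)‖ₑ := by
  have h : inner ℂ (coh w) g = expChar ((2 * Real.pi)⁻¹ * inner ℝ w.2 ((1 / 2 : ℝ) • w.1)) *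
      ft (confForm d) (localized g w.1) ((2 * Real.pi)⁻¹ • w.2) := by
    rw [inner_coh_eq_integral, ft, ← integral_const_mul]
    refine integral_congr_ae (Filter.Eventually.of_forall fun x => ?_)
    simp only [cohFun, map_mul, conj_expChar, Complex.conj_ofReal, localized, confForm_apply]
    rw [← mul_assoc (expChar _) (expChar _), ← expChar_add, ← mul_assoc]
    congr 3
    rw [inner_sub_right, real_inner_smul_right x, real_inner_comm x]
    ring
  rw [h, enorm_mul, ← ofReal_norm (expChar _), norm_expChar, ENNReal.ofReal_one, one_mul]

theorem continuous_inner_coh (g : L2 d) : Continuous fun w : Phase d => inner ℂ (coh w) g :=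
  continuous_coh.inner continuous_const

theorem exists_lintegral_inner_coh_sq (d : ℕ) : ∃ κ : ℝ≥0, 0 < κ ∧ ∀ g : L2 d,
    ∫⁻ w, ‖inner ℂ (coh w) g‖ₑ ^ 2 = κ * ‖g‖ₑ ^ 2 := by
  have h2pi : (2 * Real.pi)⁻¹ ≠ 0 := by have := Real.pi_pos; positivity
  obtain ⟨C, hC0, hC⟩ := exists_lintegral_comp_equiv (volume : Measure (Conf d))
    (ContinuousLinearEquiv.smulLeft (Units.mk0 _ h2pi))
  set E : Conf d → ℝ≥0∞ := fun x => ENNReal.ofReal (Real.exp (-(‖x‖ ^ 2)))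
  have hEc : Continuous fun x : Conf d => Real.exp (-(‖x‖ ^ 2)) := by fun_prop
  have hE : Measurable E := hEc.measurable.ennreal_ofReal
  set J := ∫⁻ x, E x
  have hJ : J ≠ ⊤ := by
    have := (integrable_exp_neg_norm_sq one_pos (0 : Conf d)).lintegral_lt_top
    simpa [J, E] using this.ne
  have hJ0 : J ≠ 0 := by
    intro h
    rw [lintegral_eq_zero_iff hE] at h
    have : ∀ᵐ x : Conf d, False := by
      filter_upwards [h] with x hx
      simp only [E, Pi.zero_apply, ENNReal.ofReal_eq_zero] at hx
      exact absurd hx (not_le.2 (Real.exp_pos _))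
    rw [Filter.eventually_false_iff_eq_bot, ae_eq_bot] at this
    exact (NeZero.ne (volume : Measure (Conf d))) this
  refine ⟨C * J.toNNReal, mul_pos hC0 (ENNReal.toNNReal_pos hJ0 hJ), fun g => ?_⟩
  push_cast
  rw [ENNReal.coe_toNNReal hJ, enorm_sq_L2]
  have hgm : Measurable fun x => ‖g x‖ₑ ^ 2 := (Lp.stronglyMeasurable g).measurable.enorm.pow_const 2
  calc ∫⁻ w, ‖inner ℂ (coh w) g‖ₑ ^ 2 = ∫⁻ w₁ : Conf d, ∫⁻ w₂ : Conf d, ‖inner ℂ (coh (w₁, w₂)) g‖ₑ ^ 2 :=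
        lintegral_prod _ ((continuous_inner_coh g).measurable.enorm.pow_const 2).aemeasurable
    _ = ∫⁻ w₁ : Conf d, C * ∫⁻ x, E (x - w₁) * ‖g x‖ₑ ^ 2 := by
        refine lintegral_congr fun w₁ => ?_
        simp_rw [enorm_inner_coh]
        refine (hC fun ξ => ‖ft (confForm d) (localized g w₁) ξ‖ₑ ^ 2).trans ?_
        rw [conf_plancherel (integrable_localized g w₁) (memLp_localized g w₁)]
        congr 1
        refine lintegral_congr fun x => ?_
        rw [localized, enorm_mul, mul_pow]
        congr 1
        rw [← ofReal_norm, Complex.norm_real, Real.norm_of_nonneg (Real.exp_pos _).le,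
          ← ENNReal.ofReal_pow (Real.exp_pos _).le, ← Real.exp_nat_mul]
        simp only [E]
        congr 2; push_cast; ring
    _ = C * ∫⁻ x, ∫⁻ w₁ : Conf d, E (x - w₁) * ‖g x‖ₑ ^ 2 := by
        rw [lintegral_const_mul' _ _ ENNReal.coe_ne_top, lintegral_lintegral_swap]
        have h1 : Measurable fun q : Conf d × Conf d => E (q.2 - q.1) :=
          hE.comp (measurable_snd.sub measurable_fst)
        exact (h1.mul (hgm.comp measurable_snd)).aemeasurable
    _ = C * ∫⁻ x, J * ‖g x‖ₑ ^ 2 := by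
        congr 1
        refine lintegral_congr fun x => ?_
        rw [lintegral_mul_const _ (show Measurable fun w₁ => E (x - w₁) from
          hE.comp (measurable_id.const_sub x))]
        congr 1
        refine Eq.trans ?_ (lintegral_sub_right_eq_self E x)
        refine lintegral_congr fun w => ?_
        simp only [E, norm_sub_rev x w]
    _ = _ := by
        rw [lintegral_const_mul _ hgm, mul_assoc]

/-- The resolution of the identity by coherent states. -/
theorem exists_resolution (d : ℕ) : ∃ κ : ℝ≥0, 0 < κ ∧
    (∀ g : L2 d, ∫⁻ w, ‖inner ℂ (coh w) g‖ₑ ^ 2 = κ * ‖g‖ₑ ^ 2) ∧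
    ∀ g e : L2 d, ∫ w, inner ℂ g (coh w) * inner ℂ (coh w) e = κ * inner ℂ g e := by
  obtain ⟨κ, hκ, h⟩ := exists_lintegral_inner_coh_sq d
  refine ⟨κ, hκ, h, fun g e => ?_⟩
  have hi : ∀ g : L2 d, Integrable fun w => ‖inner ℂ (coh w) g‖ ^ 2 := by
    intro g
    refine ⟨((continuous_inner_coh g).norm.pow 2).aestronglyMeasurable, ?_⟩
    rw [hasFiniteIntegral_iff_enorm]
    refine lt_of_eq_of_lt ?_ ((h g).trans_lt (by finiteness))
    refine lintegral_congr fun w => ?_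
    rw [enorm_pow, enorm_norm]
  have hr : ∀ g : L2 d, ∫ w, ‖inner ℂ (coh w) g‖ ^ 2 = κ * ‖g‖ ^ 2 := by
    intro g
    rw [integral_eq_lintegral_of_nonneg_ae (Filter.Eventually.of_forall fun _ => sq_nonneg _)
      (hi g).aestronglyMeasurable]
    have : ∀ w : Phase d, ENNReal.ofReal (‖inner ℂ (coh w) g‖ ^ 2) = ‖inner ℂ (coh w) g‖ₑ ^ 2 := by
      intro w
      rw [ENNReal.ofReal_pow (norm_nonneg _), ofReal_norm]
    simp_rw [this]
    rw [h]
    simp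
  have hpt : ∀ w, inner ℂ g (coh w) * inner ℂ (coh w) e =
      (((‖inner ℂ (coh w) (g + e)‖ ^ 2 : ℝ) : ℂ) - ((‖inner ℂ (coh w) (g - e)‖ ^ 2 : ℝ) : ℂ) +
        (((‖inner ℂ (coh w) (g - Complex.I • e)‖ ^ 2 : ℝ) : ℂ) -
          ((‖inner ℂ (coh w) (g + Complex.I • e)‖ ^ 2 : ℝ) : ℂ)) * Complex.I) / 4 := by
    intro w
    have := inner_eq_sum_norm_sq_div_four (𝕜 := ℂ) (inner ℂ (coh w) g) (inner ℂ (coh w) e)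
    rw [RCLike.inner_apply, inner_conj_symm, mul_comm] at this
    rw [this]
    simp only [inner_add_right, inner_sub_right, inner_smul_right, RCLike.I_to_complex, smul_eq_mul]
    push_cast
    rfl
  have hI : ∀ g : L2 d, Integrable fun w => ((‖inner ℂ (coh w) g‖ ^ 2 : ℝ) : ℂ) := fun g => (hi g).ofReal
  have hR : ∀ g : L2 d, ∫ w, ((‖inner ℂ (coh w) g‖ ^ 2 : ℝ) : ℂ) = ((κ * ‖g‖ ^ 2 : ℝ) : ℂ) := by
    intro g
    rw [integral_complex_ofReal, hr]
  have hS : ∀ g e : L2 d, Integrable fun w =>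
      ((‖inner ℂ (coh w) g‖ ^ 2 : ℝ) : ℂ) - ((‖inner ℂ (coh w) e‖ ^ 2 : ℝ) : ℂ) :=
    fun g e => (hI g).sub (hI e)
  have pol : inner ℂ g e = ((‖g + e‖ : ℂ) ^ 2 - (‖g - e‖ : ℂ) ^ 2 +
      ((‖g - Complex.I • e‖ : ℂ) ^ 2 - (‖g + Complex.I • e‖ : ℂ) ^ 2) * Complex.I) / 4 :=
    inner_eq_sum_norm_sq_div_four g e
  simp_rw [hpt]
  rw [integral_div, integral_add (hS _ _) ((hS _ _).mul_const _),
    integral_sub (hI _) (hI _), integral_mul_const, integral_sub (hI _) (hI _), hR, hR, hR, hR, pol]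
  push_cast
  ring

end

section

/-! ### Reflections -/

variable {d : ℕ}

/-- The reflection of `u` at the phase space point `z`. -/
def reflFun (z : Phase d) (u : Conf d → ℂ) (x : Conf d) : ℂ :=
  expChar (Real.pi⁻¹ * inner ℝ (x - z.1) z.2) * u ((2 : ℝ) • z.1 - x)

theorem measurePreserving_refl (c : Conf d) : MeasurePreserving (fun x : Conf d => c - x) := by
  have h1 : MeasurePreserving (fun x : Conf d => -x) := (LinearIsometryEquiv.neg ℝ).measurePreserving
  have h2 : MeasurePreserving (fun x : Conf d => c + x) := measurePreserving_add_left volume c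
  have := h2.comp h1
  simpa [Function.comp_def, sub_eq_add_neg] using this

theorem continuous_reflPhase : Continuous fun q : Phase d × Conf d =>
    expChar (Real.pi⁻¹ * inner ℝ (q.2 - q.1.1) q.1.2) :=
  continuous_expChar.comp' (by fun_prop)

theorem memLp_reflFun (z : Phase d) {u : Conf d → ℂ} (hu : MemLp u 2) : MemLp (reflFun z u) 2 := by
  have h1 : MemLp (fun x => u ((2 : ℝ) • z.1 - x)) 2 :=
    hu.comp_measurePreserving (measurePreserving_refl _)
  have hc : Continuous fun x : Conf d => expChar (Real.pi⁻¹ * inner ℝ (x - z.1) z.2) :=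
    continuous_expChar.comp' (by fun_prop)
  refine h1.of_le (hc.aestronglyMeasurable.mul h1.aestronglyMeasurable) (Filter.Eventually.of_forall fun x => ?_)
  rw [reflFun, norm_mul, norm_expChar, one_mul]

/-- The reflection at a phase space point, on `L²`. -/
def refl (z : Phase d) (u : L2 d) : L2 d := (memLp_reflFun z (Lp.memLp u)).toLp

theorem refl_coeFn (z : Phase d) (u : L2 d) : refl z u =ᵐ[volume] reflFun z u := MemLp.coeFn_toLp _

theorem refl_coeFn_of_ae (z : Phase d) {u : L2 d} {f : Conf d → ℂ} (h : u =ᵐ[volume] f) :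
    refl z u =ᵐ[volume] reflFun z f := by
  have h2 := (measurePreserving_refl ((2 : ℝ) • z.1)).quasiMeasurePreserving.ae_eq_comp h
  filter_upwards [refl_coeFn z u, h2] with x h1 h2
  rw [h1, reflFun, reflFun]
  exact congrArg _ h2

theorem refl_add (z : Phase d) (u v : L2 d) : refl z (u + v) = refl z u + refl z v := by
  refine Lp.ext ?_
  filter_upwards [refl_coeFn_of_ae z (Lp.coeFn_add u v), refl_coeFn z u, refl_coeFn z v,
    Lp.coeFn_add (refl z u) (refl z v)] with x h1 h2 h3 h4
  rw [h1, h4, Pi.add_apply, h2, h3]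
  simp only [reflFun, Pi.add_apply, mul_add]

theorem refl_smul (z : Phase d) (c : ℂ) (u : L2 d) : refl z (c • u) = c • refl z u := by
  refine Lp.ext ?_
  filter_upwards [refl_coeFn_of_ae z (Lp.coeFn_smul c u), refl_coeFn z u,
    Lp.coeFn_smul c (refl z u)] with x h1 h2 h3
  rw [h1, h3, Pi.smul_apply, h2]
  simp only [reflFun, Pi.smul_apply, smul_eq_mul]
  ring

theorem norm_refl (z : Phase d) (u : L2 d) : ‖refl z u‖ = ‖u‖ := by
  rw [Lp.norm_def, Lp.norm_def]
  congr 1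
  rw [eLpNorm_congr_ae (refl_coeFn z u)]
  have h1 : eLpNorm (reflFun z u) 2 volume = eLpNorm (fun x => u ((2 : ℝ) • z.1 - x)) 2 volume := by
    refine eLpNorm_congr_norm_ae (Filter.Eventually.of_forall fun x => ?_)
    rw [reflFun, norm_mul, norm_expChar, one_mul]
  rw [h1]
  exact eLpNorm_comp_measurePreserving (Lp.aestronglyMeasurable u) (measurePreserving_refl _)

theorem inner_refl_eq (v u : L2 d) (z : Phase d) :
    inner ℂ v (refl z u) = ∫ x, (starRingEnd ℂ) (v x) * reflFun z u x := by
  rw [L2.inner_def]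
  refine integral_congr_ae ?_
  filter_upwards [refl_coeFn z u] with x h1
  rw [h1, RCLike.inner_apply, mul_comm]

theorem stronglyMeasurable_inner_refl (v u : L2 d) : StronglyMeasurable fun z : Phase d => inner ℂ v (refl z u) := by
  simp_rw [inner_refl_eq]
  refine StronglyMeasurable.integral_prod_right (f := fun (z : Phase d) (x : Conf d) =>
    (starRingEnd ℂ) (v x) * reflFun z u x) ?_
  have h1 : StronglyMeasurable fun q : Phase d × Conf d => (starRingEnd ℂ) (v q.2) :=
    Complex.continuous_conj.comp_stronglyMeasurable ((Lp.stronglyMeasurable v).comp_measurable measurable_snd)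
  have hc : Continuous fun q : Phase d × Conf d => (2 : ℝ) • q.1.1 - q.2 := by fun_prop
  have h2 : StronglyMeasurable fun q : Phase d × Conf d => u ((2 : ℝ) • q.1.1 - q.2) :=
    (Lp.stronglyMeasurable u).comp_measurable hc.measurable
  exact h1.mul (continuous_reflPhase.stronglyMeasurable.mul h2)

theorem norm_inner_refl_le (v u : L2 d) (z : Phase d) : ‖inner ℂ v (refl z u)‖ ≤ ‖v‖ * ‖u‖ :=
  (norm_inner_le_norm _ _).trans_eq (by rw [norm_refl])

theorem integrable_mul_inner_refl {q : Phase d → ℂ} (hq : Integrable q) (v u : L2 d) :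
    Integrable fun z => q z * inner ℂ v (refl z u) :=
  hq.mul_bdd (stronglyMeasurable_inner_refl v u).aestronglyMeasurable
    (Filter.Eventually.of_forall fun z => norm_inner_refl_le v u z)

/-- The bounded operator with integrable symbol `q`, as a superposition of reflections. -/
theorem exists_operator {q : Phase d → ℂ} (hq : Integrable q) : ∃ A : L2 d →L[ℂ] L2 d,
    ∀ v u, inner ℂ v (A u) = (Real.pi⁻¹ ^ d : ℝ) * ∫ z, q z * inner ℂ v (refl z u) := by
  set B : L2 d →ₗ⋆[ℂ] L2 d →ₗ[ℂ] ℂ := LinearMap.mk₂'ₛₗ (starRingEnd ℂ) (RingHom.id ℂ)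
    (fun v u => (Real.pi⁻¹ ^ d : ℝ) * ∫ z, q z * inner ℂ v (refl z u))
    (fun v v' u => by
      simp only [inner_add_left, mul_add]
      rw [integral_add (integrable_mul_inner_refl hq v u) (integrable_mul_inner_refl hq v' u), mul_add])
    (fun c v u => by
      simp only [inner_smul_left, mul_left_comm (q _)]
      rw [integral_const_mul, smul_eq_mul]; ring)
    (fun v u u' => by
      simp only [refl_add, inner_add_right, mul_add]
      rw [integral_add (integrable_mul_inner_refl hq v u) (integrable_mul_inner_refl hq v u'), mul_add])
    (fun c v u => by
      simp only [refl_smul, inner_smul_right, mul_left_comm (q _)]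
      rw [integral_const_mul, RingHom.id_apply, smul_eq_mul]; ring)
  have hB : ∀ v u, ‖B v u‖ ≤ ((Real.pi⁻¹ ^ d) * ∫ z, ‖q z‖) * ‖v‖ * ‖u‖ := by
    intro v u
    have h1 : ‖∫ z, q z * inner ℂ v (refl z u)‖ ≤ (∫ z, ‖q z‖) * (‖v‖ * ‖u‖) := by
      rw [← integral_mul_const]
      refine norm_integral_le_of_norm_le (hq.norm.mul_const _) (Filter.Eventually.of_forall fun z => ?_)
      rw [norm_mul]
      exact mul_le_mul_of_nonneg_left (norm_inner_refl_le v u z) (norm_nonneg _)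
    have hp : 0 ≤ Real.pi⁻¹ ^ d := by have := Real.pi_pos; positivity
    have : B v u = (Real.pi⁻¹ ^ d : ℝ) * ∫ z, q z * inner ℂ v (refl z u) := rfl
    rw [this, norm_mul, Complex.norm_real, Real.norm_of_nonneg hp, mul_assoc, mul_assoc]
    exact mul_le_mul_of_nonneg_left h1 hp
  refine ⟨ContinuousLinearMap.adjoint
    (InnerProductSpace.continuousLinearMapOfBilin (B.mkContinuous₂ _ hB)), fun v u => ?_⟩
  rw [ContinuousLinearMap.adjoint_inner_right, InnerProductSpace.continuousLinearMapOfBilin_apply]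
  rfl

theorem refl_coh (z u : Phase d) :
    refl z (coh u) = expChar ((2 * Real.pi)⁻¹ * symp z u) • coh ((2 : ℝ) • z - u) := by
  have hpi := Real.pi_pos.ne'
  refine Lp.ext ?_
  filter_upwards [refl_coeFn_of_ae z (coh_coeFn u), coh_coeFn ((2 : ℝ) • z - u),
    Lp.coeFn_smul (expChar ((2 * Real.pi)⁻¹ * symp z u)) (coh ((2 : ℝ) • z - u))] with x h1 h2 h3
  rw [h1, h3, Pi.smul_apply, h2, reflFun, cohFun, cohFun, smul_eq_mul, ← mul_assoc, ← mul_assoc,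
    ← expChar_add, ← expChar_add]
  congr 2
  · rw [symp_eq]
    simp only [Prod.fst_sub, Prod.snd_sub, Prod.smul_fst, Prod.smul_snd, inner_sub_left, inner_sub_right,
      real_inner_smul_left, real_inner_smul_right, smul_sub, smul_smul]
    rw [real_inner_comm z.2 x, real_inner_comm z.2 z.1, real_inner_comm u.2 z.1]
    field_simp
    ring
  · congr 4
    rw [← norm_neg]
    congr 1
    simp only [Prod.fst_sub, Prod.smul_fst]
    abel

end

section

/-! ### Weyl operators as superpositions of reflections -/

variable {d : ℕ}

theorem exists_schwartz_bound (u : 𝓢(Conf d, ℂ)) : ∃ C : ℝ, ∀ x, ‖u x‖ ≤ C :=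
  ⟨_, fun x => u.toBoundedContinuousFunction.norm_coe_le_norm x⟩

theorem norm_reflFun (z : Phase d) (u : Conf d → ℂ) (x : Conf d) :
    ‖reflFun z u x‖ = ‖u ((2 : ℝ) • z.1 - x)‖ := by
  rw [reflFun, norm_mul, norm_expChar, one_mul]

theorem continuous_reflFun {u : Conf d → ℂ} (hu : Continuous u) :
    Continuous fun q : Phase d × Conf d => reflFun q.1 u q.2 := by
  have h : Continuous fun q : Phase d × Conf d => u ((2 : ℝ) • q.1.1 - q.2) := hu.comp' (by fun_prop)
  exact continuous_reflPhase.mul h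

theorem integral_eq_comp_reflection (h : Conf d → ℂ) (x : Conf d) :
    ∫ y, h y = (2 : ℂ) ^ d * ∫ s : Conf d, h ((2 : ℝ) • s - x) := by
  have h1 := Measure.integral_comp_smul (volume : Measure (Conf d)) (fun y => h (y - x)) 2
  rw [h1, integral_sub_right_eq_self, finrank_euclideanSpace, Fintype.card_fin, abs_of_pos (by positivity),
    Complex.real_smul]
  push_cast
  rw [mul_inv_cancel_left₀ (pow_ne_zero _ two_ne_zero)]

theorem integrable_mul_reflFun {q : Phase d → ℂ} (hq : Integrable q) {u : Conf d → ℂ} (hu : Continuous u)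
    {C : ℝ} (hC : ∀ x, ‖u x‖ ≤ C) (x : Conf d) : Integrable fun z => q z * reflFun z u x := by
  have hc := (continuous_reflFun hu).comp' (by fun_prop : Continuous fun z : Phase d => (z, x))
  refine hq.mul_bdd hc.aestronglyMeasurable (Filter.Eventually.of_forall fun z => ?_) (c := C)
  rw [norm_reflFun]; exact hC _

theorem weylAction_eq {q : Phase d → ℂ} (hq : Integrable q) {u : Conf d → ℂ} (hu : Continuous u)
    {C : ℝ} (hC : ∀ x, ‖u x‖ ≤ C) (x : Conf d) :
    weylAction q u x = (Real.pi⁻¹ ^ d : ℝ) * ∫ z, q z * reflFun z u x := by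
  have hpi : (Real.pi : ℂ) ≠ 0 := by exact_mod_cast Real.pi_pos.ne'
  rw [weylAction]
  have e1 : ∀ ξ : Conf d, ∫ y : Conf d,
      Complex.exp (Complex.I * (inner ℝ (x - y) ξ : ℝ)) * q ((1 / 2 : ℝ) • (x + y), ξ) * u y =
      (2 : ℂ) ^ d * ∫ s : Conf d, q (s, ξ) * reflFun (s, ξ) u x := by
    intro ξ
    rw [integral_eq_comp_reflection _ x]
    congr 1
    refine integral_congr_ae (Filter.Eventually.of_forall fun s => ?_)
    simp only [reflFun]
    have h1 : (1 / 2 : ℝ) • (x + ((2 : ℝ) • s - x)) = s := by module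
    have h2 : x - ((2 : ℝ) • s - x) = (2 : ℝ) • (x - s) := by module
    rw [h1, h2, expChar, real_inner_smul_left]
    have h3 : Complex.I * ((2 * inner ℝ (x - s) ξ : ℝ) : ℂ) =
        2 * Real.pi * Complex.I * ((Real.pi⁻¹ * inner ℝ (x - s) ξ : ℝ) : ℂ) := by
      push_cast; field_simp
    rw [h3]; ring
  simp_rw [e1]
  rw [integral_const_mul, ← mul_assoc]
  congr 1
  · push_cast
    rw [mul_pow, inv_pow]
    field_simp
  · exact (integral_prod_symm _ (integrable_mul_reflFun hq hu hC x)).symm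

theorem isWeylOp_of_inner {q : Phase d → ℂ} (hq : Integrable q) {A : L2 d →L[ℂ] L2 d}
    (hA : ∀ v u, inner ℂ v (A u) = (Real.pi⁻¹ ^ d : ℝ) * ∫ z, q z * inner ℂ v (refl z u)) :
    IsWeylOp q A := by
  intro u
  obtain ⟨C, hC⟩ := exists_schwartz_bound u
  have hu := u.continuous
  set u' : L2 d := u.toLp 2 volume
  have hu' : u' =ᵐ[volume] u := SchwartzMap.coeFn_toLp u 2 volume
  have hw : weylAction q u = fun x => (Real.pi⁻¹ ^ d : ℝ) * ∫ z, q z * reflFun z u x :=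
    funext fun x => weylAction_eq hq hu hC x
  have hint : ∀ s : Set (Conf d), MeasurableSet s → volume s < ⊤ →
      Integrable (fun p : Phase d × Conf d => q p.1 * reflFun p.1 u p.2)
        ((volume : Measure (Phase d)).prod (volume.restrict s)) := by
    intro s hs hfin
    have h1 : Integrable (fun _ : Conf d => (1 : ℂ)) (volume.restrict s) :=
      integrableOn_const hfin.ne
    have h2 := hq.mul_prod h1
    simp only [mul_one] at h2
    refine h2.mul_bdd (continuous_reflFun hu).aestronglyMeasurable (Filter.Eventually.of_forall fun p => ?_) (c := C)
    rw [norm_reflFun]; exact hC _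
  refine ae_eq_of_forall_setIntegral_eq_of_sigmaFinite (fun s hs hfin => ?_) (fun s hs hfin => ?_)
    (fun s hs hfin => ?_)
  · exact integrableOn_Lp_of_measure_ne_top (A u') (by norm_num) hfin.ne
  · rw [hw]
    exact ((hint s hs hfin).integral_prod_right).const_mul _
  · rw [← L2.inner_indicatorConstLp_one (𝕜 := ℂ) hs hfin.ne (A u'), hA, hw, integral_const_mul,
      integral_integral_swap (f := fun x z => q z * reflFun z u x) (hint s hs hfin).swap]
    congr 1
    refine integral_congr_ae (Filter.Eventually.of_forall fun z => ?_)
    simp only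
    rw [L2.inner_indicatorConstLp_one, integral_const_mul]
    congr 1
    exact setIntegral_congr_ae hs ((refl_coeFn_of_ae z hu').mono fun x hx _ => hx)

theorem isWeylOp_op {q : Phase d → ℂ} (hq : Integrable q) : IsWeylOp q (op q) := by
  obtain ⟨A, hA⟩ := exists_operator hq
  have h : ∃ A, IsWeylOp q A := ⟨A, isWeylOp_of_inner hq hA⟩
  rw [op, dif_pos h]
  exact h.choose_spec

theorem inner_op {q : Phase d → ℂ} (hq : Integrable q) (v u : L2 d) :
    inner ℂ v (op q u) = (Real.pi⁻¹ ^ d : ℝ) * ∫ z, q z * inner ℂ v (refl z u) := by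
  obtain ⟨A, hA⟩ := exists_operator hq
  rw [(isWeylOp_op hq).unique (isWeylOp_of_inner hq hA), hA]

theorem inner_op_coh {q : Phase d → ℂ} (hq : Integrable q) (v : L2 d) (u : Phase d) :
    inner ℂ v (op q (coh u)) = (Real.pi⁻¹ ^ d : ℝ) * ∫ z, q z *
      (expChar ((2 * Real.pi)⁻¹ * symp z u) * inner ℂ v (coh ((2 : ℝ) • z - u))) := by
  rw [inner_op hq]
  simp_rw [refl_coh, inner_smul_right]

end

section

/-! ### Matrix elements between coherent states -/

variable {d : ℕ}

theorem integral_superposition {S : Type*} [MeasurableSpace S] {ν : Measure S} [SFinite ν] {Q : S → ℂ}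
    (hQ : Integrable Q ν) {c s : S → Phase d} (hc : Measurable c) (hs : Measurable s) :
    ∫ z, ∫ o, Q o * (expChar (phaseForm d (c o) z) * (gauss (z - s o) : ℂ)) ∂ν =
      (Real.pi ^ d : ℝ) * ∫ o, Q o * (expChar (phaseForm d (c o) (s o)) * (gauss (Real.pi • c o) : ℂ)) ∂ν := by
  have hE : Measurable fun p : Phase d × S => expChar (phaseForm d (c p.2) p.1) * (gauss (p.1 - s p.2) : ℂ) := by
    have h1 : Continuous fun p : Phase d × Phase d => phaseForm d p.1 p.2 := by
      simp only [phaseForm_apply]; fun_prop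
    refine (continuous_expChar.measurable.comp (h1.measurable.comp
      ((hc.comp measurable_snd).prodMk measurable_fst))).mul ?_
    exact Complex.continuous_ofReal.measurable.comp (continuous_gauss.measurable.comp
      (measurable_fst.sub (hs.comp measurable_snd)))
  have hg : Integrable (gauss : Phase d → ℝ) := by
    simpa using integrable_gauss (d := d) one_pos
  have hi : Integrable (fun p : Phase d × S => Q p.2 * (expChar (phaseForm d (c p.2) p.1) *
      (gauss (p.1 - s p.2) : ℂ))) ((volume : Measure (Phase d)).prod ν) := by
    have hm : AEStronglyMeasurable (fun p : Phase d × S => Q p.2 * (expChar (phaseForm d (c p.2) p.1) *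
        (gauss (p.1 - s p.2) : ℂ))) ((volume : Measure (Phase d)).prod ν) :=
      hQ.aestronglyMeasurable.comp_snd.mul hE.aestronglyMeasurable
    rw [integrable_prod_iff' hm]
    have hn : ∀ z o, ‖Q o * (expChar (phaseForm d (c o) z) * (gauss (z - s o) : ℂ))‖ =
        ‖Q o‖ * gauss (z - s o) := by
      intro z o
      rw [norm_mul, norm_mul, norm_expChar, one_mul, Complex.norm_real, Real.norm_of_nonneg (gauss_pos _).le]
    refine ⟨Filter.Eventually.of_forall fun o => ?_, ?_⟩
    · have h1 : Integrable fun z => ‖Q o‖ * gauss (z - s o) := (hg.comp_sub_right (s o)).const_mul _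
      refine h1.mono' ((hE.comp measurable_prodMk_right).const_mul (Q o)).aestronglyMeasurable
        (Filter.Eventually.of_forall fun z => (hn z o).le)
    · simp only [hn]
      simp_rw [integral_const_mul]
      have : ∀ o, ∫ z, gauss (z - s o) = ∫ z : Phase d, gauss z := fun o => integral_sub_right_eq_self _ _
      simp_rw [this]
      exact hQ.norm.mul_const _
  rw [integral_integral_swap hi, ← integral_const_mul]
  refine integral_congr_ae (Filter.Eventually.of_forall fun o => ?_)
  simp only
  rw [integral_const_mul]
  have h := integral_expChar_mul_gauss_sub one_pos (c o) (s o)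
  simp only [one_smul, one_pow, div_one] at h
  rw [h]
  push_cast
  ring

theorem phase_midpoint (w u z : Phase d) :
    (2 * Real.pi)⁻¹ * symp z u + (4 * Real.pi)⁻¹ * symp w ((2 : ℝ) • z - u) =
      -((4 * Real.pi)⁻¹ * symp w u) + -phaseForm d (freq d (w - u)) z := by
  have hpi := Real.pi_pos.ne'
  simp only [symp_eq, phaseForm_apply, freq_apply, rot_apply, Prod.fst_sub, Prod.snd_sub, Prod.smul_fst,
    Prod.smul_snd, inner_sub_left, inner_sub_right, real_inner_smul_left, real_inner_smul_right, inner_neg_left]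
  rw [real_inner_comm z.1 u.2, real_inner_comm z.2 u.1]
  field_simp
  ring

theorem phase_freq_midpoint (w u : Phase d) :
    -phaseForm d (freq d (w - u)) ((1 / 2 : ℝ) • (w + u)) = (2 * Real.pi)⁻¹ * symp w u := by
  have hpi := Real.pi_pos.ne'
  simp only [symp_eq, phaseForm_apply, freq_apply, rot_apply, Prod.fst_sub, Prod.snd_sub, Prod.smul_fst,
    Prod.smul_snd, Prod.fst_add, Prod.snd_add, inner_sub_left, inner_add_right, real_inner_smul_left,
    real_inner_smul_right, inner_neg_left]
  rw [real_inner_comm w.1 w.2, real_inner_comm u.1 u.2, real_inner_comm w.1 u.2, real_inner_comm w.2 u.1]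
  field_simp
  ring

theorem gauss_half_sub (w u z : Phase d) :
    gauss ((1 / 2 : ℝ) • (w - ((2 : ℝ) • z - u))) = gauss (z - (1 / 2 : ℝ) • (w + u)) := by
  have h : (1 / 2 : ℝ) • (w - ((2 : ℝ) • z - u)) = -(z - (1 / 2 : ℝ) • (w + u)) := by module
  rw [h]
  simp only [gauss, Prod.fst_neg, Prod.snd_neg, norm_neg]

/-- Matrix elements, between coherent states, of an operator whose symbol is a superposition of
plane waves. -/
theorem inner_coh_op_coh {S : Type*} [MeasurableSpace S] {ν : Measure S} [SFinite ν] {Q : S → ℂ}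
    (hQ : Integrable Q ν) {ζ : S → Phase d} (hζ : Measurable ζ) {q : Phase d → ℂ} (hq : Integrable q)
    (h : ∀ z, q z = ∫ o, Q o * expChar (phaseForm d (ζ o) z) ∂ν) (w u : Phase d) :
    inner ℂ (coh w) (op q (coh u)) = cohNormSq d * expChar ((4 * Real.pi)⁻¹ * symp w u) *
      ∫ o, Q o * packet ((1 / 2 : ℝ) • (w + u)) (freq d (w - u)) (ζ o) ∂ν := by
  have hpi : (Real.pi : ℂ) ≠ 0 := by exact_mod_cast Real.pi_pos.ne'
  rw [inner_op_coh hq]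
  have e1 : ∀ z, q z * (expChar ((2 * Real.pi)⁻¹ * symp z u) * inner ℂ (coh w) (coh ((2 : ℝ) • z - u))) =
      (cohNormSq d * expChar (-((4 * Real.pi)⁻¹ * symp w u))) *
        ∫ o, Q o * (expChar (phaseForm d (ζ o - freq d (w - u)) z) *
          (gauss (z - (1 / 2 : ℝ) • (w + u)) : ℂ)) ∂ν := by
    intro z
    have e2 : ∀ o, Q o * (expChar (phaseForm d (ζ o - freq d (w - u)) z) *
        (gauss (z - (1 / 2 : ℝ) • (w + u)) : ℂ)) = Q o * expChar (phaseForm d (ζ o) z) *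
        (expChar (-phaseForm d (freq d (w - u)) z) * (gauss (z - (1 / 2 : ℝ) • (w + u)) : ℂ)) := by
      intro o
      rw [phaseForm_sub_left, sub_eq_add_neg, expChar_add]; ring
    simp_rw [e2]
    rw [integral_mul_const, ← h, inner_coh, gauss_half_sub]
    have e3 := congrArg expChar (phase_midpoint w u z)
    rw [expChar_add, expChar_add] at e3
    linear_combination (q z * cohNormSq d * (gauss (z - (1 / 2 : ℝ) • (w + u)) : ℂ)) * e3
  simp_rw [e1]
  rw [integral_const_mul, integral_superposition hQ (hζ.sub_const _) measurable_const]
  have e4 : ∀ o, Q o * (expChar (phaseForm d (ζ o - freq d (w - u)) ((1 / 2 : ℝ) • (w + u))) *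
      (gauss (Real.pi • (ζ o - freq d (w - u))) : ℂ)) =
      expChar ((2 * Real.pi)⁻¹ * symp w u) *
        (Q o * packet ((1 / 2 : ℝ) • (w + u)) (freq d (w - u)) (ζ o)) := by
    intro o
    rw [phaseForm_sub_left, sub_eq_add_neg, expChar_add, phase_freq_midpoint, packet, phaseForm_comm (ζ o)]
    ring
  simp_rw [e4]
  rw [integral_const_mul]
  have e5 : expChar (-((4 * Real.pi)⁻¹ * symp w u)) * expChar ((2 * Real.pi)⁻¹ * symp w u) =
      expChar ((4 * Real.pi)⁻¹ * symp w u) := by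
    rw [← expChar_add]
    congr 1
    have := Real.pi_pos.ne'
    field_simp
    ring
  rw [← e5]
  have e6 : ((Real.pi⁻¹ ^ d : ℝ) : ℂ) * (Real.pi ^ d : ℝ) = 1 := by
    push_cast
    rw [← mul_pow, inv_mul_cancel₀ hpi, one_pow]
  linear_combination (cohNormSq d * expChar (-((4 * Real.pi)⁻¹ * symp w u)) *
    expChar ((2 * Real.pi)⁻¹ * symp w u) *
      ∫ o, Q o * packet ((1 / 2 : ℝ) • (w + u)) (freq d (w - u)) (ζ o) ∂ν) * e6

theorem phase_compose (w u ξ η : Phase d) :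
    phaseForm d ξ ((1 / 2 : ℝ) • (w - u)) +
      phaseForm d (ξ + η - freq d (w - u)) ((1 / 2 : ℝ) • (w + u) - Real.pi • rot d ξ) =
      (2 * Real.pi)⁻¹ * symp w u + (-(Real.pi * symp ξ η) + phaseForm d ((1 / 2 : ℝ) • (w + u)) (ξ + η)) := by
  have hpi := Real.pi_pos.ne'
  simp only [symp_eq, phaseForm_apply, freq_apply, rot_apply, Prod.fst_sub, Prod.snd_sub, Prod.smul_fst,
    Prod.smul_snd, Prod.fst_add, Prod.snd_add, inner_sub_left, inner_sub_right, inner_add_left, inner_add_right,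
    real_inner_smul_left, real_inner_smul_right, inner_neg_left, inner_neg_right, smul_neg]
  rw [real_inner_comm w.1 w.2, real_inner_comm u.1 u.2, real_inner_comm w.1 u.2, real_inner_comm w.2 u.1,
    real_inner_comm ξ.1 w.1, real_inner_comm ξ.2 w.2, real_inner_comm ξ.1 u.1, real_inner_comm ξ.2 u.2,
    real_inner_comm η.1 w.1, real_inner_comm η.2 w.2, real_inner_comm η.1 u.1, real_inner_comm η.2 u.2,
    real_inner_comm ξ.1 ξ.2, real_inner_comm ξ.1 η.2, real_inner_comm ξ.2 η.1]
  field_simp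
  ring

theorem packet_reflected (w u ξ z : Phase d) :
    packet ((1 / 2 : ℝ) • (w + ((2 : ℝ) • z - u))) (freq d (w - ((2 : ℝ) • z - u))) ξ =
      expChar (phaseForm d ξ ((1 / 2 : ℝ) • (w - u)) + phaseForm d ξ z) *
        (gauss (z - ((1 / 2 : ℝ) • (w + u) - Real.pi • rot d ξ)) : ℂ) := by
  have hpi := Real.pi_pos.ne'
  rw [packet]
  congr 2
  · rw [← map_add, phaseForm_comm]
    congr 1
    module
  · have h : Real.pi • (ξ - freq d (w - ((2 : ℝ) • z - u))) =
        -rot d (z - ((1 / 2 : ℝ) • (w + u) - Real.pi • rot d ξ)) := by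
      rw [freq_apply]
      simp only [map_sub, map_smul, map_add, rot_rot, smul_sub, smul_add, smul_smul, smul_neg]
      have h2 : Real.pi * -(2 * Real.pi)⁻¹ = -(1 / 2 : ℝ) := by field_simp
      have h3 : Real.pi * (-(2 * Real.pi)⁻¹ * 2) = -1 := by field_simp
      rw [h2]
      rw [h3]
      module
    rw [h]
    have hg : ∀ y : Phase d, gauss (-rot d y) = gauss y := by
      intro y
      simp only [gauss, rot_apply, Prod.fst_neg, Prod.snd_neg, neg_neg, norm_neg]
      rw [add_comm]
    rw [hg]

/-- Matrix elements of the composition of two operators, between coherent states. -/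
theorem inner_coh_op_op_coh {P Q p q : Phase d → ℂ} (hP : Integrable P) (hQ : Integrable Q)
    (hp : Integrable p) (hq : Integrable q)
    (hpP : ∀ z, p z = ∫ ξ, P ξ * expChar (phaseForm d ξ z))
    (hqQ : ∀ z, q z = ∫ η, Q η * expChar (phaseForm d η z)) (w u : Phase d) :
    inner ℂ (coh w) (op p (op q (coh u))) = cohNormSq d * expChar ((4 * Real.pi)⁻¹ * symp w u) *
      ∫ θ : Phase d × Phase d, P θ.1 * Q θ.2 * (expChar (-(Real.pi * symp θ.1 θ.2)) *
        packet ((1 / 2 : ℝ) • (w + u)) (freq d (w - u)) (θ.1 + θ.2)) := by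
  have hpi : (Real.pi : ℂ) ≠ 0 := by exact_mod_cast Real.pi_pos.ne'
  rw [← ContinuousLinearMap.adjoint_inner_left, inner_op_coh hq]
  simp_rw [ContinuousLinearMap.adjoint_inner_left]
  have hPQ : Integrable (fun θ : Phase d × Phase d => P θ.1 * Q θ.2) := hP.mul_prod hQ
  have e0 : ∀ u', inner ℂ (coh w) (op p (coh u')) = _ := fun u' =>
    inner_coh_op_coh hP measurable_id hp hpP w u'
  have hb : Continuous fun θ : Phase d × Phase d => expChar (phaseForm d θ.1 ((1 / 2 : ℝ) • (w - u))) := by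
    simp only [phaseForm_apply]
    exact continuous_expChar.comp' (by fun_prop)
  have hPQ' : Integrable (fun θ : Phase d × Phase d => P θ.1 * Q θ.2 *
      expChar (phaseForm d θ.1 ((1 / 2 : ℝ) • (w - u)))) :=
    hPQ.mul_bdd (c := 1) hb.aestronglyMeasurable (Filter.Eventually.of_forall fun θ => by rw [norm_expChar])
  have e1 : ∀ z, q z * (expChar ((2 * Real.pi)⁻¹ * symp z u) *
      inner ℂ (coh w) (op p (coh ((2 : ℝ) • z - u)))) =
      (cohNormSq d * expChar (-((4 * Real.pi)⁻¹ * symp w u))) *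
        ∫ θ : Phase d × Phase d, P θ.1 * Q θ.2 * expChar (phaseForm d θ.1 ((1 / 2 : ℝ) • (w - u))) *
          (expChar (phaseForm d (θ.1 + θ.2 - freq d (w - u)) z) *
            (gauss (z - ((1 / 2 : ℝ) • (w + u) - Real.pi • rot d θ.1)) : ℂ)) := by
    intro z
    have e2 : ∀ θ : Phase d × Phase d, P θ.1 * Q θ.2 * expChar (phaseForm d θ.1 ((1 / 2 : ℝ) • (w - u))) *
          (expChar (phaseForm d (θ.1 + θ.2 - freq d (w - u)) z) *
            (gauss (z - ((1 / 2 : ℝ) • (w + u) - Real.pi • rot d θ.1)) : ℂ)) =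
          expChar (-phaseForm d (freq d (w - u)) z) *
          ((fun ξ => P ξ * packet ((1 / 2 : ℝ) • (w + ((2 : ℝ) • z - u))) (freq d (w - ((2 : ℝ) • z - u))) ξ) θ.1 *
          (fun η => Q η * expChar (phaseForm d η z)) θ.2) := by
      intro θ
      simp only
      rw [packet_reflected, phaseForm_sub_left, phaseForm_add_left, expChar_sub, expChar_add, expChar_add]
      ring
    simp_rw [e2]
    rw [integral_const_mul]
    have e3 := integral_prod_mul (μ := (volume : Measure (Phase d))) (ν := (volume : Measure (Phase d)))
      (fun ξ => P ξ * packet ((1 / 2 : ℝ) • (w + ((2 : ℝ) • z - u))) (freq d (w - ((2 : ℝ) • z - u))) ξ)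
      (fun η => Q η * expChar (phaseForm d η z))
    rw [show (∫ θ : Phase d × Phase d, (fun ξ => P ξ * packet ((1 / 2 : ℝ) • (w + ((2 : ℝ) • z - u)))
        (freq d (w - ((2 : ℝ) • z - u))) ξ) θ.1 * (fun η => Q η * expChar (phaseForm d η z)) θ.2) = _ from e3,
      ← hqQ, e0]
    have e4 := congrArg expChar (phase_midpoint w u z)
    rw [expChar_add, expChar_add] at e4
    simp only [id]
    linear_combination (q z * cohNormSq d * ∫ ξ, P ξ * packet ((1 / 2 : ℝ) • (w + ((2 : ℝ) • z - u)))
      (freq d (w - ((2 : ℝ) • z - u))) ξ) * e4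
  simp_rw [e1]
  have hs : Measurable fun θ : Phase d × Phase d => (1 / 2 : ℝ) • (w + u) - Real.pi • rot d θ.1 :=
    Continuous.measurable (by fun_prop)
  have hc : Measurable fun θ : Phase d × Phase d => θ.1 + θ.2 - freq d (w - u) :=
    Continuous.measurable (by fun_prop)
  rw [integral_const_mul, integral_superposition hPQ' hc hs]
  have e4 : ∀ θ : Phase d × Phase d, P θ.1 * Q θ.2 * expChar (phaseForm d θ.1 ((1 / 2 : ℝ) • (w - u))) *
      (expChar (phaseForm d (θ.1 + θ.2 - freq d (w - u)) ((1 / 2 : ℝ) • (w + u) - Real.pi • rot d θ.1)) *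
      (gauss (Real.pi • (θ.1 + θ.2 - freq d (w - u))) : ℂ)) =
      expChar ((2 * Real.pi)⁻¹ * symp w u) *
        (P θ.1 * Q θ.2 * (expChar (-(Real.pi * symp θ.1 θ.2)) *
        packet ((1 / 2 : ℝ) • (w + u)) (freq d (w - u)) (θ.1 + θ.2))) := by
    intro θ
    have e := congrArg expChar (phase_compose w u θ.1 θ.2)
    rw [expChar_add, expChar_add, expChar_add] at e
    rw [packet]
    linear_combination (P θ.1 * Q θ.2 * (gauss (Real.pi • (θ.1 + θ.2 - freq d (w - u))) : ℂ)) * e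
  simp_rw [e4]
  rw [integral_const_mul]
  have e5 : expChar (-((4 * Real.pi)⁻¹ * symp w u)) * expChar ((2 * Real.pi)⁻¹ * symp w u) =
      expChar ((4 * Real.pi)⁻¹ * symp w u) := by
    rw [← expChar_add]
    congr 1
    have := Real.pi_pos.ne'
    field_simp
    ring
  rw [← e5]
  have e6 : ((Real.pi⁻¹ ^ d : ℝ) : ℂ) * (Real.pi ^ d : ℝ) = 1 := by
    push_cast
    rw [← mul_pow, inv_mul_cancel₀ hpi, one_pow]
  linear_combination (cohNormSq d * expChar (-((4 * Real.pi)⁻¹ * symp w u)) *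
    expChar ((2 * Real.pi)⁻¹ * symp w u) *
      ∫ θ : Phase d × Phase d, (P θ.1 * Q θ.2 * (expChar (-(Real.pi * symp θ.1 θ.2)) *
        packet ((1 / 2 : ℝ) • (w + u)) (freq d (w - u)) (θ.1 + θ.2)))) * e6

end

section

/-! ### The Moyal expansion on the Fourier side -/

variable {d : ℕ}

theorem exp_sub_sum_eq (z : ℂ) (n : ℕ) :
    Complex.exp z - ∑ j ∈ Finset.range (n + 1), z ^ j / j.factorial =
      z ^ (n + 1) / (n + 1).factorial *
        ∫ t in (0 : ℝ)..1, (((n + 1) * (1 - t) ^ n : ℝ) : ℂ) * Complex.exp (t * z) := by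
  have he : ∀ t : ℝ, HasDerivAt (fun t : ℝ => Complex.exp (t * z)) (z * Complex.exp (t * z)) t := by
    intro t
    have h := ((Complex.ofRealCLM.hasDerivAt (x := t)).mul_const z).cexp
    simp only [Complex.ofRealCLM_apply, Complex.ofReal_one, one_mul] at h
    rwa [mul_comm] at h
  induction n with
  | zero =>
    have h := intervalIntegral.integral_eq_sub_of_hasDerivAt (a := 0) (b := 1) (fun t _ => he t)
      (Continuous.intervalIntegrable (by fun_prop) _ _)
    rw [intervalIntegral.integral_const_mul] at h
    simp only [zero_add, Finset.sum_range_one, pow_zero, Nat.factorial_zero, Nat.factorial_one,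
      Nat.cast_one, div_one, pow_one, Nat.cast_zero, mul_one, Complex.ofReal_one, one_mul]
    rw [h]; simp
  | succ n ih =>
    rw [Finset.sum_range_succ, ← sub_sub, ih]
    have hd : ∀ t : ℝ, HasDerivAt (fun t : ℝ => (((1 - t) ^ (n + 1) : ℝ) : ℂ) * Complex.exp (t * z))
        (-((((n + 1) * (1 - t) ^ n : ℝ) : ℂ) * Complex.exp (t * z)) +
          (z / (n + 2)) * ((((n + 2) * (1 - t) ^ (n + 1) : ℝ) : ℂ) * Complex.exp (t * z))) t := by
      intro t
      have h1 : HasDerivAt (fun t : ℝ => (1 - t) ^ (n + 1)) (-((n + 1) * (1 - t) ^ n)) t := by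
        have := ((hasDerivAt_id t).const_sub 1).pow (n + 1)
        simp only [id, Nat.add_sub_cancel] at this
        convert! this using 1
        push_cast; ring
      have h2 := h1.ofReal_comp.mul (he t)
      convert! h2 using 1
      have : (n + 2 : ℂ) ≠ 0 := by exact_mod_cast (Nat.succ_ne_zero (n + 1))
      push_cast
      field_simp
    have h := intervalIntegral.integral_eq_sub_of_hasDerivAt (a := 0) (b := 1) (fun t _ => hd t)
      (Continuous.intervalIntegrable (by fun_prop) _ _)
    rw [intervalIntegral.integral_add (Continuous.intervalIntegrable (by fun_prop) _ _)
      (Continuous.intervalIntegrable (by fun_prop) _ _), intervalIntegral.integral_neg,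
      intervalIntegral.integral_const_mul] at h
    simp only [sub_self, sub_zero, one_pow, Complex.ofReal_one, Complex.ofReal_zero, zero_mul, Complex.exp_zero,
      mul_one, ne_eq, Nat.succ_ne_zero, not_false_eq_true, zero_pow, zero_sub] at h
    have h3 : ((n + 1 + 1).factorial : ℂ) = (n + 2) * (n + 1).factorial := by
      rw [Nat.factorial_succ]; push_cast; ring
    have h4 : ((n + 1).factorial : ℂ) ≠ 0 := by exact_mod_cast (Nat.factorial_ne_zero _)
    have h5 : (n + 2 : ℂ) ≠ 0 := by exact_mod_cast (Nat.succ_ne_zero (n + 1))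
    have h6 : ∀ t : ℝ, ((((n + 1 : ℕ) : ℝ) + 1) * (1 - t) ^ (n + 1) : ℝ) = ((n + 2) * (1 - t) ^ (n + 1) : ℝ) := by
      intro t; push_cast; ring
    simp only [h6]
    rw [h3]
    set I₀ := ∫ t in (0 : ℝ)..1, (((n + 1) * (1 - t) ^ n : ℝ) : ℂ) * Complex.exp (t * z)
    set I₁ := ∫ t in (0 : ℝ)..1, (((n + 2) * (1 - t) ^ (n + 1) : ℝ) : ℂ) * Complex.exp (t * z)
    have h7 : I₀ = 1 + z / (n + 2) * I₁ := by linear_combination -h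
    rw [h7]
    field_simp
    ring

/-- The linear change of variables `(s, v) ↦ (s + v, s)`. -/
def shear (d : ℕ) : (Phase d × Phase d) →L[ℝ] (Phase d × Phase d) :=
  ContinuousLinearMap.prod
    (ContinuousLinearMap.fst ℝ (Phase d) (Phase d) + ContinuousLinearMap.snd ℝ (Phase d) (Phase d))
    (ContinuousLinearMap.fst ℝ (Phase d) (Phase d))

@[simp] theorem shear_apply (w : Phase d × Phase d) : shear d w = (w.1 + w.2, w.1) := rfl

theorem measurePreserving_shear : MeasurePreserving (shear d) := by
  have h1 := measurePreserving_prod_add (volume : Measure (Phase d)) (volume : Measure (Phase d))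
  have h2 := (Measure.measurePreserving_swap (μ := (volume : Measure (Phase d)))
    (ν := (volume : Measure (Phase d)))).comp h1
  exact h2

theorem measurePreserving_frequency_shear :
    MeasurePreserving fun θ : Phase d × Phase d => ((θ.2, θ.1 - θ.2) : Phase d × Phase d) := by
  have h1 := measurePreserving_prod_neg_add (volume : Measure (Phase d)) (volume : Measure (Phase d))
  have h2 := h1.comp (Measure.measurePreserving_swap (μ := (volume : Measure (Phase d)))
    (ν := (volume : Measure (Phase d))))
  have h3 : (fun θ : Phase d × Phase d => ((θ.2, θ.1 - θ.2) : Phase d × Phase d)) =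
      (fun z : Phase d × Phase d => (z.1, -z.1 + z.2)) ∘ Prod.swap := by
    funext θ
    simp only [Function.comp_apply, Prod.fst_swap, Prod.snd_swap, sub_eq_neg_add]
  rw [h3]
  exact h2

theorem SL1.comp_shear {F : Phase d × Phase d → ℂ} (hF : SL1 F) : SL1 fun w => F (shear d w) :=
  hF.comp_clm (shear d) measurePreserving_shear

theorem ft_comp_shear {F : Phase d × Phase d → ℂ} (hF : SL1 F) (α ξ : Phase d) :
    ft (pairForm d) (fun w => F (shear d w)) (α, ξ) = ft (pairForm d) F (ξ, α - ξ) := by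
  have hc : Continuous fun w : Phase d × Phase d => expChar (-pairForm d w (ξ, α - ξ)) * F w :=
    Continuous.mul (by fun_prop) hF.continuous
  rw [ft, ft]
  conv_rhs => rw [← measurePreserving_shear.map_eq]
  rw [integral_map measurePreserving_shear.measurable.aemeasurable hc.aestronglyMeasurable]
  refine integral_congr_ae (Filter.Eventually.of_forall fun w => ?_)
  simp only
  congr 3
  rw [pairForm_apply, pairForm_apply]
  simp only [shear_apply]
  rw [phaseForm_add_left, phaseForm_comm w.1 (α - ξ), phaseForm_sub_left, phaseForm_comm α, phaseForm_comm ξ]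
  ring

theorem SL1.pairPartial {F : Phase d × Phase d → ℂ} (hF : SL1 F) (a) : SL1 (pairPartial a F) :=
  hF.dirDeriv (pairDir a)

theorem SL1.symplecticDeriv {F : Phase d × Phase d → ℂ} (hF : SL1 F) : SL1 (symplecticDeriv F) := by
  refine SL1.sum Finset.univ fun i => ?_
  have h1 := (hF.pairPartial (.inr (.inr i))).pairPartial (.inl (.inl i))
  have h2 := ((hF.pairPartial (.inr (.inl i))).pairPartial (.inl (.inr i))).const_mul (-1)
  have h3 := h1.add h2
  simpa only [neg_one_mul, ← sub_eq_add_neg] using h3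

theorem ft_symplecticDeriv {F : Phase d × Phase d → ℂ} (hF : SL1 F) (ξ η : Phase d) :
    ft (pairForm d) (symplecticDeriv F) (ξ, η) = (-(4 * Real.pi ^ 2 * symp ξ η) : ℝ) * ft (pairForm d) F (ξ, η) := by
  have hp : ∀ a {H : Phase d × Phase d → ℂ}, SL1 H → ft (pairForm d) (pairPartial a H) (ξ, η) =
      2 * Real.pi * Complex.I * pairForm d (pairDir a) (ξ, η) * ft (pairForm d) H (ξ, η) :=
    fun a H hH => ft_dirDeriv (pairForm d) hH (pairDir a) (ξ, η)
  have hi : ∀ {H : Phase d × Phase d → ℂ}, SL1 H →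
      Integrable fun w => expChar (-pairForm d w (ξ, η)) * H w := fun hH =>
    integrable_expChar_mul ((pairForm d).flip (ξ, η)) hH.integrable
  have h1 : ∀ i : Fin d, SL1 (pairPartial (.inl (.inl i)) (pairPartial (.inr (.inr i)) F)) := fun i =>
    (hF.pairPartial _).pairPartial _
  have h2 : ∀ i : Fin d, SL1 (pairPartial (.inl (.inr i)) (pairPartial (.inr (.inl i)) F)) := fun i =>
    (hF.pairPartial _).pairPartial _
  have e : ft (pairForm d) (symplecticDeriv F) (ξ, η) = ∑ i : Fin d,
      (ft (pairForm d) (pairPartial (.inl (.inl i)) (pairPartial (.inr (.inr i)) F)) (ξ, η) -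
        ft (pairForm d) (pairPartial (.inl (.inr i)) (pairPartial (.inr (.inl i)) F)) (ξ, η)) := by
    simp only [ft, symplecticDeriv, Finset.mul_sum, mul_sub]
    refine (integral_finsetSum _ fun i _ => (hi (h1 i)).sub (hi (h2 i))).trans ?_
    refine Finset.sum_congr rfl fun i _ => ?_
    exact integral_sub (hi (h1 i)) (hi (h2 i))
  have hI : Complex.I ^ 2 = -1 := Complex.I_sq
  have hc : ∀ i : Fin d, ft (pairForm d) (pairPartial (.inl (.inl i)) (pairPartial (.inr (.inr i)) F)) (ξ, η) -
        ft (pairForm d) (pairPartial (.inl (.inr i)) (pairPartial (.inr (.inl i)) F)) (ξ, η) =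
      ((-(4 * Real.pi ^ 2) * (ξ.1 i * η.2 i - ξ.2 i * η.1 i) : ℝ) : ℂ) * ft (pairForm d) F (ξ, η) := by
    intro i
    rw [hp _ (hF.pairPartial _), hp _ hF, hp _ (hF.pairPartial _), hp _ hF]
    have v : ∀ x : Conf d, inner ℝ (EuclideanSpace.single i (1 : ℝ)) x = x i := fun x => by
      rw [EuclideanSpace.inner_single_left]; simp
    simp only [pairForm_apply, phaseForm_apply, pairDir, phaseDir, Sum.elim_inl, Sum.elim_inr, Prod.fst_zero,
      Prod.snd_zero, inner_zero_left, v, add_zero, zero_add]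
    push_cast
    linear_combination (4 * Real.pi ^ 2 * ((ξ.1 i : ℂ) * η.2 i - ξ.2 i * η.1 i) * ft (pairForm d) F (ξ, η)) * hI
  rw [e]
  simp_rw [hc]
  rw [← Finset.sum_mul, ← Complex.ofReal_sum, ← Finset.mul_sum]
  congr 3
  rw [symp_eq, PiLp.inner_apply, PiLp.inner_apply, ← Finset.sum_sub_distrib, neg_mul]
  congr 2
  refine Finset.sum_congr rfl fun i _ => ?_
  simp only [RCLike.inner_apply, conj_trivial]
  ring

theorem SL1.iterate_symplecticDeriv {F : Phase d × Phase d → ℂ} (hF : SL1 F) (j : ℕ) :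
    SL1 (Weyl.symplecticDeriv^[j] F) := by
  induction j with
  | zero => exact hF
  | succ j ih => rw [Function.iterate_succ_apply']; exact ih.symplecticDeriv

theorem ft_iterate_symplecticDeriv {F : Phase d × Phase d → ℂ} (hF : SL1 F) (j : ℕ) (ξ η : Phase d) :
    ft (pairForm d) (symplecticDeriv^[j] F) (ξ, η) =
      ((-(4 * Real.pi ^ 2 * symp ξ η) : ℝ) : ℂ) ^ j * ft (pairForm d) F (ξ, η) := by
  induction j with
  | zero => simp
  | succ j ih =>
    rw [Function.iterate_succ_apply', ft_symplecticDeriv (hF.iterate_symplecticDeriv j), ih, pow_succ]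
    ring

theorem SL1.moyalTerm {p q : Phase d → ℂ} (hp : SL1 p) (hq : SL1 q) (j : ℕ) : SL1 (moyalTerm p q j) :=
  ((hp.tensor hq).iterate_symplecticDeriv j).const_mul _

theorem ft_tensor (p q : Phase d → ℂ) (ξ η : Phase d) :
    ft (pairForm d) (fun w => p w.1 * q w.2) (ξ, η) = ft (phaseForm d) p ξ * ft (phaseForm d) q η := by
  refine Eq.trans ?_ (integral_prod_mul (μ := (volume : Measure (Phase d))) (ν := (volume : Measure (Phase d)))
    (fun v => expChar (-phaseForm d v ξ) * p v) (fun v => expChar (-phaseForm d v η) * q v))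
  refine integral_congr_ae (Filter.Eventually.of_forall fun w => ?_)
  simp only
  rw [pairForm_apply, neg_add, expChar_add]
  ring

/-- The symbol of the phase `exp (i h)` in the Fourier representation of the Moyal product. -/
def moyalPhase (ξ η : Phase d) : ℂ := Complex.I * ((-(2 * Real.pi ^ 2 * symp ξ η) : ℝ) : ℂ)

theorem ft_moyalTerm {p q : Phase d → ℂ} (hp : SL1 p) (hq : SL1 q) (j : ℕ) (ξ η : Phase d) :
    ft (pairForm d) (moyalTerm p q j) (ξ, η) =
      moyalPhase ξ η ^ j / j.factorial * (ft (phaseForm d) p ξ * ft (phaseForm d) q η) := by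
  have h : ft (pairForm d) (moyalTerm p q j) (ξ, η) = (Complex.I ^ j / ((j.factorial : ℂ) * 2 ^ j)) *
      ft (pairForm d) (symplecticDeriv^[j] (fun v => p v.1 * q v.2)) (ξ, η) := by
    simp only [ft, moyalTerm, mul_left_comm (expChar _)]
    rw [integral_const_mul]
  rw [h, ft_iterate_symplecticDeriv (hp.tensor hq), ft_tensor, moyalPhase, mul_pow]
  have h2 : ((-(4 * Real.pi ^ 2 * symp ξ η) : ℝ) : ℂ) = 2 * ((-(2 * Real.pi ^ 2 * symp ξ η) : ℝ) : ℂ) := by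
    push_cast; ring
  rw [h2, mul_pow]
  field_simp

theorem expChar_eq_exp_moyalPhase (t : ℝ) (ξ η : Phase d) :
    expChar (-(Real.pi * t * symp ξ η)) = Complex.exp (t * moyalPhase ξ η) := by
  rw [expChar, moyalPhase]
  congr 1
  push_cast
  ring

theorem symp_sub_self (ξ α : Phase d) : symp ξ (α - ξ) = symp ξ α := by
  rw [symp_eq, symp_eq, Prod.fst_sub, Prod.snd_sub, inner_sub_right, inner_sub_right, real_inner_comm ξ.1]
  ring

end

section

/-! ### The remainder of the Moyal expansion -/

variable {d : ℕ}

theorem SL1.integrable_restrict {f : Phase d × Phase d → ℂ} (hf : SL1 f) :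
    Integrable fun s : Phase d => f (s, 0) := by
  obtain ⟨C, hC0, hC⟩ := exists_norm_ft_windowed_le d (2 * d + 1) (2 * d + 1) (2 * d + 1)
  set δ : Phase d → ℝ≥0∞ := fun s => ENNReal.ofReal (decay (2 * d + 1) s)
  have hδ : Measurable δ := (continuous_decay _).measurable.ennreal_ofReal
  set I := ∫⁻ s : Phase d, δ s
  have hI : I < ⊤ := lintegral_decay_lt_top (by rw [finrank_phase]; omega)
  set D : Phase d × Phase d → ℝ≥0∞ := fun w => ENNReal.ofReal (derivSum (2 * d + 1 + (2 * d + 1)) f w)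
  have hDm : Measurable D := by
    have : Continuous (derivSum (2 * d + 1 + (2 * d + 1)) f) := by
      unfold derivSum
      exact continuous_finsetSum _ fun k _ => (continuous_iteratedFDeriv_of_smooth hf.1 k).norm
    exact this.measurable.ennreal_ofReal
  have hD : ∫⁻ w, D w < ⊤ := by
    have h := (integrable_derivSum hf (2 * d + 1 + (2 * d + 1))).lintegral_lt_top
    exact h
  have hHj : Measurable fun q : Phase d × (Phase d × Phase d) => δ (q.2.1 + -q.1) * D q.2 := by
    have : Continuous fun q : Phase d × (Phase d × Phase d) => decay (2 * d + 1) (q.2.1 + -q.1) := by fun_prop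
    exact this.measurable.ennreal_ofReal.mul (hDm.comp measurable_snd)
  set H : Phase d → ℝ≥0∞ := fun a => ∫⁻ w : Phase d × Phase d, δ (w.1 + -a) * D w
  have hHm : Measurable H :=
    Measurable.lintegral_prod_right (f := fun (a : Phase d) (w : Phase d × Phase d) => δ (w.1 + -a) * D w) hHj
  have hH : ∫⁻ a, H a = I * ∫⁻ w, D w := by
    simp only [H]
    rw [lintegral_lintegral_swap hHj.aemeasurable, ← lintegral_const_mul _ hDm]
    refine lintegral_congr fun w => ?_
    have hw : Measurable fun a : Phase d => δ (w.1 + -a) :=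
      hδ.comp (measurable_const.add measurable_id.neg)
    rw [lintegral_mul_const _ hw]
    congr 1
    refine Eq.trans ?_ (lintegral_sub_right_eq_self δ w.1)
    refine lintegral_congr fun a => ?_
    simp only [δ, decay]
    rw [← sub_eq_add_neg, norm_sub_rev]
  have hb : ∀ a : Phase d, ‖f (a, 0)‖ₑ ≤ ENNReal.ofReal C * (I * I) * H a := by
    intro a
    have h1 := pair_inversion (hf.windowed a) (a, 0)
    have h2 : Weyl.windowed f a (a, 0) = f (a, 0) := by
      rw [Weyl.windowed, add_neg_cancel]
      simp [gauss]
    rw [← h2, ← h1]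
    have h3 : ∀ β ξ : Phase d, ‖ft (pairForm d) (Weyl.windowed f a) (β, ξ)‖ₑ ≤
        ENNReal.ofReal C * H a * (δ β * δ ξ) := by
      intro β ξ
      rw [← ofReal_norm]
      refine (ENNReal.ofReal_le_ofReal (hC f hf a β ξ)).trans (le_of_eq ?_)
      have h1 := (decay_pos (2 * d + 1) β).le
      have h2 := (decay_pos (2 * d + 1) ξ).le
      rw [ENNReal.ofReal_mul (by positivity), ENNReal.ofReal_mul (by positivity), ENNReal.ofReal_mul hC0,
        ofReal_integral_eq_lintegral_ofReal]
      · have : ∀ w : Phase d × Phase d, ENNReal.ofReal (decay (2 * d + 1) (w.1 + -a) *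
            derivSum (2 * d + 1 + (2 * d + 1)) f w) = δ (w.1 + -a) * D w := fun w =>
          ENNReal.ofReal_mul (decay_pos _ _).le
        simp only [this]
        simp only [H, δ]
        ring
      · refine (integrable_derivSum hf _).bdd_mul (c := 1)
          (Continuous.aestronglyMeasurable (by fun_prop)) (Filter.Eventually.of_forall fun w => ?_)
        rw [Real.norm_of_nonneg (decay_pos _ _).le]; exact decay_le_one _ _
      · exact Filter.Eventually.of_forall fun w => mul_nonneg (decay_pos _ _).le (derivSum_nonneg _ _ _)
    have hm2 : Measurable fun θ : Phase d × Phase d => δ θ.1 * δ θ.2 :=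
      (hδ.comp measurable_fst).mul (hδ.comp measurable_snd)
    calc _ ≤ ∫⁻ θ : Phase d × Phase d, ‖expChar (pairForm d (a, 0) θ) * ft (pairForm d) (Weyl.windowed f a) θ‖ₑ :=
          enorm_integral_le_lintegral_enorm _
      _ ≤ ∫⁻ θ : Phase d × Phase d, ENNReal.ofReal C * H a * (δ θ.1 * δ θ.2) := by
          refine lintegral_mono fun θ => ?_
          simp only
          rw [enorm_mul, ← ofReal_norm (expChar _), norm_expChar, ENNReal.ofReal_one, one_mul]
          exact h3 θ.1 θ.2
      _ = _ := by
          rw [lintegral_const_mul _ hm2]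
          have e : ∫⁻ θ : Phase d × Phase d, δ θ.1 * δ θ.2 = I * I :=
            lintegral_prod_mul hδ.aemeasurable hδ.aemeasurable
          rw [e]
          ring
  have hc : Continuous fun s : Phase d => f (s, 0) := hf.continuous.comp' (by fun_prop)
  refine ⟨hc.aestronglyMeasurable, ?_⟩
  refine lt_of_le_of_lt (lintegral_mono hb) ?_
  rw [lintegral_const_mul _ hHm, hH]
  exact ENNReal.mul_lt_top (ENNReal.mul_lt_top ENNReal.ofReal_lt_top (ENNReal.mul_lt_top hI hI))
    (ENNReal.mul_lt_top hI hD)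

/-- The `j`-th Moyal term in the coordinates `(y, x - y)`. -/
def shearedTerm (p q : Phase d → ℂ) (j : ℕ) : Phase d × Phase d → ℂ := fun w => moyalTerm p q j (shear d w)

theorem SL1.shearedTerm {p q : Phase d → ℂ} (hp : SL1 p) (hq : SL1 q) (j : ℕ) : SL1 (shearedTerm p q j) :=
  (hp.moyalTerm hq j).comp_shear

theorem moyalPhase_sub_self (ξ α : Phase d) : moyalPhase ξ (α - ξ) = moyalPhase ξ α := by
  rw [moyalPhase, symp_sub_self, moyalPhase]

theorem ft_shearedTerm {p q : Phase d → ℂ} (hp : SL1 p) (hq : SL1 q) (j : ℕ) (θ : Phase d × Phase d) :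
    ft (pairForm d) (shearedTerm p q j) θ = moyalPhase θ.2 θ.1 ^ j / j.factorial *
      (ft (phaseForm d) p θ.2 * ft (phaseForm d) q (θ.1 - θ.2)) := by
  obtain ⟨α, ξ⟩ := θ
  have h := ft_comp_shear (hp.moyalTerm hq j) α ξ
  rw [ft_moyalTerm hp hq, moyalPhase_sub_self] at h
  exact h

theorem moyalSum_eq (p q : Phase d → ℂ) (n : ℕ) :
    moyalSum p q n = fun z => ∑ j ∈ Finset.range (n + 1), shearedTerm p q j (z, 0) := by
  funext z
  simp only [moyalSum, shearedTerm, shear_apply, add_zero]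

theorem integrable_moyalSum {p q : Phase d → ℂ} (hp : SL1 p) (hq : SL1 q) (n : ℕ) :
    Integrable (moyalSum p q n) := by
  rw [moyalSum_eq]
  exact integrable_finsetSum _ fun j _ => (hp.shearedTerm hq j).integrable_restrict

theorem moyalSum_superposition {p q : Phase d → ℂ} (hp : SL1 p) (hq : SL1 q) (n : ℕ) (z : Phase d) :
    moyalSum p q n z = ∫ θ : Phase d × Phase d,
      (∑ j ∈ Finset.range (n + 1), ft (pairForm d) (shearedTerm p q j) θ) * expChar (phaseForm d θ.1 z) := by
  rw [moyalSum_eq]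
  simp only [Finset.sum_mul]
  have hE : Continuous fun θ : Phase d × Phase d => expChar (phaseForm d θ.1 z) := by
    simp only [phaseForm_apply]
    exact continuous_expChar.comp' (by fun_prop)
  rw [integral_finsetSum _ fun j _ => integrable_ft_mul (hp.shearedTerm hq j) hE (C := 1)
    fun θ => (norm_expChar _).le]
  refine Finset.sum_congr rfl fun j _ => ?_
  rw [← pair_inversion (hp.shearedTerm hq j) (z, 0)]
  refine integral_congr_ae (Filter.Eventually.of_forall fun θ => ?_)
  simp only
  rw [pairForm_apply, mul_comm]
  simp only [map_zero, zero_apply, add_zero]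
  rw [phaseForm_comm]

theorem phase_superposition {p : Phase d → ℂ} (hp : SL1 p) (z : Phase d) :
    p z = ∫ ξ, ft (phaseForm d) p ξ * expChar (phaseForm d ξ z) := by
  rw [← phase_inversion hp z]
  refine integral_congr_ae (Filter.Eventually.of_forall fun θ => ?_)
  simp only
  rw [phaseForm_comm, mul_comm]

/-- The remainder of the Moyal expansion. -/
def remainder (p q : Phase d → ℂ) (n : ℕ) : L2 d →L[ℂ] L2 d := op p ∘L op q - op (moyalSum p q n)

theorem inner_coh_remainder_coh {p q : Phase d → ℂ} (hp : SL1 p) (hq : SL1 q) (n : ℕ) (w u : Phase d) :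
    inner ℂ (coh w) (remainder p q n (coh u)) = cohNormSq d * expChar ((4 * Real.pi)⁻¹ * symp w u) *
      ∫ t in Set.Ioc (0 : ℝ) 1, (((n + 1) * (1 - t) ^ n : ℝ) : ℂ) *
        packetKernel t (shearedTerm p q (n + 1)) (w, u) := by
  set x : Phase d → ℂ := packet ((1 / 2 : ℝ) • (w + u)) (freq d (w - u))
  have hxc : Continuous x := by
    have h := (continuous_packet (d := d)).comp' (by fun_prop : Continuous fun α : Phase d =>
      ((1 / 2 : ℝ) • (w + u), freq d (w - u), α))
    exact h
  have hx1 : ∀ α, ‖x α‖ ≤ 1 := fun α => norm_packet_le_one _ _ _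
  have hxθ : Continuous fun θ : Phase d × Phase d => x θ.1 := hxc.comp continuous_fst
  have hi : ∀ j, Integrable fun θ => ft (pairForm d) (shearedTerm p q j) θ * x θ.1 := fun j =>
    integrable_ft_mul (hp.shearedTerm hq j) hxθ (C := 1) fun θ => hx1 _
  have hQ : Integrable fun θ => ∑ j ∈ Finset.range (n + 1), ft (pairForm d) (shearedTerm p q j) θ :=
    integrable_finsetSum _ fun j _ => integrable_ft nondeg_pairForm (hp.shearedTerm hq j)
  have hP : Integrable (ft (phaseForm d) p) := integrable_ft nondeg_phaseForm hp
  have hQ' : Integrable (ft (phaseForm d) q) := integrable_ft nondeg_phaseForm hq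
  have hmp := measurePreserving_frequency_shear (d := d)
  set K : Phase d × Phase d → ℂ := fun θ => ft (phaseForm d) p θ.1 * ft (phaseForm d) q θ.2 *
    (expChar (-(Real.pi * symp θ.1 θ.2)) * x (θ.1 + θ.2))
  have hKc : Continuous fun θ : Phase d × Phase d => expChar (-(Real.pi * symp θ.1 θ.2)) * x (θ.1 + θ.2) :=
    (continuous_expChar.comp' (by fun_prop)).mul (hxc.comp' (by fun_prop))
  have hK : Integrable K :=
    (hP.mul_prod hQ').mul_bdd (c := 1) hKc.aestronglyMeasurable (Filter.Eventually.of_forall fun θ => by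
      rw [norm_mul, norm_expChar, one_mul]; exact hx1 _)
  have e1 : ∫ θ, K θ = ∫ θ : Phase d × Phase d, K (θ.2, θ.1 - θ.2) := by
    conv_lhs => rw [← hmp.map_eq]
    exact integral_map hmp.measurable.aemeasurable (by rw [hmp.map_eq]; exact hK.aestronglyMeasurable)
  have hK2 : Integrable fun θ : Phase d × Phase d => K (θ.2, θ.1 - θ.2) := by
    have h := hmp.integrable_comp_of_integrable hK
    exact h
  have hL : Integrable fun θ : Phase d × Phase d =>
      (∑ j ∈ Finset.range (n + 1), ft (pairForm d) (shearedTerm p q j) θ) * x θ.1 :=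
    hQ.mul_bdd (c := 1) hxθ.aestronglyMeasurable (Filter.Eventually.of_forall fun θ => hx1 _)
  rw [remainder, sub_apply, inner_sub_right, ContinuousLinearMap.comp_apply,
    inner_coh_op_op_coh hP hQ' hp.integrable hq.integrable (phase_superposition hp) (phase_superposition hq) w u,
    inner_coh_op_coh hQ measurable_fst (integrable_moyalSum hp hq n) (moyalSum_superposition hp hq n) w u,
    ← mul_sub]
  congr 1
  have e2 : (∫ θ, K θ) - (∫ θ : Phase d × Phase d,
      (∑ j ∈ Finset.range (n + 1), ft (pairForm d) (shearedTerm p q j) θ) * x θ.1) =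
      ∫ θ : Phase d × Phase d, ∫ t in Set.Ioc (0 : ℝ) 1, (((n + 1) * (1 - t) ^ n : ℝ) : ℂ) *
        (ft (pairForm d) (shearedTerm p q (n + 1)) θ * (expChar (-(Real.pi * t * symp θ.2 θ.1)) * x θ.1)) := by
    rw [e1, ← integral_sub hK2 hL]
    refine integral_congr_ae (Filter.Eventually.of_forall fun θ => ?_)
    have h1 := exp_sub_sum_eq (moyalPhase θ.2 θ.1) n
    rw [intervalIntegral.integral_of_le zero_le_one] at h1
    have h2 := expChar_eq_exp_moyalPhase 1 θ.2 θ.1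
    rw [mul_one, Complex.ofReal_one, one_mul] at h2
    simp only [expChar_eq_exp_moyalPhase]
    simp only [K, symp_sub_self, add_sub_cancel, h2]
    simp only [ft_shearedTerm hp hq]
    rw [← Finset.sum_mul]
    have h3 : ∀ t : ℝ, (((n + 1) * (1 - t) ^ n : ℝ) : ℂ) * (moyalPhase θ.2 θ.1 ^ (n + 1) / (n + 1).factorial *
        (ft (phaseForm d) p θ.2 * ft (phaseForm d) q (θ.1 - θ.2)) *
        (Complex.exp (t * moyalPhase θ.2 θ.1) * x θ.1)) =
        (moyalPhase θ.2 θ.1 ^ (n + 1) / (n + 1).factorial *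
          (ft (phaseForm d) p θ.2 * ft (phaseForm d) q (θ.1 - θ.2)) * x θ.1) *
        ((((n + 1) * (1 - t) ^ n : ℝ) : ℂ) * Complex.exp (t * moyalPhase θ.2 θ.1)) := fun t => by ring
    simp only [h3]
    rw [integral_const_mul]
    linear_combination (ft (phaseForm d) p θ.2 * ft (phaseForm d) q (θ.1 - θ.2) * x θ.1) * h1
  refine e2.trans ?_
  have hτ : Integrable (fun t : ℝ => (((n + 1) * (1 - t) ^ n : ℝ) : ℂ)) (volume.restrict (Set.Ioc 0 1)) :=
    (Continuous.integrableOn_Icc (by fun_prop)).mono_set Set.Ioc_subset_Icc_self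
  have hEc : Continuous fun o : (Phase d × Phase d) × ℝ => expChar (-(Real.pi * o.2 * symp o.1.2 o.1.1)) * x o.1.1 :=
    (continuous_expChar.comp' (by fun_prop)).mul (hxc.comp' (by fun_prop))
  have hj : Integrable (fun o : (Phase d × Phase d) × ℝ => (((n + 1) * (1 - o.2) ^ n : ℝ) : ℂ) *
      (ft (pairForm d) (shearedTerm p q (n + 1)) o.1 * (expChar (-(Real.pi * o.2 * symp o.1.2 o.1.1)) * x o.1.1)))
      ((volume : Measure (Phase d × Phase d)).prod (volume.restrict (Set.Ioc 0 1))) := by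
    have h := ((integrable_ft nondeg_pairForm (hp.shearedTerm hq (n + 1))).mul_prod hτ).mul_bdd (c := 1)
      hEc.aestronglyMeasurable (Filter.Eventually.of_forall fun o => by
        rw [norm_mul, norm_expChar, one_mul]; exact hx1 _)
    refine h.congr (Filter.Eventually.of_forall fun o => ?_)
    simp only
    ring
  rw [integral_integral_swap hj]
  refine integral_congr_ae (Filter.Eventually.of_forall fun t => ?_)
  simp only
  rw [integral_const_mul]
  rfl

end

section

/-! ### Operator norm and trace norm of the remainder -/

variable {d : ℕ}

/-- The weight in the integral form of the Taylor remainder. -/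
def taylorWeight (n : ℕ) (t : ℝ) : ℝ := (n + 1) * (1 - t) ^ n

theorem lintegral_taylorWeight (n : ℕ) :
    ∫⁻ t in Set.Ioc (0 : ℝ) 1, ENNReal.ofReal (taylorWeight n t) = 1 := by
  have hc : Continuous (taylorWeight n) := by unfold taylorWeight; fun_prop
  have hi : IntegrableOn (taylorWeight n) (Set.Ioc 0 1) :=
    hc.integrableOn_Icc.mono_set Set.Ioc_subset_Icc_self
  rw [← ofReal_integral_eq_lintegral_ofReal hi, ← intervalIntegral.integral_of_le zero_le_one]
  · have : ∫ t in (0 : ℝ)..1, taylorWeight n t = 1 := by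
      simp only [taylorWeight]
      rw [intervalIntegral.integral_const_mul, intervalIntegral.integral_comp_sub_left (fun x => x ^ n) 1]
      simp only [sub_self, sub_zero, integral_pow, one_pow, ne_eq, Nat.succ_ne_zero, not_false_eq_true, zero_pow]
      have : (n + 1 : ℝ) ≠ 0 := by positivity
      field_simp
    rw [this, ENNReal.ofReal_one]
  · refine (ae_restrict_mem measurableSet_Ioc).mono fun t ht => ?_
    have : 0 ≤ 1 - t := by linarith [ht.2]
    simp only [taylorWeight, Pi.zero_apply]
    positivity

theorem measurable_taylorWeight (n : ℕ) : Measurable fun t => ENNReal.ofReal (taylorWeight n t) := by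
  have hc : Continuous (taylorWeight n) := by unfold taylorWeight; fun_prop
  exact hc.measurable.ennreal_ofReal

theorem enorm_inner_comm {H : Type*} [NormedAddCommGroup H] [InnerProductSpace ℂ H] (x y : H) :
    ‖inner ℂ x y‖ₑ = ‖inner ℂ y x‖ₑ := by
  rw [← ofReal_norm, ← ofReal_norm, norm_inner_symm]

theorem enorm_inner_coh_remainder_coh_le {p q : Phase d → ℂ} (hp : SL1 p) (hq : SL1 q) (n : ℕ) (w u : Phase d) :
    ‖inner ℂ (coh w) (remainder p q n (coh u))‖ₑ ≤ ENNReal.ofReal (cohNormSq d) *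
      ∫⁻ t in Set.Ioc (0 : ℝ) 1, ENNReal.ofReal (taylorWeight n t) *
        ‖packetKernel t (shearedTerm p q (n + 1)) (w, u)‖ₑ := by
  rw [inner_coh_remainder_coh hp hq, enorm_mul, enorm_mul, ← ofReal_norm (expChar _), norm_expChar,
    ENNReal.ofReal_one, mul_one, ← ofReal_norm (cohNormSq d : ℂ), Complex.norm_real,
    Real.norm_of_nonneg (cohNormSq_pos d).le]
  refine mul_le_mul_right ((enorm_integral_le_lintegral_enorm _).trans (le_of_eq ?_)) _
  refine setLIntegral_congr_fun measurableSet_Ioc fun t ht => ?_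
  have : 0 ≤ 1 - t := by linarith [ht.2]
  rw [enorm_mul, ← ofReal_norm (((n + 1) * (1 - t) ^ n : ℝ) : ℂ), Complex.norm_real, Real.norm_of_nonneg (by positivity),
    taylorWeight]

/-- The packet kernel, tested against two weights. -/
def kernelTest (f : Phase d × Phase d → ℂ) (n : ℕ) (M : Phase d × Phase d → ℝ≥0∞) : ℝ≥0∞ :=
  ∫⁻ t in Set.Ioc (0 : ℝ) 1, ENNReal.ofReal (taylorWeight n t) * ∫⁻ W, ‖packetKernel t f W‖ₑ * M W

theorem measurable_packetKernel {f : Phase d × Phase d → ℂ} (hf : SL1 f) :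
    Measurable fun o : ℝ × (Phase d × Phase d) => ‖packetKernel o.1 f o.2‖ₑ := by
  have h := (continuous_packetKernel hf).measurable.enorm
  exact h

theorem measurable_weighted_packetKernel {f : Phase d × Phase d → ℂ} (hf : SL1 f) (n : ℕ) :
    Measurable (Function.uncurry fun (W : Phase d × Phase d) (t : ℝ) =>
      ENNReal.ofReal (taylorWeight n t) * ‖packetKernel t f W‖ₑ) := by
  have h := (measurable_packetKernel hf).comp (measurable_swap (α := Phase d × Phase d) (β := ℝ))
  exact ((measurable_taylorWeight n).comp measurable_snd).mul h

/-- The weighted mean of the packet kernels. -/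
def meanKernel (f : Phase d × Phase d → ℂ) (n : ℕ) (W : Phase d × Phase d) : ℝ≥0∞ :=
  ∫⁻ t in Set.Ioc (0 : ℝ) 1, ENNReal.ofReal (taylorWeight n t) * ‖packetKernel t f W‖ₑ

theorem measurable_meanKernel {f : Phase d × Phase d → ℂ} (hf : SL1 f) (n : ℕ) :
    Measurable (meanKernel f n) :=
  Measurable.lintegral_prod_right (measurable_weighted_packetKernel hf n)

theorem lintegral_meanKernel_mul {f : Phase d × Phase d → ℂ} (hf : SL1 f) (n : ℕ)
    {A : Phase d × Phase d → ℝ≥0∞} (hA : Measurable A) :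
    ∫⁻ W, meanKernel f n W * A W = kernelTest f n A := by
  have hw := measurable_weighted_packetKernel hf n
  have e4 : ∀ W : Phase d × Phase d, meanKernel f n W * A W = ∫⁻ t in Set.Ioc (0 : ℝ) 1,
      ENNReal.ofReal (taylorWeight n t) * ‖packetKernel t f W‖ₑ * A W := by
    intro W
    rw [meanKernel, lintegral_mul_const _ hw.of_uncurry_left]
  simp only [e4]
  have hA' : Measurable fun o : (Phase d × Phase d) × ℝ => A o.1 := hA.comp measurable_fst
  have hj := hw.mul hA'
  rw [lintegral_lintegral_swap hj.aemeasurable, kernelTest]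
  refine lintegral_congr fun t => ?_
  simp only [mul_assoc]
  rw [lintegral_const_mul' _ _ ENNReal.ofReal_ne_top]

theorem enorm_inner_le_of_resolution {κ : ℝ≥0} (hκ : 0 < κ)
    (hres : ∀ g e : L2 d, ∫ w, inner ℂ g (coh w) * inner ℂ (coh w) e = (κ : ℝ) * inner ℂ g e) (g e : L2 d) :
    ‖inner ℂ g e‖ₑ ≤ (κ : ℝ≥0∞)⁻¹ * ∫⁻ w, ‖inner ℂ g (coh w)‖ₑ * ‖inner ℂ (coh w) e‖ₑ := by
  have hκ' : (κ : ℝ≥0∞) ≠ 0 := by exact_mod_cast hκ.ne'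
  have h1 : (κ : ℝ≥0∞) * ‖inner ℂ g e‖ₑ ≤ ∫⁻ w, ‖inner ℂ g (coh w)‖ₑ * ‖inner ℂ (coh w) e‖ₑ := by
    have h2 : (κ : ℝ≥0∞) * ‖inner ℂ g e‖ₑ = ‖((κ : ℝ) : ℂ) * inner ℂ g e‖ₑ := by
      rw [enorm_mul, ← ofReal_norm ((κ : ℝ) : ℂ), Complex.norm_real, Real.norm_of_nonneg κ.coe_nonneg,
        ENNReal.ofReal_coe_nnreal]
    rw [h2, ← hres]
    refine (enorm_integral_le_lintegral_enorm _).trans (le_of_eq ?_)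
    exact lintegral_congr fun w => enorm_mul _ _
  calc ‖inner ℂ g e‖ₑ = (κ : ℝ≥0∞)⁻¹ * (κ * ‖inner ℂ g e‖ₑ) := by
        rw [← mul_assoc, ENNReal.inv_mul_cancel hκ' ENNReal.coe_ne_top, one_mul]
    _ ≤ _ := mul_le_mul_right h1 _

theorem exists_enorm_inner_remainder_le (d : ℕ) : ∃ C : ℝ≥0, ∀ p q : Phase d → ℂ, SL1 p → SL1 q →
    ∀ (n : ℕ) (g e : L2 d), ‖inner ℂ g (remainder p q n e)‖ₑ ≤
      C * kernelTest (shearedTerm p q (n + 1)) n fun W => ‖inner ℂ (coh W.1) g‖ₑ * ‖inner ℂ (coh W.2) e‖ₑ := by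
  obtain ⟨κ, hκ, -, hres⟩ := exists_resolution d
  refine ⟨κ⁻¹ ^ 2 * (cohNormSq d).toNNReal, fun p q hp hq n g e => ?_⟩
  have hr := fun g e => enorm_inner_le_of_resolution hκ hres g e
  generalize hT : remainder p q n = T
  have hcc : ∀ w u, ‖inner ℂ (coh w) (T (coh u))‖ₑ ≤ ENNReal.ofReal (cohNormSq d) *
      meanKernel (shearedTerm p q (n + 1)) n (w, u) := by
    intro w u
    rw [← hT]
    exact enorm_inner_coh_remainder_coh_le hp hq n w u
  have hU : Measurable fun w => ‖inner ℂ (coh w) g‖ₑ := (continuous_inner_coh g).measurable.enorm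
  have hV : Measurable fun w => ‖inner ℂ (coh w) e‖ₑ := (continuous_inner_coh e).measurable.enorm
  have hf := hp.shearedTerm hq (n + 1)
  have hM := measurable_meanKernel hf n
  have hUV : Measurable fun W : Phase d × Phase d => ‖inner ℂ (coh W.1) g‖ₑ * ‖inner ℂ (coh W.2) e‖ₑ :=
    (hU.comp measurable_fst).mul (hV.comp measurable_snd)
  rw [← lintegral_meanKernel_mul hf n hUV]
  generalize meanKernel (shearedTerm p q (n + 1)) n = M at hM hcc
  generalize hU' : (fun w => ‖inner ℂ (coh w) g‖ₑ) = U at hU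
  generalize hV' : (fun w => ‖inner ℂ (coh w) e‖ₑ) = V at hV
  have hUw : ∀ w, ‖inner ℂ (coh w) g‖ₑ = U w := fun w => congrFun hU' w
  have hVw : ∀ w, ‖inner ℂ (coh w) e‖ₑ = V w := fun w => congrFun hV' w
  simp only [hUw, hVw] at hUV ⊢
  have h1 : ‖inner ℂ g (T e)‖ₑ ≤ (κ : ℝ≥0∞)⁻¹ * ∫⁻ w, U w * ‖inner ℂ (coh w) (T e)‖ₑ := by
    refine (hr g (T e)).trans (le_of_eq ?_)
    simp only [enorm_inner_comm g, hUw]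
  have h2 : ∀ w, ‖inner ℂ (coh w) (T e)‖ₑ ≤
      (κ : ℝ≥0∞)⁻¹ * ∫⁻ u, ENNReal.ofReal (cohNormSq d) * M (w, u) * V u := by
    intro w
    rw [← ContinuousLinearMap.adjoint_inner_left]
    refine (hr _ e).trans (mul_le_mul_right (lintegral_mono fun u => ?_) _)
    simp only
    rw [ContinuousLinearMap.adjoint_inner_left, hVw]
    exact mul_le_mul_left (hcc w u) _
  have hMV : ∀ w, Measurable fun u => M (w, u) * V u := by
    intro w
    have h := hM.comp (measurable_prodMk_left (x := w))
    exact h.mul hV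
  have hMUV : Measurable fun W : Phase d × Phase d => M W * (U W.1 * V W.2) := hM.mul hUV
  calc ‖inner ℂ g (T e)‖ₑ
      ≤ (κ : ℝ≥0∞)⁻¹ * ∫⁻ w, U w * ((κ : ℝ≥0∞)⁻¹ * ∫⁻ u, ENNReal.ofReal (cohNormSq d) * M (w, u) * V u) :=
        h1.trans (mul_le_mul_right (lintegral_mono fun w => mul_le_mul_right (h2 w) _) _)
    _ = (κ : ℝ≥0∞)⁻¹ * ((κ : ℝ≥0∞)⁻¹ * ENNReal.ofReal (cohNormSq d) * ∫⁻ w, ∫⁻ u, M (w, u) * (U w * V u)) := by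
        have hκ' : (κ : ℝ≥0∞)⁻¹ ≠ ⊤ := ENNReal.inv_ne_top.2 (by exact_mod_cast hκ.ne')
        congr 1
        rw [← lintegral_const_mul' _ _ (ENNReal.mul_ne_top hκ' ENNReal.ofReal_ne_top)]
        refine lintegral_congr fun w => ?_
        have e1 : ∀ u, ENNReal.ofReal (cohNormSq d) * M (w, u) * V u =
          ENNReal.ofReal (cohNormSq d) * (M (w, u) * V u) := fun u => by ring
        have e2 : ∀ u, M (w, u) * (U w * V u) = U w * (M (w, u) * V u) := fun u => by ring
        simp only [e1, e2]
        rw [lintegral_const_mul _ (hMV w), lintegral_const_mul _ (hMV w)]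
        ring
    _ = (κ : ℝ≥0∞)⁻¹ * ((κ : ℝ≥0∞)⁻¹ * ENNReal.ofReal (cohNormSq d) *
          ∫⁻ W : Phase d × Phase d, M W * (U W.1 * V W.2)) := by
        congr 2
        exact (lintegral_prod _ hMUV.aemeasurable).symm
    _ = _ := by
        push_cast
        rw [ENNReal.coe_inv hκ.ne', ENNReal.ofReal]
        ring

theorem kernelTest_le {f : Phase d × Phase d → ℂ} {n : ℕ} {M : Phase d × Phase d → ℝ≥0∞} {A : ℝ≥0∞}
    (h : ∀ t : ℝ, |t| ≤ 1 → ∫⁻ W, ‖packetKernel t f W‖ₑ * M W ≤ A) : kernelTest f n M ≤ A := by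
  calc kernelTest f n M ≤ ∫⁻ t in Set.Ioc (0 : ℝ) 1, ENNReal.ofReal (taylorWeight n t) * A := by
        refine setLIntegral_mono' measurableSet_Ioc fun t ht => ?_
        exact mul_le_mul_right (h t (abs_le.2 ⟨by linarith [ht.1], ht.2⟩)) _
    _ = A := by rw [lintegral_mul_const _ (measurable_taylorWeight n), lintegral_taylorWeight, one_mul]

theorem exists_enorm_remainder_le (d G : ℕ) : ∃ C : ℝ≥0, ∀ p q : Phase d → ℂ, SL1 p → SL1 q → ∀ n : ℕ,
    ‖remainder p q n‖ₑ ≤ C * ∫⁻ v : Phase d, ⨆ s : Phase d,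
      ENNReal.ofReal (derivSum (G + 3 * d + 3) (shearedTerm p q (n + 1)) (s, v) / japBracket v ^ G) := by
  obtain ⟨C, hC⟩ := exists_enorm_inner_remainder_le d
  obtain ⟨C', hC'⟩ := exists_lintegral_packetKernel_mul_le_weighted d G
  obtain ⟨κ, hκ, hsq, -⟩ := exists_resolution d
  refine ⟨C * (C' + 1) * κ, fun p q hp hq n => ?_⟩
  set f := shearedTerm p q (n + 1)
  have hf : SL1 f := hp.shearedTerm hq (n + 1)
  set S := ∫⁻ v : Phase d, ⨆ s : Phase d, ENNReal.ofReal (derivSum (G + 3 * d + 3) f (s, v) / japBracket v ^ G)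
  have h1 : ∀ g e : L2 d, ‖inner ℂ g (remainder p q n e)‖ₑ ≤ (C * (C' + 1) * κ * S * ‖e‖ₑ) * ‖g‖ₑ := by
    intro g e
    refine (hC p q hp hq n g e).trans ?_
    have h2 : kernelTest f n (fun W => ‖inner ℂ (coh W.1) g‖ₑ * ‖inner ℂ (coh W.2) e‖ₑ) ≤
        (C' + 1) * S * (κ * (‖g‖ₑ * ‖e‖ₑ)) := by
      refine kernelTest_le fun t ht => ?_
      have h3 := hC' t ht f hf (fun w => ‖inner ℂ (coh w) g‖ₑ) (fun w => ‖inner ℂ (coh w) e‖ₑ)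
        (continuous_inner_coh g).measurable.enorm (continuous_inner_coh e).measurable.enorm
      simp only [hsq] at h3
      refine (ENNReal.pow_le_pow_left_iff two_ne_zero).1 (h3.trans ?_)
      have h4 : (C' : ℝ≥0∞) ≤ (C' + 1) ^ 2 := by
        have : C' ≤ (C' + 1) ^ 2 := by nlinarith [sq_nonneg C']
        exact_mod_cast this
      calc (C' : ℝ≥0∞) * S ^ 2 * (κ * ‖g‖ₑ ^ 2 * (κ * ‖e‖ₑ ^ 2)) ≤
            (C' + 1) ^ 2 * S ^ 2 * (κ * ‖g‖ₑ ^ 2 * (κ * ‖e‖ₑ ^ 2)) := by gcongr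
        _ = _ := by ring
    refine (mul_le_mul_right h2 _).trans (le_of_eq ?_)
    ring
  push_cast
  set A : ℝ≥0∞ := C * (C' + 1) * κ * S
  refine ContinuousLinearMap.opENorm_le_bound _ fun e => ?_
  by_cases h0 : remainder p q n e = 0
  · rw [h0, enorm_zero]; exact zero_le
  have h6 := h1 (remainder p q n e) e
  rw [inner_self_eq_norm_sq_to_K, enorm_pow] at h6
  have h8 : ‖((‖remainder p q n e‖ : ℝ) : ℂ)‖ₑ = ‖remainder p q n e‖ₑ := by
    rw [← ofReal_norm, Complex.norm_real, norm_norm, ofReal_norm]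
  rw [show ‖(RCLike.ofReal ‖remainder p q n e‖ : ℂ)‖ₑ = _ from h8, sq] at h6
  exact (ENNReal.mul_le_mul_iff_left (enorm_ne_zero.2 h0) enorm_ne_top).1 h6

theorem sum_enorm_inner_mul_le {H : Type*} [NormedAddCommGroup H] [InnerProductSpace ℂ H] {N : ℕ} {e f : Fin N → H}
    (he : Orthonormal ℂ e) (hf : Orthonormal ℂ f) {x y : H} {c : ℝ} (hx : ‖x‖ ^ 2 = c) (hy : ‖y‖ ^ 2 = c) :
    ∑ i, ‖inner ℂ x (f i)‖ₑ * ‖inner ℂ y (e i)‖ₑ ≤ ENNReal.ofReal c := by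
  have h1 : ∀ i, ‖inner ℂ x (f i)‖ₑ * ‖inner ℂ y (e i)‖ₑ = ENNReal.ofReal (‖inner ℂ (f i) x‖ * ‖inner ℂ (e i) y‖) := by
    intro i
    rw [enorm_inner_comm x, enorm_inner_comm y, ENNReal.ofReal_mul (norm_nonneg _), ofReal_norm, ofReal_norm]
  simp only [h1]
  rw [← ENNReal.ofReal_sum_of_nonneg fun i _ => by positivity]
  refine ENNReal.ofReal_le_ofReal ?_
  have hb1 := hf.sum_inner_products_le x (s := Finset.univ)
  have hb2 := he.sum_inner_products_le y (s := Finset.univ)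
  have h2 : ∑ i, ‖inner ℂ (f i) x‖ * ‖inner ℂ (e i) y‖ ≤
      ∑ i, (1 / 2 * ‖inner ℂ (f i) x‖ ^ 2 + 1 / 2 * ‖inner ℂ (e i) y‖ ^ 2) :=
    Finset.sum_le_sum fun i _ => by nlinarith [sq_nonneg (‖inner ℂ (f i) x‖ - ‖inner ℂ (e i) y‖)]
  rw [Finset.sum_add_distrib, ← Finset.mul_sum, ← Finset.mul_sum] at h2
  linarith

theorem sum_kernelTest {f : Phase d × Phase d → ℂ} (hf : SL1 f) (n : ℕ) {ι : Type*} (s : Finset ι)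
    {M : ι → Phase d × Phase d → ℝ≥0∞} (hM : ∀ i, Measurable (M i)) :
    ∑ i ∈ s, kernelTest f n (M i) = kernelTest f n fun W => ∑ i ∈ s, M i W := by
  have e := lintegral_meanKernel_mul hf n (A := fun W => ∑ i ∈ s, M i W) (Finset.measurable_sum s fun i _ => hM i)
  rw [← e]
  simp only [Finset.mul_sum]
  refine Eq.trans ?_ (lintegral_finsetSum s fun i _ => (measurable_meanKernel hf n).mul (hM i)).symm
  exact Finset.sum_congr rfl fun i _ => (lintegral_meanKernel_mul hf n (hM i)).symm

theorem exists_traceNorm_remainder_le (d G : ℕ) : ∃ C : ℝ≥0, ∀ p q : Phase d → ℂ, SL1 p → SL1 q → ∀ n : ℕ,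
    traceNorm (remainder p q n) ≤ C * ∫⁻ w : Phase d × Phase d,
      ENNReal.ofReal (derivSum (G + 4 * d + 2) (shearedTerm p q (n + 1)) w / japBracket w.2 ^ G) := by
  obtain ⟨C, hC⟩ := exists_enorm_inner_remainder_le d
  obtain ⟨C', hC'⟩ := exists_lintegral_packetKernel_le_weighted d G
  refine ⟨C * (C' * (cohNormSq d).toNNReal), fun p q hp hq n => ?_⟩
  have hC := hC p q hp hq n
  have hf : SL1 (shearedTerm p q (n + 1)) := hp.shearedTerm hq (n + 1)
  have hC' := fun t ht => hC' t ht _ hf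
  generalize shearedTerm p q (n + 1) = f at hf hC hC'
  generalize remainder p q n = T at hC
  generalize (∫⁻ w : Phase d × Phase d, ENNReal.ofReal (derivSum (G + 4 * d + 2) f w / japBracket w.2 ^ G)) = S at hC'
  refine iSup_le fun N => iSup_le fun e => iSup_le fun b => iSup_le fun he => iSup_le fun hb => ?_
  have hM : ∀ i, Measurable fun W : Phase d × Phase d =>
      ‖inner ℂ (coh W.1) (b i)‖ₑ * ‖inner ℂ (coh W.2) (e i)‖ₑ := fun i =>
    ((continuous_inner_coh (b i)).measurable.enorm.comp measurable_fst).mul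
      ((continuous_inner_coh (e i)).measurable.enorm.comp measurable_snd)
  calc ∑ i, ‖inner ℂ (b i) (T (e i))‖ₑ ≤ ∑ i, C * kernelTest f n
          fun W => ‖inner ℂ (coh W.1) (b i)‖ₑ * ‖inner ℂ (coh W.2) (e i)‖ₑ :=
        Finset.sum_le_sum fun i _ => hC (b i) (e i)
    _ = C * kernelTest f n fun W => ∑ i, ‖inner ℂ (coh W.1) (b i)‖ₑ * ‖inner ℂ (coh W.2) (e i)‖ₑ := by
        rw [← Finset.mul_sum, sum_kernelTest hf n _ hM]
    _ ≤ C * (C' * S * ENNReal.ofReal (cohNormSq d)) := by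
        refine mul_le_mul_right (kernelTest_le fun t ht => ?_) _
        have hk : Measurable fun W => ‖packetKernel t f W‖ₑ := by
          have h := (measurable_packetKernel hf).comp (measurable_prodMk_left (x := t))
          exact h
        calc ∫⁻ W, ‖packetKernel t f W‖ₑ * ∑ i, ‖inner ℂ (coh W.1) (b i)‖ₑ * ‖inner ℂ (coh W.2) (e i)‖ₑ ≤
            ∫⁻ W, ‖packetKernel t f W‖ₑ * ENNReal.ofReal (cohNormSq d) :=
              lintegral_mono fun W => mul_le_mul_right
                (sum_enorm_inner_mul_le he hb (norm_coh_sq W.1) (norm_coh_sq W.2)) _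
          _ = (∫⁻ W, ‖packetKernel t f W‖ₑ) * ENNReal.ofReal (cohNormSq d) := lintegral_mul_const _ hk
          _ ≤ _ := mul_le_mul_left (hC' t ht) _
    _ = _ := by
        push_cast
        rw [ENNReal.ofReal]
        ring

end

section

/-! ### Multi-index derivatives -/

section Partial

variable {X : Type*} [NormedAddCommGroup X] [NormedSpace ℝ X]

theorem dirDeriv_comm {f : X → ℂ} (hf : ContDiff ℝ ∞ f) (a b : X) :
    dirDeriv a (dirDeriv b f) = dirDeriv b (dirDeriv a f) := by
  funext x
  have h2 : ContDiff ℝ 2 f := contDiff_infty.1 hf 2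
  have hd : DifferentiableAt ℝ (fderiv ℝ f) x :=
    ((h2.fderiv_right (m := 1) (by norm_num)).differentiable one_ne_zero) x
  have h : ∀ a b : X, dirDeriv a (dirDeriv b f) x = fderiv ℝ (fderiv ℝ f) x a b := by
    intro a b
    change fderiv ℝ (fun y => fderiv ℝ f y b) x a = _
    rw [fderiv_clm_apply hd (differentiableAt_const b)]
    simp
  have hs : IsSymmSndFDerivAt ℝ f x :=
    h2.contDiffAt.isSymmSndFDerivAt (by rw [minSmoothness_of_isRCLikeNormedField])
  rw [h, h, hs.eq]

/-- The iterated derivative in a list of directions. -/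
def listDeriv (l : List X) (f : X → ℂ) : X → ℂ := l.foldr dirDeriv f

theorem contDiff_listDeriv {f : X → ℂ} (hf : ContDiff ℝ ∞ f) (l : List X) : ContDiff ℝ ∞ (listDeriv l f) := by
  induction l with
  | nil => exact hf
  | cons a l ih => exact contDiff_dirDeriv ih a

theorem listDeriv_perm {f : X → ℂ} (hf : ContDiff ℝ ∞ f) {l l' : List X} (h : l.Perm l') :
    listDeriv l f = listDeriv l' f := by
  induction h with
  | nil => rfl
  | cons a _ ih => exact congrArg (dirDeriv a) ih
  | swap a b l => exact dirDeriv_comm (contDiff_listDeriv hf l) b a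
  | trans _ _ ih1 ih2 => exact ih1.trans ih2

theorem iteratedFDeriv_eq_listDeriv {f : X → ℂ} (hf : ContDiff ℝ ∞ f) (k : ℕ) (v : Fin k → X) (x : X) :
    iteratedFDeriv ℝ k f x v = listDeriv (List.ofFn v) f x := by
  induction k generalizing x with
  | zero => simp [listDeriv]
  | succ k ih =>
    rw [List.ofFn_succ]
    change _ = fderiv ℝ (listDeriv (List.ofFn fun i => v i.succ) f) x (v 0)
    rw [iteratedFDeriv_succ_apply_left]
    have h1 : listDeriv (List.ofFn fun i => v i.succ) f =
        fun y => iteratedFDeriv ℝ k f y (fun i => v i.succ) := by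
      funext y; rw [ih]
    have hd : DifferentiableAt ℝ (iteratedFDeriv ℝ k f) x :=
      hf.differentiable_iteratedFDeriv (by exact_mod_cast WithTop.coe_lt_top _) x
    rw [h1]
    have h2 := ((ContinuousMultilinearMap.apply ℝ (fun _ : Fin k => X) ℂ (fun i => v i.succ)).hasFDerivAt).comp x
      hd.hasFDerivAt
    have h3 : HasFDerivAt (fun y => iteratedFDeriv ℝ k f y (fun i => v i.succ)) _ x := h2
    rw [h3.fderiv]
    rfl

theorem iteratedFDeriv_comp_equiv {f : X → ℂ} (hf : ContDiff ℝ ∞ f) {N k : ℕ} (g : Fin N ≃ Fin k)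
    (v : Fin k → X) (x : X) :
    iteratedFDeriv ℝ N f x (fun j => v (g j)) = iteratedFDeriv ℝ k f x v := by
  have h : N = k := by simpa using Fintype.card_congr g
  subst h
  rw [iteratedFDeriv_eq_listDeriv hf, iteratedFDeriv_eq_listDeriv hf]
  exact congrFun (listDeriv_perm hf (Equiv.Perm.ofFn_comp_perm g v)) x

variable {ι : Type*} [Fintype ι] [DecidableEq ι]

theorem multiDeriv_eq_iteratedFDeriv {f : X → ℂ} (hf : ContDiff ℝ ∞ f) (b : ι → X) {k : ℕ} (r : Fin k → ι) (x : X) :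
    multiDeriv b (fun i => Fintype.card {j // r j = i}) f x = iteratedFDeriv ℝ k f x fun j => b (r j) := by
  set m : ι → ℕ := fun i => Fintype.card {j // r j = i}
  let e : (Σ i, Fin (m i)) ≃ Fin k :=
    (Equiv.sigmaCongrRight fun i => (Fintype.equivFin {j // r j = i}).symm).trans (Equiv.sigmaFiberEquiv r)
  have he : ∀ s : (Σ i, Fin (m i)), r (e s) = s.1 := fun s =>
    ((Fintype.equivFin {j // r j = s.1}).symm s.2).2
  have h := iteratedFDeriv_comp_equiv hf ((Fintype.equivFin (Σ i, Fin (m i))).symm.trans e) (fun j => b (r j)) x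
  rw [← h, multiDeriv]
  congr 1
  funext j
  simp only [Equiv.trans_apply, he]

/-- The tuple `b` spans, with coordinates bounded by the norm. -/
def IsUnitFrame (b : ι → X) : Prop :=
  ∀ v, ∃ c : ι → ℝ, (∀ i, |c i| ≤ ‖v‖) ∧ v = ∑ i, c i • b i

theorem IsUnitFrame.norm_le {b : ι → X} (hb : IsUnitFrame b) {k : ℕ}
    (A : ContinuousMultilinearMap ℝ (fun _ : Fin k => X) ℂ) :
    ‖A‖ ≤ ∑ r : Fin k → ι, ‖A fun j => b (r j)‖ := by
  refine A.opNorm_le_bound (Finset.sum_nonneg fun _ _ => norm_nonneg _) fun v => ?_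
  choose c hc hv using hb
  have h1 : v = fun j => ∑ i, c (v j) i • b i := funext fun j => hv (v j)
  have h2 : A v = ∑ r : Fin k → ι, (∏ j, c (v j) (r j)) • A fun j => b (r j) := by
    conv_lhs => rw [h1]
    rw [A.map_sum]
    exact Finset.sum_congr rfl fun r _ => A.map_smul_univ _ _
  rw [h2, Finset.sum_mul]
  refine (norm_sum_le _ _).trans (Finset.sum_le_sum fun r _ => ?_)
  rw [norm_smul, mul_comm]
  refine mul_le_mul_of_nonneg_left ?_ (norm_nonneg _)
  rw [norm_prod]
  exact Finset.prod_le_prod (fun _ _ => norm_nonneg _) fun j _ => hc (v j) (r j)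

theorem IsUnitFrame.norm_iteratedFDeriv_le {b : ι → X} (hb : IsUnitFrame b) {f : X → ℂ} (hf : ContDiff ℝ ∞ f)
    {k D : ℕ} (hk : k ≤ D) (x : X) :
    ‖iteratedFDeriv ℝ k f x‖ ≤ (Fintype.card (Fin k → ι) : ℝ) * ∑ m ∈ multiIndices ι D, ‖multiDeriv b m f x‖ := by
  refine (hb.norm_le _).trans ?_
  rw [← nsmul_eq_mul]
  refine Finset.sum_le_card_nsmul _ _ _ fun r _ => ?_
  rw [← multiDeriv_eq_iteratedFDeriv hf b r x]
  refine Finset.single_le_sum (f := fun m => ‖multiDeriv b m f x‖) (fun _ _ => norm_nonneg _)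
    (mem_multiIndices.2 ?_)
  refine le_trans (le_of_eq ?_) hk
  rw [← Fintype.card_sigma, Fintype.card_congr (Equiv.sigmaFiberEquiv r), Fintype.card_fin]

theorem IsUnitFrame.exists_derivSum_le {b : ι → X} (hb : IsUnitFrame b) (D : ℕ) :
    ∃ C : ℝ, 0 ≤ C ∧ ∀ f : X → ℂ, ContDiff ℝ ∞ f → ∀ x,
      derivSum D f x ≤ C * ∑ m ∈ multiIndices ι D, ‖multiDeriv b m f x‖ := by
  refine ⟨∑ k ∈ Finset.range (D + 1), (Fintype.card (Fin k → ι) : ℝ), by positivity, fun f hf x => ?_⟩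
  rw [derivSum, Finset.sum_mul]
  exact Finset.sum_le_sum fun k hk =>
    hb.norm_iteratedFDeriv_le hf (Nat.lt_succ_iff.1 (Finset.mem_range.1 hk)) x

theorem continuous_multiDeriv {f : X → ℂ} (hf : ContDiff ℝ ∞ f) (b : ι → X) (m : ι → ℕ) :
    Continuous (multiDeriv b m f) := by
  have h := continuous_iteratedFDeriv_of_smooth hf (Fintype.card (Σ i, Fin (m i)))
  exact (ContinuousMultilinearMap.apply ℝ _ ℂ _).continuous.comp h

end Partial

variable {d : ℕ}

theorem isUnitFrame_phaseDir : IsUnitFrame (phaseDir (d := d)) := by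
  intro v
  have hv : ∀ y : Conf d, y = ∑ i, y i • EuclideanSpace.single i (1 : ℝ) := by
    intro y
    ext j
    simp [Finset.sum_apply, Pi.single_apply]
  refine ⟨Sum.elim (fun i => v.1 i) fun i => v.2 i, ?_, ?_⟩
  · rintro (i | i)
    · exact (PiLp.norm_apply_le v.1 i).trans (norm_fst_le v)
    · exact (PiLp.norm_apply_le v.2 i).trans (norm_snd_le v)
  · rw [Fintype.sum_sum_type]
    simp only [Sum.elim_inl, Sum.elim_inr, phaseDir, Prod.smul_mk, smul_zero]
    refine Prod.ext ?_ ?_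
    · simp only [Prod.fst_add, Prod.fst_sum, Finset.sum_const_zero, add_zero]
      exact hv v.1
    · simp only [Prod.snd_add, Prod.snd_sum, Finset.sum_const_zero, zero_add]
      exact hv v.2

theorem isUnitFrame_pairDir : IsUnitFrame (pairDir (d := d)) := by
  intro v
  obtain ⟨c₁, h1, e1⟩ := isUnitFrame_phaseDir v.1
  obtain ⟨c₂, h2, e2⟩ := isUnitFrame_phaseDir v.2
  refine ⟨Sum.elim c₁ c₂, ?_, ?_⟩
  · rintro (i | i)
    · exact (h1 i).trans (norm_fst_le v)
    · exact (h2 i).trans (norm_snd_le v)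
  · rw [Fintype.sum_sum_type]
    simp only [Sum.elim_inl, Sum.elim_inr, pairDir, Prod.smul_mk, smul_zero]
    refine Prod.ext ?_ ?_
    · simp only [Prod.fst_add, Prod.fst_sum, Finset.sum_const_zero, add_zero]
      exact e1
    · simp only [Prod.snd_add, Prod.snd_sum, Finset.sum_const_zero, zero_add]
      exact e2

theorem IsSmoothL1.sl1 {p : Phase d → ℂ} (hp : IsSmoothL1 p) : SL1 p := by
  refine SL1.of_bound hp.1 fun k => ⟨_, ?_, isUnitFrame_phaseDir.norm_iteratedFDeriv_le hp.1 le_rfl⟩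
  exact (integrable_finsetSum _ fun m _ => (hp.2 m).norm).const_mul _

end

section

/-! ### Bounds by multi-index derivatives -/

variable {d : ℕ}

theorem exists_derivSum_shear_le (d D : ℕ) : ∃ C : ℝ, 0 ≤ C ∧ ∀ F : Phase d × Phase d → ℂ, ContDiff ℝ ∞ F →
    ∀ w, derivSum D (fun w => F (shear d w)) w ≤
      C * ∑ m ∈ multiIndices ((Fin d ⊕ Fin d) ⊕ (Fin d ⊕ Fin d)) D, ‖multiDeriv pairDir m F (shear d w)‖ := by
  obtain ⟨C, hC0, hC⟩ := (isUnitFrame_pairDir (d := d)).exists_derivSum_le D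
  refine ⟨(1 + ‖shear d‖) ^ D * C, by positivity, fun F hF w => ?_⟩
  rw [mul_assoc]
  refine le_trans ?_ (mul_le_mul_of_nonneg_left (hC F hF (shear d w)) (by positivity))
  rw [derivSum, derivSum, Finset.mul_sum]
  refine Finset.sum_le_sum fun k hk => (norm_iteratedFDeriv_comp_clm_le hF (shear d) k w).trans ?_
  refine mul_le_mul_of_nonneg_right ?_ (norm_nonneg _)
  have h0 := norm_nonneg (shear d)
  calc ‖shear d‖ ^ k ≤ (1 + ‖shear d‖) ^ k := pow_le_pow_left₀ h0 (by linarith) k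
    _ ≤ _ := pow_le_pow_right₀ (by linarith) (Nat.lt_succ_iff.1 (Finset.mem_range.1 hk))

theorem exists_ofReal_derivSum_shear_le (d G D : ℕ) : ∃ C : ℝ≥0, ∀ F : Phase d × Phase d → ℂ, ContDiff ℝ ∞ F →
    ∀ w : Phase d × Phase d, ENNReal.ofReal (derivSum D (fun w => F (shear d w)) w / japBracket w.2 ^ G) ≤
      C * ∑ m ∈ multiIndices ((Fin d ⊕ Fin d) ⊕ (Fin d ⊕ Fin d)) D,
        ENNReal.ofReal (‖multiDeriv pairDir m F (shear d w)‖ / japBracket w.2 ^ G) := by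
  obtain ⟨C, hC0, hC⟩ := exists_derivSum_shear_le d D
  refine ⟨C.toNNReal, fun F hF w => ?_⟩
  have hj : 0 ≤ japBracket w.2 ^ G := pow_nonneg (Real.sqrt_nonneg _) _
  rw [← ENNReal.ofReal_sum_of_nonneg fun m _ => div_nonneg (norm_nonneg _) hj]
  change _ ≤ ENNReal.ofReal C * _
  rw [← ENNReal.ofReal_mul hC0, ← Finset.sum_div, ← mul_div_assoc]
  exact ENNReal.ofReal_le_ofReal (div_le_div_of_nonneg_right (hC F hF w) hj)

theorem continuous_weighted_multiDeriv {F : Phase d × Phase d → ℂ} (hF : ContDiff ℝ ∞ F) (G : ℕ)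
    (m : (Fin d ⊕ Fin d) ⊕ (Fin d ⊕ Fin d) → ℕ) :
    Continuous fun w : Phase d × Phase d =>
      ENNReal.ofReal (‖multiDeriv pairDir m F w‖ / japBracket (w.1 - w.2) ^ G) := by
  refine ENNReal.continuous_ofReal.comp ((continuous_multiDeriv hF pairDir m).norm.div ?_ fun w => ?_)
  · unfold japBracket; fun_prop
  · have : 0 < japBracket (w.1 - w.2) := Real.sqrt_pos.2 (by positivity)
    positivity

theorem exists_lintegral_shear_le_weightedL1 (d G D : ℕ) : ∃ C : ℝ≥0, ∀ F : Phase d × Phase d → ℂ,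
    ContDiff ℝ ∞ F → ∫⁻ w : Phase d × Phase d,
      ENNReal.ofReal (derivSum D (fun w => F (shear d w)) w / japBracket w.2 ^ G) ≤ C * weightedL1 G D F := by
  obtain ⟨C, hC⟩ := exists_ofReal_derivSum_shear_le d G D
  refine ⟨C, fun F hF => (lintegral_mono (hC F hF)).trans (le_of_eq ?_)⟩
  rw [lintegral_const_mul' _ _ ENNReal.coe_ne_top, weightedL1]
  have hm : ∀ m, Measurable fun w : Phase d × Phase d =>
      ENNReal.ofReal (‖multiDeriv pairDir m F w‖ / japBracket (w.1 - w.2) ^ G) := fun m =>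
    (continuous_weighted_multiDeriv hF G m).measurable
  have hs : ∀ m, ∀ w : Phase d × Phase d,
      ENNReal.ofReal (‖multiDeriv pairDir m F (shear d w)‖ / japBracket w.2 ^ G) =
      (fun w : Phase d × Phase d => ENNReal.ofReal (‖multiDeriv pairDir m F w‖ / japBracket (w.1 - w.2) ^ G))
        (shear d w) := by
    intro m w
    simp only [shear_apply, add_sub_cancel_left]
  simp only [hs]
  congr 1
  refine (lintegral_finsetSum _ fun m _ => (hm m).comp (shear d).continuous.measurable).trans ?_
  refine Finset.sum_congr rfl fun m _ => ?_
  refine (measurePreserving_shear.lintegral_comp (hm m)).trans ?_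
  exact lintegral_prod_symm _ (hm m).aemeasurable

theorem exists_lintegral_shear_le_weightedSup (d G D : ℕ) : ∃ C : ℝ≥0, ∀ F : Phase d × Phase d → ℂ,
    ContDiff ℝ ∞ F → ∫⁻ v : Phase d, ⨆ s : Phase d,
      ENNReal.ofReal (derivSum D (fun w => F (shear d w)) (s, v) / japBracket v ^ G) ≤ C * weightedSup G D F := by
  obtain ⟨C, hC⟩ := exists_ofReal_derivSum_shear_le d G D
  refine ⟨C, fun F hF => ?_⟩
  set Φ : ((Fin d ⊕ Fin d) ⊕ (Fin d ⊕ Fin d) → ℕ) → Phase d × Phase d → ℝ≥0∞ := fun m w =>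
    ENNReal.ofReal (‖multiDeriv pairDir m F w‖ / japBracket (w.1 - w.2) ^ G)
  have hΦ : ∀ m, Continuous (Φ m) := continuous_weighted_multiDeriv hF G
  have hsup : ∀ m v, (⨆ (x : Phase d) (y : Phase d) (_ : x - y = v), Φ m (x, y)) = ⨆ s, Φ m (s + v, s) := by
    intro m v
    refine le_antisymm (iSup_le fun x => iSup_le fun y => iSup_le fun h => ?_) (iSup_le fun s => ?_)
    · have : x = y + v := by rw [← h]; abel
      rw [this]
      exact le_iSup (fun s => Φ m (s + v, s)) y
    · exact le_iSup_of_le (s + v) (le_iSup_of_le s (le_iSup_of_le (add_sub_cancel_left s v) le_rfl))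
  have hm : ∀ m, Measurable fun v => ⨆ s, Φ m (s + v, s) := fun m =>
    (lowerSemicontinuous_iSup fun s => Continuous.lowerSemicontinuous
      ((hΦ m).comp' (by fun_prop : Continuous fun v => (s + v, s)))).measurable
  have hw : weightedSup G D F = ∑ m ∈ multiIndices ((Fin d ⊕ Fin d) ⊕ (Fin d ⊕ Fin d)) D,
      ∫⁻ v : Phase d, ⨆ s, Φ m (s + v, s) :=
    Finset.sum_congr rfl fun m _ => lintegral_congr fun v => hsup m v
  rw [hw, ← lintegral_finsetSum _ fun m _ => hm m, ← lintegral_const_mul' _ _ ENNReal.coe_ne_top]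
  refine lintegral_mono fun v => iSup_le fun s => (hC F hF (s, v)).trans ?_
  refine mul_le_mul_right (Finset.sum_le_sum fun m _ => ?_) _
  refine le_iSup_of_le s (le_of_eq ?_)
  simp only [Φ, shear_apply, add_sub_cancel_left]

end

end Weyl

end

theorem lemma3p3 (d G : ℕ) :
    ∃ C C' : ℝ≥0, ∀ p q : Weyl.Phase d → ℂ, Weyl.IsSmoothL1 p → Weyl.IsSmoothL1 q → ∀ n : ℕ,
      (Weyl.IsWeylOp p (Weyl.op p) ∧ Weyl.IsWeylOp q (Weyl.op q) ∧
        Weyl.IsWeylOp (Weyl.moyalSum p q n) (Weyl.op (Weyl.moyalSum p q n))) ∧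
      Weyl.traceNorm (Weyl.op p ∘L Weyl.op q - Weyl.op (Weyl.moyalSum p q n)) ≤
        C * Weyl.weightedL1 G (G + 4 * d + 2) (Weyl.moyalTerm p q (n + 1)) ∧
      ‖Weyl.op p ∘L Weyl.op q - Weyl.op (Weyl.moyalSum p q n)‖ₑ ≤
        C' * Weyl.weightedSup G (G + 3 * d + 3) (Weyl.moyalTerm p q (n + 1)) := by
  obtain ⟨C₁, h1⟩ := Weyl.exists_traceNorm_remainder_le d G
  obtain ⟨C₂, h2⟩ := Weyl.exists_lintegral_shear_le_weightedL1 d G (G + 4 * d + 2)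
  obtain ⟨C₃, h3⟩ := Weyl.exists_enorm_remainder_le d G
  obtain ⟨C₄, h4⟩ := Weyl.exists_lintegral_shear_le_weightedSup d G (G + 3 * d + 3)
  refine ⟨C₁ * C₂, C₃ * C₄, fun p q hp hq n => ?_⟩
  have hp' := hp.sl1
  have hq' := hq.sl1
  have hF := (hp'.moyalTerm hq' (n + 1)).1
  refine ⟨⟨Weyl.isWeylOp_op hp'.integrable, Weyl.isWeylOp_op hq'.integrable,
    Weyl.isWeylOp_op (Weyl.integrable_moyalSum hp' hq' n)⟩, ?_, ?_⟩
  · rw [ENNReal.coe_mul, mul_assoc]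
    exact (h1 p q hp' hq' n).trans (mul_le_mul_right (h2 _ hF) _)
  · rw [ENNReal.coe_mul, mul_assoc]
    exact (h3 p q hp' hq' n).trans (mul_le_mul_right (h4 _ hF) _)
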